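/- Conventions. A pentagon is a simple (not necessarily convex) closed pentagonal region in the Euclidean plane. A unit-area pentagon is Cairo, respectively Prismatic, if it is circumscribed about a circle and has three angles of $2\pi/3$ and two right angles which are nonadjacent, respectively adjacent. A unit-area pentagon is efficient if its perimeter is at most that of a unit-area Cairo pentagon. A Type 2 non-convex pentagon is a pentagon with exactly two interior angles larger than $\pi$. Given a family of angles $(a_i)$, the angle $a_j$ is said to tile if there are non-negative integers $m_i$, only finitely many of them nonzero, with $m_j\ge 1$ and $\sum_i m_i a_i = 2\pi$. The perimeter of a tiling of a torus is the total length of its edges, each edge counted once. Proposition. Let $\mathbb{R}^2/\Lambda$ be a flat torus ($\Lambda$ a lattice of rank two) with an edge-to-edge tiling by finitely many unit-area pentagons, each of which is an efficient pentagon or a Type 2 non-convex pentagon. Assume that each efficient pentagon of the tiling has at most four angles (among its five, counted vertex by vertex) that tile with respect to the family of all interior angles of all efficient pentagons of the tiling. Then the perimeter per tile (the perimeter of the tiling divided by the number of tiles) is strictly greater than half the perimeter of a unit-area Prismatic pentagon. -/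

import Mathlib

open Set MeasureTheory Filter Topology

noncomputable section

/-- A (simple, not necessarily convex) pentagon in the Euclidean plane `ℂ`: five vertices in cyclic
order whose edges form a simple closed polygonal curve, together with the compact region bounded by
that curve.  (By the Jordan curve theorem the curve bounds exactly one nonempty regular closed
compact set, so `region` is determined by the vertices.) -/
structure Pentagon extends Polygon ℂ 5 where
  /-- consecutive edges meet only in their common vertex -/
  edge_inter_succ : ∀ k : Fin 5,
    toPolygon.edgeSet ℝ k ∩ toPolygon.edgeSet ℝ (k + 1) = {vertices (k + 1)}
  /-- non-consecutive edges are disjoint -/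
  edge_disjoint : ∀ k : Fin 5, Disjoint (toPolygon.edgeSet ℝ k) (toPolygon.edgeSet ℝ (k + 2))
  /-- the closed region bounded by the polygonal curve -/
  region : Set ℂ
  isCompact_region : IsCompact region
  closure_interior_region : closure (interior region) = region
  frontier_region : frontier region = toPolygon.boundary ℝ

namespace Pentagon

/-- The `k`-th edge, the segment from vertex `k` to vertex `k + 1`. -/
def edge (P : Pentagon) (k : Fin 5) : Set ℂ := P.toPolygon.edgeSet ℝ k

/-- The length of the `k`-th edge. -/
def edgeLength (P : Pentagon) (k : Fin 5) : ℝ := dist (P.vertices k) (P.vertices (k + 1))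

def perimeter (P : Pentagon) : ℝ := ∑ k, P.edgeLength k

def area (P : Pentagon) : ℝ := volume.real P.region

/-- The interior angle (in radians, between `0` and `2π`) at the `k`-th vertex: the total measure
of the directions `θ` which point from the vertex into the pentagon. -/
def angle (P : Pentagon) (k : Fin 5) : ℝ :=
  volume.real {θ : ℝ | θ ∈ Ioc (-Real.pi) Real.pi ∧
    ∀ᶠ t : ℝ in 𝓝[>] 0, P.vertices k + t * Complex.exp (θ * Complex.I) ∈ P.region}

/-- The pentagon is circumscribed about a circle: it contains a disk whose bounding circle
touches every edge. -/
def IsCircumscribed (P : Pentagon) : Prop :=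
  ∃ (c : ℂ) (r : ℝ), 0 < r ∧ Metric.closedBall c r ⊆ P.region ∧
    ∀ k, ∃ z ∈ P.edge k, dist z c = r

/-- Three angles of `2π/3` and two nonadjacent right angles, circumscribed about a circle. -/
def IsCairo (P : Pentagon) : Prop :=
  P.IsCircumscribed ∧ ∃ k, P.angle k = Real.pi / 2 ∧ P.angle (k + 1) = 2 * Real.pi / 3 ∧
    P.angle (k + 2) = Real.pi / 2 ∧ P.angle (k + 3) = 2 * Real.pi / 3 ∧
    P.angle (k + 4) = 2 * Real.pi / 3

/-- Three angles of `2π/3` and two adjacent right angles, circumscribed about a circle. -/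
def IsPrismatic (P : Pentagon) : Prop :=
  P.IsCircumscribed ∧ ∃ k, P.angle k = Real.pi / 2 ∧ P.angle (k + 1) = Real.pi / 2 ∧
    P.angle (k + 2) = 2 * Real.pi / 3 ∧ P.angle (k + 3) = 2 * Real.pi / 3 ∧
    P.angle (k + 4) = 2 * Real.pi / 3

/-- A unit-area pentagon is efficient if its perimeter is at most that of a unit-area Cairo
pentagon. -/
def IsEfficient (P : Pentagon) : Prop :=
  P.area = 1 ∧ ∃ C : Pentagon, C.IsCairo ∧ C.area = 1 ∧ P.perimeter ≤ C.perimeter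

/-- A Type 2 non-convex pentagon: exactly two interior angles are larger than `π`. -/
def IsType2 (P : Pentagon) : Prop := {k | Real.pi < P.angle k}.ncard = 2

/-- Two tiles meet edge-to-edge: each common point is a vertex of both, or lies on an entire edge
common to both. -/
def EdgeToEdge (P Q : Pentagon) : Prop :=
  ∀ z ∈ P.region ∩ Q.region,
    (∃ k l, z = P.vertices k ∧ z = Q.vertices l) ∨ ∃ k l, P.edge k = Q.edge l ∧ z ∈ P.edge k

theorem edge_eq_segment (P : Pentagon) (k : Fin 5) :
    P.edge k = segment ℝ (P.vertices k) (P.vertices (k + 1)) := by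
  simp [edge, Polygon.edgeSet, affineSegment_eq_segment]

theorem edgeLength_eq_diam (P : Pentagon) (k : Fin 5) :
    P.edgeLength k = Metric.diam (P.edge k) := by
  rw [edge_eq_segment, ← convexHull_pair, convexHull_diam, Metric.diam_pair, edgeLength]

theorem edgeSet_translate (p : Polygon ℂ 5) (w : ℂ) (k : Fin 5) :
    (⟨fun j => w + p.vertices j⟩ : Polygon ℂ 5).edgeSet ℝ k = (w + ·) '' p.edgeSet ℝ k := by
  simp only [Polygon.edgeSet, affineSegment_eq_segment, segment_translate_image]

/-- The translate of a pentagon by the vector `w`. -/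
def translate (P : Pentagon) (w : ℂ) : Pentagon where
  vertices k := w + P.vertices k
  edge_inter_succ k := by
    rw [edgeSet_translate, edgeSet_translate, ← image_inter (add_right_injective w),
      P.edge_inter_succ, image_singleton]
  edge_disjoint k := by
    rw [edgeSet_translate, edgeSet_translate, disjoint_image_iff (add_right_injective w)]
    exact P.edge_disjoint k
  region := (w + ·) '' P.region
  isCompact_region := P.isCompact_region.image (by fun_prop)
  closure_interior_region := by
    rw [show ((w + ·) : ℂ → ℂ) = Homeomorph.addLeft w from rfl, ← Homeomorph.image_interior,
      ← Homeomorph.image_closure, P.closure_interior_region]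
  frontier_region := by
    rw [show ((w + ·) : ℂ → ℂ) = Homeomorph.addLeft w from rfl, ← Homeomorph.image_frontier,
      P.frontier_region]
    simp only [Polygon.boundary, image_iUnion, edgeSet_translate]
    rfl

theorem translate_edge (P : Pentagon) (w : ℂ) (k : Fin 5) :
    (P.translate w).edge k = (w + ·) '' P.edge k :=
  edgeSet_translate P.toPolygon w k

theorem translate_edgeLength (P : Pentagon) (w : ℂ) (k : Fin 5) :
    (P.translate w).edgeLength k = P.edgeLength k := by
  simp [edgeLength, translate]

end Pentagon

/-- An edge-to-edge tiling of the flat torus `ℂ / Λ` by finitely many pentagons, indexed by `ι`.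
It is given by a lift of each tile to the plane: the translates of these lifts by the lattice `Λ`
cover the plane without overlaps and meet edge-to-edge.  Each tile of the torus has exactly one
index, because translates with different `(i, w)` have disjoint interiors. -/
structure TorusTiling (Λ : Submodule ℤ ℂ) (ι : Type*) where
  tile : ι → Pentagon
  cover : ⋃ p : ι × Λ, ((tile p.1).translate p.2).region = univ
  disjoint : Pairwise fun p q : ι × Λ =>
    Disjoint (interior ((tile p.1).translate p.2).region)
      (interior ((tile q.1).translate q.2).region)
  edgeToEdge : Pairwise fun p q : ι × Λ =>
    ((tile p.1).translate p.2).EdgeToEdge ((tile q.1).translate q.2)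

namespace TorusTiling

variable {Λ : Submodule ℤ ℂ} {ι : Type*}

/-- Two edges of (lifted) tiles are the same edge of the torus if they differ by a lattice
translation. -/
def edgeSetoid (T : TorusTiling Λ ι) : Setoid (ι × Fin 5) where
  r e f := ∃ w ∈ Λ, ((T.tile e.1).translate w).edge e.2 = (T.tile f.1).edge f.2
  iseqv := by
    simp only [Pentagon.translate_edge]
    refine ⟨fun e => ⟨0, Λ.zero_mem, by simp⟩, ?_, ?_⟩
    · rintro e f ⟨w, hw, h⟩
      exact ⟨-w, Λ.neg_mem hw, by rw [← h, image_image]; simp⟩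
    · rintro e f g ⟨w, hw, h⟩ ⟨w', hw', h'⟩
      exact ⟨w' + w, Λ.add_mem hw' hw, by rw [← h', ← h, image_image]; simp [add_assoc]⟩

/-- The edges of the tiled torus (an edge common to two tiles is a single element). -/
def Edge (T : TorusTiling Λ ι) : Type _ := Quotient T.edgeSetoid

/-- The length of an edge of the tiled torus. -/
def edgeLength (T : TorusTiling Λ ι) : T.Edge → ℝ :=
  Quotient.lift (fun e => (T.tile e.1).edgeLength e.2) <| by
    rintro e f ⟨w, -, h⟩
    rw [← Pentagon.translate_edgeLength _ w, Pentagon.edgeLength_eq_diam, h,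
      Pentagon.edgeLength_eq_diam]

/-- The perimeter of the tiling: the total length of its edges in the torus, each counted once
(a finite sum when `ι` is finite). -/
def perimeter (T : TorusTiling Λ ι) : ℝ := ∑ᶠ e : T.Edge, T.edgeLength e

def perimeterPerTile (T : TorusTiling Λ ι) : ℝ := T.perimeter / Nat.card ι

/-- The indices of all angles of the efficient tiles. -/
def EfficientCorner (T : TorusTiling Λ ι) : Type _ := {i : ι // (T.tile i).IsEfficient} × Fin 5

/-- The angle at a corner of an efficient tile. -/
def cornerAngle (T : TorusTiling Λ ι) (c : T.EfficientCorner) : ℝ := (T.tile c.1.1).angle c.2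

end TorusTiling

/-- Given a family of angles `a`, the angle `a j` tiles if some angles of the family, with positive
multiplicities and `a j` among them, add up to `2π`. -/
def AngleTiles {κ : Type*} (a : κ → ℝ) (j : κ) : Prop :=
  ∃ m : κ →₀ ℕ, m j ≠ 0 ∧ (m.sum fun i n => n * a i) = 2 * Real.pi

end

/-!
The perimeter of a unit-area pentagon is more than `3.811` by the isoperimetric inequality for
pentagons; that of one with two reflex angles is more than `4.5589`, because leaving out its reflex
vertices gives a triangle of larger area and smaller perimeter. A Prismatic pentagon has perimeter
less than `3.8638`, so it suffices to find at most twelve efficient tiles for every other tile.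

An angle of at most `2π / 5` could be cut off so as to violate the isoperimetric inequality, hence
the angles of an efficient tile are larger, and a vertex of the tiling with a corner of another
tile has room for at most four efficient corners, or two if that corner is reflex. Every efficient
tile has a corner at such a mixed vertex, since otherwise all of its angles would tile. Sharing the
efficient corners of a mixed vertex equally among its other corners gives at most
`2 * 2 + 3 * 4 = 16` of them to every other tile. Two corrections bring this down to twelve: an
efficient tile with an edge on another tile has more than one mixed corner, and a corner of another
tile shares its vertex with a second one unless both of its edges face efficient tiles.
-/

open scoped Real ComplexConjugate

/-- The determinant of two vectors of the plane: twice the signed area of the triangle that they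
span with the origin. -/
def cross (a b : ℂ) : ℝ := a.re * b.im - a.im * b.re

/-- The area enclosed by a closed polygonal curve, counted with winding numbers and given by the
shoelace formula. -/
noncomputable def signedArea {n : ℕ} [NeZero n] (z : Fin n → ℂ) : ℝ :=
  (∑ k, cross (z k) (z (k + 1))) / 2

/-- The length of a closed polygonal curve. -/
noncomputable def polyLength {n : ℕ} [NeZero n] (z : Fin n → ℂ) : ℝ := ∑ k, dist (z k) (z (k + 1))

theorem cross_eq_im (a b : ℂ) : cross a b = (conj a * b).im := by
  simp only [cross, Complex.mul_im, Complex.conj_re, Complex.conj_im]; ring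

theorem cross_mul_mul (a b e : ℂ) : cross (a * e) (b * e) = ‖e‖ ^ 2 * cross a b := by
  rw [Complex.sq_norm, Complex.normSq_apply]
  simp only [cross, Complex.mul_re, Complex.mul_im]; ring

section ClosedCurve

variable {n : ℕ} [NeZero n] (z : Fin n → ℂ)

theorem polyLength_nonneg : 0 ≤ polyLength z := Finset.sum_nonneg fun _ _ => dist_nonneg

theorem signedArea_rotate (k : Fin n) : signedArea (fun j => z (j + k)) = signedArea z := by
  have := Equiv.sum_comp (Equiv.addRight k) (fun j => cross (z j) (z (j + 1)))
  simpa only [signedArea, Equiv.coe_addRight, add_right_comm _ k] using congrArg (· / 2) this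

theorem polyLength_rotate (k : Fin n) : polyLength (fun j => z (j + k)) = polyLength z := by
  have := Equiv.sum_comp (Equiv.addRight k) (fun j => dist (z j) (z (j + 1)))
  simpa only [polyLength, Equiv.coe_addRight, add_right_comm _ k] using this

theorem signedArea_sub_const (a : ℂ) : signedArea (fun k => z k - a) = signedArea z := by
  have hshift : ∑ k, cross a (z (k + 1)) = ∑ k, cross a (z k) :=
    Equiv.sum_comp (Equiv.addRight (1 : Fin n)) fun k => cross a (z k)
  have hcross (k : Fin n) : cross (z k - a) (z (k + 1) - a) =
      cross (z k) (z (k + 1)) + (cross a (z k) - cross a (z (k + 1))) := by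
    simp only [cross, Complex.sub_re, Complex.sub_im]; ring
  simp only [signedArea, hcross, Finset.sum_add_distrib, Finset.sum_sub_distrib, hshift, sub_self,
    add_zero]

theorem polyLength_sub_const (a : ℂ) : polyLength (fun k => z k - a) = polyLength z := by
  simp only [polyLength, dist_sub_right]

theorem continuous_signedArea : Continuous (signedArea : (Fin n → ℂ) → ℝ) := by
  unfold signedArea cross; fun_prop

theorem continuous_polyLength : Continuous (polyLength : (Fin n → ℂ) → ℝ) := by
  unfold polyLength; fun_prop

theorem dist_zero_le_polyLength (k : Fin n) : dist (z 0) (z k) ≤ polyLength z := by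
  set f : ℕ → ℂ := fun i => z (Fin.ofNat n i)
  calc dist (z 0) (z k) ≤ ∑ i ∈ Finset.range k, dist (f i) (f (i + 1)) := by
        simpa [f] using dist_le_range_sum_dist f k
    _ ≤ ∑ i ∈ Finset.range n, dist (f i) (f (i + 1)) :=
        Finset.sum_le_sum_of_subset_of_nonneg (Finset.range_mono k.2.le) fun _ _ _ => dist_nonneg
    _ = polyLength z := by
        rw [← Fin.sum_univ_eq_sum_range fun i => dist (f i) (f (i + 1))]
        refine Finset.sum_congr rfl fun k _ => ?_
        have hk : Fin.ofNat n k = k := Fin.ext (Nat.mod_eq_of_lt k.2)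
        have hk' : Fin.ofNat n (k + 1) = k + 1 := Fin.ext (by simp [Fin.val_add])
        simp only [f, hk, hk']

end ClosedCurve

section Fourier

open ZMod

variable {n : ℕ} [NeZero n]

theorem sum_conj_dft_mul_dft (f g : ZMod n → ℂ) :
    ∑ k, conj (𝓕 f k) * 𝓕 g k = n * ∑ j, conj (f j) * g j := by
  calc ∑ k, conj (𝓕 f k) * 𝓕 g k
      = ∑ k, ∑ j, conj (f j) * (stdAddChar (j * k) * 𝓕 g k) := by
        refine Finset.sum_congr rfl fun k _ => ?_
        rw [dft_apply, map_sum, Finset.sum_mul]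
        refine Finset.sum_congr rfl fun j _ => ?_
        rw [smul_eq_mul, map_mul, ← AddChar.map_neg_eq_conj, neg_neg]; ring
    _ = ∑ j, conj (f j) * 𝓕 (𝓕 g) (-j) := by
        rw [Finset.sum_comm]
        refine Finset.sum_congr rfl fun j _ => ?_
        rw [dft_apply, Finset.mul_sum]
        refine Finset.sum_congr rfl fun k _ => ?_
        rw [smul_eq_mul, mul_neg, neg_neg, mul_comm j k]
    _ = n * ∑ j, conj (f j) * g j := by
        simp only [dft_dft, neg_neg, smul_eq_mul, Finset.mul_sum]
        exact Finset.sum_congr rfl fun j _ => by ring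

theorem dft_shift (f : ZMod n → ℂ) (k : ZMod n) :
    𝓕 (fun j => f (j + 1)) k = stdAddChar k * 𝓕 f k := by
  simp only [dft_apply, smul_eq_mul, Finset.mul_sum]
  rw [← Equiv.sum_comp (Equiv.addRight (1 : ZMod n))
    (fun j => stdAddChar k * (stdAddChar (-(j * k)) * f j))]
  refine Finset.sum_congr rfl fun j _ => ?_
  rw [Equiv.coe_addRight, ← mul_assoc, ← AddChar.map_add_eq_mul]
  congr 2; ring

theorem tan_mul_im_stdAddChar_le (hn : 3 ≤ n) (k : ZMod n) :
    2 * Real.tan (π / n) * (stdAddChar k).im ≤ ‖stdAddChar k - 1‖ ^ 2 := by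
  have hn0 : (0 : ℝ) < n := by positivity
  have hn3 : (3 : ℝ) ≤ n := by exact_mod_cast hn
  set φ : ℝ := π * k.val / n
  have hexp : stdAddChar k = Complex.exp ((2 * φ : ℝ) * Complex.I) := by
    conv_lhs => rw [← ZMod.natCast_zmod_val k]
    rw [← Int.cast_natCast (R := ZMod n), stdAddChar_coe]
    congr 1; push_cast [φ]; ring
  have hcos : 0 < Real.cos (π / n) := Real.cos_pos_of_mem_Ioo
    ⟨by linarith [Real.pi_pos, show 0 < π / n by positivity],
      by rw [div_lt_div_iff₀ hn0 two_pos]; nlinarith [Real.pi_pos]⟩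
  have hsin : 0 ≤ Real.sin φ * Real.sin (φ - π / n) := by
    rcases Nat.eq_zero_or_pos k.val with h | h
    · simp [φ, h]
    have hk : (1 : ℝ) ≤ k.val := by exact_mod_cast h
    have hkn : (k.val : ℝ) ≤ n := by exact_mod_cast (ZMod.val_lt k).le
    have hφ : φ ≤ π := by rw [div_le_iff₀ hn0]; gcongr
    have hφ' : π / n ≤ φ := by
      rw [div_le_div_iff_of_pos_right hn0]; nlinarith [Real.pi_pos]
    exact mul_nonneg (Real.sin_nonneg_of_nonneg_of_le_pi (by positivity) hφ)
      (Real.sin_nonneg_of_nonneg_of_le_pi (by linarith)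
        (by linarith [show 0 ≤ π / n by positivity]))
  have him : (stdAddChar k).im = 2 * Real.sin φ * Real.cos φ := by
    rw [hexp, Complex.exp_ofReal_mul_I_im, Real.sin_two_mul]
  have hnorm : ‖stdAddChar k - 1‖ ^ 2 = 4 * Real.sin φ ^ 2 := by
    rw [hexp, Complex.sq_norm, Complex.normSq_apply, Complex.sub_re, Complex.sub_im,
      Complex.exp_ofReal_mul_I_re, Complex.exp_ofReal_mul_I_im, Real.sin_two_mul, Real.cos_two_mul']
    simp only [Complex.one_re, Complex.one_im]
    linear_combination (Real.sin φ ^ 2 + Real.cos φ ^ 2 - 1) * Real.sin_sq_add_cos_sq φ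
  rw [him, hnorm, Real.tan_eq_sin_div_cos, ← sub_nonneg]
  rw [Real.sin_sub] at hsin
  have : 4 * Real.sin φ ^ 2 -
      2 * (Real.sin (π / n) / Real.cos (π / n)) * (2 * Real.sin φ * Real.cos φ) =
      4 / Real.cos (π / n) * (Real.sin φ *
        (Real.sin φ * Real.cos (π / n) - Real.cos φ * Real.sin (π / n))) := by
    field_simp; ring
  rw [this]
  positivity

theorem tan_mul_sum_cross_le (hn : 3 ≤ n) (z : ZMod n → ℂ) :
    2 * Real.tan (π / n) * ∑ k, cross (z k) (z (k + 1)) ≤ ∑ k, dist (z k) (z (k + 1)) ^ 2 := by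
  have hn0 : (0 : ℝ) < n := by positivity
  have hcross : n * ∑ k, cross (z k) (z (k + 1)) = ∑ k, ‖𝓕 z k‖ ^ 2 * (stdAddChar k).im := by
    have h := congrArg Complex.im (sum_conj_dft_mul_dft z fun j => z (j + 1))
    rw [← Complex.ofReal_natCast, Complex.im_ofReal_mul, Complex.im_sum, Complex.im_sum] at h
    simp only [cross_eq_im]
    rw [← h]
    refine Finset.sum_congr rfl fun k _ => ?_
    rw [dft_shift, mul_left_comm, Complex.conj_mul', ← Complex.ofReal_pow, mul_comm,
      Complex.im_ofReal_mul]
  have hdist : n * ∑ k, dist (z k) (z (k + 1)) ^ 2 =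
      ∑ k, ‖𝓕 z k‖ ^ 2 * ‖(stdAddChar k : ℂ) - 1‖ ^ 2 := by
    have h := sum_conj_dft_mul_dft (fun j => z (j + 1) - z j) fun j => z (j + 1) - z j
    have hd (k : ZMod n) : 𝓕 (fun j => z (j + 1) - z j) k = (stdAddChar k - 1) * 𝓕 z k := by
      have := congrFun (map_sub 𝓕 (fun j => z (j + 1)) z) k
      rw [sub_mul, one_mul, ← dft_shift]
      exact this
    simp only [hd, Complex.conj_mul', norm_mul] at h
    norm_cast at h
    simp only [dist_eq_norm, norm_sub_rev (z _) (z (_ + 1)), ← h]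
    exact Finset.sum_congr rfl fun k _ => by ring
  refine le_of_mul_le_mul_left ?_ hn0
  calc n * (2 * Real.tan (π / n) * ∑ k, cross (z k) (z (k + 1)))
      = ∑ k, ‖𝓕 z k‖ ^ 2 * (2 * Real.tan (π / n) * (stdAddChar k).im) := by
        rw [mul_left_comm, hcross, Finset.mul_sum]
        exact Finset.sum_congr rfl fun k _ => by ring
    _ ≤ ∑ k, ‖𝓕 z k‖ ^ 2 * ‖(stdAddChar k : ℂ) - 1‖ ^ 2 := by
        gcongr with k
        exact tan_mul_im_stdAddChar_le hn k
    _ = n * ∑ k, dist (z k) (z (k + 1)) ^ 2 := hdist.symm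

end Fourier

section Equilateral

theorem one_add_im_sq_le (w : ℂ) : 1 + w.im ^ 2 ≤ ((‖w + 1‖ + ‖w - 1‖) / 2) ^ 2 := by
  have hsum : (w + 1) - conj (w - 1) = 2 * (1 + w.im * Complex.I) := by
    apply Complex.ext <;> simp <;> ring
  have hle : 2 * ‖1 + w.im * Complex.I‖ ≤ ‖w + 1‖ + ‖w - 1‖ := by
    rw [← Complex.norm_two, ← norm_mul, ← hsum, ← Complex.norm_conj (w - 1)]
    exact norm_sub_le _ _
  calc 1 + w.im ^ 2 = ‖1 + w.im * Complex.I‖ ^ 2 := by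
        rw [Complex.sq_norm, Complex.normSq_apply]; simp; ring
    _ ≤ ((‖w + 1‖ + ‖w - 1‖) / 2) ^ 2 := by gcongr; linarith

theorem exists_isosceles (B C D : ℂ) : ∃ C' : ℂ,
    dist B C' = (dist B C + dist C D) / 2 ∧ dist C' D = (dist B C + dist C D) / 2 ∧
    cross B C + cross C D ≤ cross B C' + cross C' D := by
  rcases eq_or_ne B D with rfl | hBD
  · exact ⟨C, by rw [dist_comm C]; ring, by rw [dist_comm C]; ring, le_rfl⟩
  obtain ⟨M, e, rfl, rfl, he⟩ : ∃ M e : ℂ, B = M - e ∧ D = M + e ∧ e ≠ 0 :=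
    ⟨(B + D) / 2, (D - B) / 2, by ring, by ring,
      div_ne_zero (sub_ne_zero.2 hBD.symm) two_ne_zero⟩
  obtain ⟨w, rfl⟩ : ∃ w, C = M + w * e := ⟨(C - M) / e, by field_simp; ring⟩
  have hleft (v : ℂ) : dist (M - e) (M + v * e) = ‖v + 1‖ * ‖e‖ := by
    rw [dist_comm, dist_eq_norm, ← norm_mul]; congr 1; ring
  have hright (v : ℂ) : dist (M + v * e) (M + e) = ‖v - 1‖ * ‖e‖ := by
    rw [dist_eq_norm, ← norm_mul]; congr 1; ring
  have harea (v : ℂ) : cross (M - e) (M + v * e) + cross (M + v * e) (M + e) =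
      cross (M - e) (M + e) - 2 * ‖e‖ ^ 2 * v.im := by
    rw [Complex.sq_norm, Complex.normSq_apply]
    simp only [cross, Complex.add_re, Complex.add_im, Complex.sub_re, Complex.sub_im,
      Complex.mul_re, Complex.mul_im]
    ring
  set r := (‖w + 1‖ + ‖w - 1‖) / 2 with hr
  have hw : 1 + w.im ^ 2 ≤ r ^ 2 := one_add_im_sq_le w
  set t := √(r ^ 2 - 1)
  have ht : t ^ 2 = r ^ 2 - 1 := Real.sq_sqrt (by nlinarith [sq_nonneg w.im])
  have hwt : -w.im ≤ t := Real.le_sqrt_of_sq_le (by linarith [neg_sq w.im])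
  have hnorm (s : ℝ) (hs : s ^ 2 = 1) : ‖(s : ℂ) + (-t : ℝ) * Complex.I‖ = r := by
    rw [Complex.norm_add_mul_I, Real.sqrt_eq_iff_mul_self_eq (by positivity) (by positivity)]
    nlinarith
  have hside : r * ‖e‖ = (‖w + 1‖ * ‖e‖ + ‖w - 1‖ * ‖e‖) / 2 := by rw [hr]; ring
  refine ⟨M + ((-t : ℝ) * Complex.I) * e, ?_, ?_, ?_⟩
  · rw [hleft, hleft, hright, ← hside, ← hnorm 1 (by norm_num), Complex.ofReal_one, add_comm]
  · rw [hright, hleft, hright, ← hside, ← hnorm (-1) (by norm_num), Complex.ofReal_neg 1,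
      Complex.ofReal_one, neg_add_eq_sub]
  · rw [harea, harea, Complex.im_ofReal_mul, Complex.I_im]
    nlinarith [sq_nonneg ‖e‖]

theorem sum_update_cyclic {n : ℕ} [NeZero n] {α R : Type*} [AddCommGroup R] (F : α → α → R)
    (z : Fin n → α) {k : Fin n} (c : α) (hk : k - 1 ≠ k) :
    ∑ j, F (Function.update z k c j) (Function.update z k c (j + 1)) =
      ∑ j, F (z j) (z (j + 1)) + ((F (z (k - 1)) c + F c (z (k + 1))) -
        (F (z (k - 1)) (z k) + F (z k) (z (k + 1)))) := by
  have hk' : k + 1 ≠ k := fun h => hk (by rw [sub_eq_iff_eq_add, h])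
  have hsplit (f : Fin n → R) : ∑ j, f j = f (k - 1) + f k + ∑ j ∈ {k - 1, k}ᶜ, f j := by
    rw [← Finset.sum_pair hk, Finset.sum_add_sum_compl]
  have hrest : ∑ j ∈ ({k - 1, k} : Finset (Fin n))ᶜ,
      F (Function.update z k c j) (Function.update z k c (j + 1)) =
      ∑ j ∈ ({k - 1, k} : Finset (Fin n))ᶜ, F (z j) (z (j + 1)) := by
    refine Finset.sum_congr rfl fun j hj => ?_
    simp only [Finset.mem_compl, Finset.mem_insert, Finset.mem_singleton, not_or] at hj
    rw [Function.update_of_ne hj.2, Function.update_of_ne fun h => hj.1 (by rw [← h]; simp)]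
  rw [hsplit fun j => F (z j) (z (j + 1)), hsplit, hrest]
  simp only [sub_add_cancel, Function.update_self, Function.update_of_ne hk,
    Function.update_of_ne hk']
  abel

/-- Of the curves that do at least as well as `z`, take one whose sides have the least sum of
squares: by `exists_isosceles`, two adjacent sides of different lengths could still be improved. -/
theorem exists_equilateral {m : ℕ} (hm : 1 ≤ m) (z : Fin (m + 1) → ℂ) :
    ∃ y : Fin (m + 1) → ℂ, signedArea z ≤ signedArea y ∧ polyLength y ≤ polyLength z ∧
      ∀ k, dist (y k) (y (k + 1)) = dist (y 0) (y 1) := by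
  set K : Set (Fin (m + 1) → ℂ) :=
    {y | y 0 = 0 ∧ polyLength y ≤ polyLength z ∧ signedArea z ≤ signedArea y}
  have hK : IsCompact K := by
    refine (isCompact_closedBall (0 : Fin (m + 1) → ℂ) (polyLength z)).of_isClosed_subset ?_ ?_
    · exact (isClosed_eq (continuous_apply 0) continuous_const).inter
        ((isClosed_le continuous_polyLength continuous_const).inter
          (isClosed_le continuous_const continuous_signedArea))
    · rintro y ⟨hy0, hyL, -⟩
      rw [mem_closedBall_zero_iff, pi_norm_le_iff_of_nonneg (polyLength_nonneg z)]
      intro k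
      simpa [hy0] using (dist_zero_le_polyLength y k).trans hyL
  have hne : K.Nonempty :=
    ⟨fun k => z k - z 0, sub_self _, (polyLength_sub_const z _).le, (signedArea_sub_const z _).ge⟩
  obtain ⟨y, ⟨hy0, hyL, hyS⟩, hmin⟩ := hK.exists_isMinOn hne
    (f := fun y => ∑ k, dist (y k) (y (k + 1)) ^ 2) (by fun_prop)
  have hadj (k : Fin (m + 1)) (hk : k ≠ 0) : dist (y (k - 1)) (y k) = dist (y k) (y (k + 1)) := by
    have hk1 : k - 1 ≠ k := by
      have : NeZero m := ⟨by omega⟩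
      simp
    obtain ⟨c, hc, hc', hcross⟩ := exists_isosceles (y (k - 1)) (y k) (y (k + 1))
    have hmem : Function.update y k c ∈ K := by
      refine ⟨by rw [Function.update_of_ne hk.symm, hy0], ?_, ?_⟩
      · rw [polyLength, sum_update_cyclic _ y c hk1, hc, hc', ← polyLength]
        linarith
      · rw [signedArea, signedArea, sum_update_cyclic _ y c hk1]
        rw [signedArea, signedArea] at hyS
        linarith
    have hle := isMinOn_iff.1 hmin _ hmem
    rw [sum_update_cyclic (fun a b => dist a b ^ 2) y c hk1, hc, hc'] at hle
    have : (dist (y (k - 1)) (y k) - dist (y k) (y (k + 1))) ^ 2 ≤ 0 := by nlinarith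
    exact sub_eq_zero.1 (pow_eq_zero_iff two_ne_zero |>.1 (this.antisymm (sq_nonneg _)))
  refine ⟨y, hyS, hyL, fun k => ?_⟩
  induction k using Fin.induction with
  | zero => rw [zero_add]
  | succ i ih => rw [← hadj _ (Fin.succ_ne_zero i), ← ih, ← Fin.coeSucc_eq_succ,
      add_sub_cancel_right]

theorem isoperimetric {n : ℕ} [NeZero n] (hn : 3 ≤ n) (z : Fin n → ℂ) :
    4 * n * Real.tan (π / n) * signedArea z ≤ polyLength z ^ 2 := by
  obtain ⟨m, rfl⟩ : ∃ m, n = m + 1 := ⟨n - 1, by omega⟩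
  obtain ⟨y, hS, hL, hy⟩ := exists_equilateral (by omega) z
  have htan : 0 ≤ Real.tan (π / (m + 1 : ℕ)) := Real.tan_nonneg_of_nonneg_of_le_pi_div_two
    (by positivity) (by gcongr; exact_mod_cast (by omega : 2 ≤ m + 1))
  have hE := tan_mul_sum_cross_le hn y
  have hLy : polyLength y = (m + 1 : ℕ) * dist (y 0) (y 1) := by simp [polyLength, hy]
  have hEy : ∑ k, dist (y k) (y (k + 1)) ^ 2 = (m + 1 : ℕ) * dist (y 0) (y 1) ^ 2 := by simp [hy]
  calc 4 * (m + 1 : ℕ) * Real.tan (π / (m + 1 : ℕ)) * signedArea z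
      ≤ 4 * (m + 1 : ℕ) * Real.tan (π / (m + 1 : ℕ)) * signedArea y := by gcongr
    _ = (m + 1 : ℕ) *
          (2 * Real.tan (π / (m + 1 : ℕ)) * ∑ k, cross (y k) (y (k + 1))) := by
        rw [signedArea]; ring
    _ ≤ (m + 1 : ℕ) * ((m + 1 : ℕ) * dist (y 0) (y 1) ^ 2) := by
        rw [← hEy]; gcongr; exact hE
    _ = polyLength y ^ 2 := by rw [hLy]; ring
    _ ≤ polyLength z ^ 2 := by gcongr; exact polyLength_nonneg y

end Equilateral

/-- Twice the signed area of the triangle `a b c`: negative if the path `a b c` turns right. -/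
def crossArea (a b c : ℂ) : ℝ := cross (b - a) (c - a)

theorem crossArea_eq (a b c : ℂ) : crossArea a b c = cross a b + cross b c - cross a c := by
  simp only [crossArea, cross, Complex.sub_re, Complex.sub_im]; ring

theorem sum_tail_cyclic {n : ℕ} {α R : Type*} [AddCommGroup R] (F : α → α → R)
    (z : Fin (n + 2) → α) :
    ∑ j, F (Fin.tail z j) (Fin.tail z (j + 1)) = ∑ j, F (z j) (z (j + 1)) -
      (F (z (Fin.last (n + 1))) (z 0) + F (z 0) (z 1) - F (z (Fin.last (n + 1))) (z 1)) := by
  rw [Fin.sum_univ_castSucc, Fin.sum_univ_succ fun j => F (z j) (z (j + 1)),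
    Fin.sum_univ_castSucc (n := n)]
  simp only [Fin.tail, Fin.coeSucc_eq_succ, Fin.last_add_one, Fin.succ_last, zero_add,
    Fin.succ_castSucc, Fin.succ_zero_eq_one]
  abel

/-- The closed curve obtained by leaving out the vertex `k`; its first vertex is `z (k + 1)`. -/
def removeVertex {n : ℕ} (z : Fin (n + 2) → ℂ) (k : Fin (n + 2)) : Fin (n + 1) → ℂ :=
  Fin.tail fun j => z (j + k)

section RemoveVertex

variable {n : ℕ} (z : Fin (n + 2) → ℂ) (k : Fin (n + 2))

theorem signedArea_removeVertex : signedArea (removeVertex z k) =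
    signedArea z - crossArea (z (k - 1)) (z k) (z (k + 1)) / 2 := by
  have hlast : Fin.last (n + 1) + k = k - 1 := by
    rw [eq_sub_iff_add_eq, add_right_comm _ k 1, Fin.last_add_one, zero_add]
  rw [← signedArea_rotate z k, signedArea, removeVertex, sum_tail_cyclic, signedArea, crossArea_eq,
    zero_add, add_comm 1 k, hlast]
  ring

theorem polyLength_removeVertex_le : polyLength (removeVertex z k) ≤ polyLength z := by
  rw [← polyLength_rotate z k, polyLength, removeVertex, sum_tail_cyclic, ← polyLength]
  linarith [dist_triangle (z (Fin.last (n + 1) + k)) (z (0 + k)) (z (1 + k))]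

end RemoveVertex

theorem mul_signedArea_le_of_le {n : ℕ} [NeZero n] (hn : 3 ≤ n) {c : ℝ} (hc0 : 0 ≤ c)
    (hc : c ≤ 4 * n * Real.tan (π / n)) (z : Fin n → ℂ) :
    c * signedArea z ≤ polyLength z ^ 2 := by
  rcases le_total (signedArea z) 0 with hS | hS
  · exact (mul_nonpos_of_nonneg_of_nonpos hc0 hS).trans (sq_nonneg _)
  · exact (mul_le_mul_of_nonneg_right hc hS).trans (isoperimetric hn z)

theorem isoperimetric_triangle (z : Fin 3 → ℂ) : 20.784 * signedArea z ≤ polyLength z ^ 2 := by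
  refine mul_signedArea_le_of_le le_rfl (by norm_num) ?_ z
  rw [Nat.cast_ofNat, Real.tan_pi_div_three]
  linarith [Real.le_sqrt_of_sq_le (show (1.732 : ℝ) ^ 2 ≤ 3 by norm_num)]

theorem isoperimetric_quadrilateral (z : Fin 4 → ℂ) : 16 * signedArea z ≤ polyLength z ^ 2 := by
  refine mul_signedArea_le_of_le (by norm_num) (by norm_num) ?_ z
  rw [Nat.cast_ofNat, Real.tan_pi_div_four]
  norm_num

theorem isoperimetric_pentagon (z : Fin 5 → ℂ) : 14.53 * signedArea z ≤ polyLength z ^ 2 := by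
  refine mul_signedArea_le_of_le (by norm_num) (by norm_num) ?_ z
  have hsqrt : √5 ^ 2 = 5 := Real.sq_sqrt (by norm_num)
  have hsqrt_le : √5 ≤ 2.23607 := Real.sqrt_le_iff.2 (by norm_num)
  have hsin : 0.58777 ≤ Real.sin (π / 5) := by
    have h0 : 0 ≤ Real.sin (π / 5) := Real.sin_nonneg_of_nonneg_of_le_pi (by positivity)
      (by linarith [Real.pi_pos])
    have h1 := Real.sin_sq_add_cos_sq (π / 5)
    rw [Real.cos_pi_div_five] at h1
    nlinarith
  rw [Nat.cast_ofNat, Real.tan_eq_sin_div_cos, Real.cos_pi_div_five, ← mul_div_assoc,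
    le_div_iff₀ (by positivity)]
  linarith

theorem isoperimetric_hexagon (z : Fin 6 → ℂ) : 13.856 * signedArea z ≤ polyLength z ^ 2 := by
  refine mul_signedArea_le_of_le (by norm_num) (by norm_num) ?_ z
  rw [Nat.cast_ofNat, Real.tan_pi_div_six, mul_one_div, le_div_iff₀ (by positivity)]
  linarith [Real.sqrt_le_iff.2 (show (0 : ℝ) ≤ 1.7321 ∧ (3 : ℝ) ≤ 1.7321 ^ 2 by norm_num)]

section Corner

variable {u w C D : ℂ} {x y t : ℝ}

theorem signedArea_truncate (u w C D : ℂ) (x y t : ℝ) :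
    signedArea ![t * u, x * u, C, D, y * w, t * w] =
      signedArea ![0, x * u, C, D, y * w] - t ^ 2 / 2 * cross u w := by
  simp [signedArea, Fin.sum_univ_succ, cross]
  ring

theorem polyLength_pentagon (hu : ‖u‖ = 1) (hw : ‖w‖ = 1) (hx : 0 ≤ x) (hy : 0 ≤ y) :
    polyLength ![0, x * u, C, D, y * w] =
      x + dist (x * u) C + dist C D + dist D (y * w) + y := by
  simp [polyLength, Fin.sum_univ_succ, hu, hw, abs_of_nonneg hx, abs_of_nonneg hy]
  ring

theorem polyLength_truncate (hu : ‖u‖ = 1) (hw : ‖w‖ = 1) (ht : 0 ≤ t) (hx : t ≤ x) (hy : t ≤ y) :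
    polyLength ![t * u, x * u, C, D, y * w, t * w] =
      polyLength ![0, x * u, C, D, y * w] - t * (2 - ‖w - u‖) := by
  have hdist {v : ℂ} (hv : ‖v‖ = 1) (a b : ℝ) : dist (a * v) (b * v) = |a - b| := by
    rw [dist_eq_norm, ← sub_mul, norm_mul, hv, mul_one, ← Complex.ofReal_sub, Complex.norm_real,
      Real.norm_eq_abs]
  have hcut : dist (t * w) (t * u) = t * ‖w - u‖ := by
    rw [dist_eq_norm, ← mul_sub, norm_mul, Complex.norm_of_nonneg ht]
  rw [polyLength_pentagon hu hw (ht.trans hx) (ht.trans hy)]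
  simp [polyLength, Fin.sum_univ_succ, hdist hu, hdist hw, hcut, abs_of_nonpos, hx,
    abs_of_nonneg (sub_nonneg.2 hy)]
  ring

theorem lt_and_lt_of_polyLength_le (hu : ‖u‖ = 1) (hw : ‖w‖ = 1) (hcross : cross u w ≤ 0.9511)
    (hx : 0 ≤ x) (hy : 0 ≤ y) (hS : signedArea ![0, x * u, C, D, y * w] = 1)
    (hL : polyLength ![0, x * u, C, D, y * w] ≤ 3.8638) : 0.07 < x ∧ 0.07 < y := by
  set z : Fin 5 → ℂ := ![0, x * u, C, D, y * w]
  have hcorner : crossArea (z (0 - 1)) (z 0) (z (0 + 1)) = x * y * cross u w := by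
    simp [z, crossArea, cross]; ring
  have hquad := isoperimetric_quadrilateral (removeVertex z 0)
  rw [signedArea_removeVertex, hcorner, hS] at hquad
  have hsq := pow_le_pow_left₀ (polyLength_nonneg _) ((polyLength_removeVertex_le z 0).trans hL) 2
  have hxy : x * y * cross u w ≤ x * y * 0.9511 := by gcongr
  have hside : dist (x * u) (y * w) ≤ dist (x * u) C + dist C D + dist D (y * w) :=
    dist_triangle4 _ _ _ _
  have hbase : x ≤ dist (x * u) (y * w) + y ∧ y ≤ dist (x * u) (y * w) + x := by
    have h0 := dist_triangle (x * u) (y * w) 0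
    have h1 := dist_triangle (y * w) (x * u) 0
    simp only [dist_zero_right, norm_mul, hu, hw, Complex.norm_of_nonneg hx,
      Complex.norm_of_nonneg hy, mul_one, dist_comm (y * w) (x * u)] at h0 h1
    exact ⟨h0, h1⟩
  rw [polyLength_pentagon hu hw hx hy] at hL
  constructor <;> nlinarith

/-- Cutting off an isosceles corner whose sides exhaust one of the two edges leaves a pentagon. -/
theorem isoperimetric_truncate (hu : ‖u‖ = 1) (hw : ‖w‖ = 1) (ht : 0 ≤ t) (hx : t ≤ x) (hy : t ≤ y)
    (hxy : t = x ∨ t = y) :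
    14.53 * (signedArea ![0, x * u, C, D, y * w] - t ^ 2 / 2 * cross u w) ≤
      (polyLength ![0, x * u, C, D, y * w] - t * (2 - ‖w - u‖)) ^ 2 := by
  rw [← signedArea_truncate, ← polyLength_truncate hu hw ht hx hy]
  set z : Fin 6 → ℂ := ![t * u, x * u, C, D, y * w, t * w]
  obtain ⟨k, hk⟩ : ∃ k, crossArea (z (k - 1)) (z k) (z (k + 1)) = 0 := by
    rcases hxy with rfl | rfl
    · exact ⟨1, by simp [z, crossArea, cross]⟩
    · exact ⟨5, by simp [z, crossArea, cross]⟩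
  calc 14.53 * signedArea z = 14.53 * signedArea (removeVertex z k) := by
        rw [signedArea_removeVertex, hk]; ring
    _ ≤ polyLength (removeVertex z k) ^ 2 := isoperimetric_pentagon _
    _ ≤ polyLength z ^ 2 := by
        gcongr
        · exact polyLength_nonneg _
        · exact polyLength_removeVertex_le z k

theorem lt_of_polyLength_le (hu : ‖u‖ = 1) (hw : ‖w‖ = 1) (hcross : cross u w ≤ 0.9511)
    (hchord : ‖w - u‖ ≤ 1.1756) (ht : 0.07 ≤ t) (hx : t ≤ x) (hy : t ≤ y) (hxy : t = x ∨ t = y)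
    (hS : signedArea ![0, x * u, C, D, y * w] = 1)
    (hL : polyLength ![0, x * u, C, D, y * w] ≤ 3.8638) : 0.44 < t := by
  have ht0 : 0 ≤ t := by linarith
  by_contra! hlt
  have hpentagon := isoperimetric_truncate (C := C) (D := D) hu hw ht0 hx hy hxy
  have hlen : polyLength ![0, x * u, C, D, y * w] - t * (2 - ‖w - u‖) ≤ 3.8638 - 0.8244 * t := by
    nlinarith
  have hlen0 : 0 ≤ polyLength ![0, x * u, C, D, y * w] - t * (2 - ‖w - u‖) := by
    rw [← polyLength_truncate hu hw ht0 hx hy]; exact polyLength_nonneg _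
  have harea : t ^ 2 / 2 * cross u w ≤ t ^ 2 / 2 * 0.9511 := by gcongr
  rw [hS] at hpentagon
  nlinarith [pow_le_pow_left₀ hlen0 hlen 2, mul_nonneg (sub_nonneg.2 ht) (sub_nonneg.2 hlt)]

/-- A sharp corner wastes length: cutting it off along an isosceles triangle of side `t` costs the
area `t ^ 2 / 2 * cross u w` and saves the length `t * (2 - ‖w - u‖)`. -/
theorem lt_polyLength_of_chord_le (hu : ‖u‖ = 1) (hw : ‖w‖ = 1) (hcross : cross u w ≤ 0.9511)
    (hchord : ‖w - u‖ ≤ 1.1756) (hx : 0 ≤ x) (hy : 0 ≤ y)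
    (hS : signedArea ![0, x * u, C, D, y * w] = 1) :
    3.8638 < polyLength ![0, x * u, C, D, y * w] := by
  by_contra! hL
  obtain ⟨hx7, hy7⟩ := lt_and_lt_of_polyLength_le hu hw hcross hx hy hS hL
  obtain ⟨hx44, hy44⟩ : 0.44 ≤ x ∧ 0.44 ≤ y := by
    rcases le_total x y with h | h
    · have := lt_of_polyLength_le hu hw hcross hchord hx7.le le_rfl h (.inl rfl) hS hL
      exact ⟨this.le, this.le.trans h⟩
    · have := lt_of_polyLength_le hu hw hcross hchord hy7.le h le_rfl (.inr rfl) hS hL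
      exact ⟨this.le.trans h, this.le⟩
  have hhexagon := isoperimetric_hexagon
    ![(0.44 : ℝ) * u, x * u, C, D, y * w, (0.44 : ℝ) * w]
  have hlen0 := polyLength_nonneg ![(0.44 : ℝ) * u, x * u, C, D, y * w, (0.44 : ℝ) * w]
  rw [signedArea_truncate, polyLength_truncate hu hw (by norm_num) hx44 hy44, hS] at hhexagon
  rw [polyLength_truncate hu hw (by norm_num) hx44 hy44] at hlen0
  have hlen := pow_le_pow_left₀ hlen0 (show _ ≤ (3.502 : ℝ) by linarith) 2
  norm_num at hlen hhexagon
  linarith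

end Corner

theorem sin_pi_div_five_le : Real.sin (π / 5) ≤ 0.5878 := by
  have hsqrt : √5 ^ 2 = 5 := Real.sq_sqrt (by norm_num)
  have hsqrt_ge : 2.23606 ≤ √5 := Real.le_sqrt_of_sq_le (by norm_num)
  have h := Real.sin_sq_add_cos_sq (π / 5)
  rw [Real.cos_pi_div_five] at h
  nlinarith

theorem sin_two_mul_pi_div_five_le : Real.sin (2 * π / 5) ≤ 0.9511 := by
  have hsqrt : √5 ^ 2 = 5 := Real.sq_sqrt (by norm_num)
  have hsqrt_ge : 2.23606 ≤ √5 := Real.le_sqrt_of_sq_le (by norm_num)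
  have h := Real.sin_sq_add_cos_sq (2 * π / 5)
  rw [mul_div_assoc, Real.cos_two_mul, Real.cos_pi_div_five] at h
  rw [mul_div_assoc]
  nlinarith

theorem cross_mul_exp {u : ℂ} (hu : ‖u‖ = 1) (α : ℝ) :
    cross u (u * Complex.exp (α * Complex.I)) = Real.sin α := by
  have hexp : conj u * (u * Complex.exp (α * Complex.I)) = Complex.exp (α * Complex.I) := by
    rw [← mul_assoc, Complex.conj_mul', hu]
    simp
  rw [cross_eq_im, hexp, Complex.exp_ofReal_mul_I_im]

theorem norm_mul_exp_sub_self {u : ℂ} (hu : ‖u‖ = 1) {α : ℝ} (hα : α ∈ Icc 0 (2 * π)) :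
    ‖u * Complex.exp (α * Complex.I) - u‖ = 2 * Real.sin (α / 2) := by
  rw [← mul_sub_one, norm_mul, hu, one_mul, mul_comm (α : ℂ),
    Complex.norm_exp_I_mul_ofReal_sub_one, Real.norm_of_nonneg]
  exact mul_nonneg zero_le_two (Real.sin_nonneg_of_nonneg_of_le_pi (by linarith [hα.1])
    (by linarith [hα.2]))

theorem lt_polyLength_of_angle_le {z : Fin 5 → ℂ} (hS : signedArea z = 1) {k : Fin 5} {α : ℝ}
    (hne : z (k + 1) ≠ z k) (h0 : 0 ≤ α) (h1 : α ≤ 2 * π / 5)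
    (hk : (z (k - 1) - z k) * dist (z k) (z (k + 1)) =
      (z (k + 1) - z k) * dist (z (k - 1)) (z k) * Complex.exp (α * Complex.I)) :
    3.8638 < polyLength z := by
  have hd : (dist (z k) (z (k + 1)) : ℂ) ≠ 0 := by exact_mod_cast (dist_pos.2 hne.symm).ne'
  set u := (z (k + 1) - z k) / dist (z k) (z (k + 1))
  set w := u * Complex.exp (α * Complex.I)
  have hu : ‖u‖ = 1 := by
    rw [norm_div, Complex.norm_of_nonneg dist_nonneg, ← dist_eq_norm, dist_comm,
      div_self (dist_pos.2 hne.symm).ne']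
  have hw : ‖w‖ = 1 := by rw [norm_mul, hu, Complex.norm_exp_ofReal_mul_I, one_mul]
  have hz : (fun j => z (j + k) - z k) = ![0, dist (z k) (z (k + 1)) * u, z (2 + k) - z k,
      z (3 + k) - z k, dist (z (k - 1)) (z k) * w] := by
    have h4 : 4 + k = k - 1 := by rw [sub_eq_neg_add]; rfl
    ext j
    fin_cases j
    · simp
    · simp [u, mul_div_cancel₀ _ hd, add_comm 1 k]
    · rfl
    · rfl
    · simp only [Fin.reduceFinMk, h4, w, u]
      simp only [Fin.isValue, Matrix.cons_val]
      field_simp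
      linear_combination hk
  rw [← polyLength_rotate z k, ← polyLength_sub_const _ (z k), hz]
  rw [← signedArea_rotate z k, ← signedArea_sub_const _ (z k), hz] at hS
  refine lt_polyLength_of_chord_le hu hw ?_ ?_ dist_nonneg dist_nonneg hS
  · rw [cross_mul_exp hu]
    exact (Real.sin_le_sin_of_le_of_le_pi_div_two (by linarith [Real.pi_pos])
      (by linarith [Real.pi_pos]) h1).trans sin_two_mul_pi_div_five_le
  · rw [norm_mul_exp_sub_self hu ⟨h0, by linarith [Real.pi_pos]⟩]
    linarith [(Real.sin_le_sin_of_le_of_le_pi_div_two (x := α / 2) (y := π / 5)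
      (by linarith [Real.pi_pos]) (by linarith [Real.pi_pos]) (by linarith)).trans
      sin_pi_div_five_le]

section Reflex

theorem crossArea_add_nonpos {A B C D : ℂ} (hB : crossArea A B C < 0) (hC : crossArea B C D < 0)
    (hdisj : Disjoint (segment ℝ A B) (segment ℝ C D)) :
    crossArea A B C + crossArea A C D ≤ 0 := by
  by_contra! hpos
  set d := crossArea A C D - crossArea B C D with hd
  have hd0 : 0 < d := by linarith
  have hIcc {a : ℝ} (h0 : 0 ≤ a) (h1 : a ≤ d) : a / d ∈ Icc (0 : ℝ) 1 :=
    ⟨by positivity, (div_le_one hd0).2 h1⟩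
  have hAB : A + (crossArea A C D / d) • (B - A) ∈ segment ℝ A B := by
    rw [segment_eq_image']
    exact ⟨_, hIcc (by linarith) (by linarith), rfl⟩
  have hCD : C + (-crossArea A B C / d) • (D - C) ∈ segment ℝ C D := by
    rw [segment_eq_image']
    exact ⟨_, hIcc (by linarith) (by linarith), rfl⟩
  have hmeet : A + (crossArea A C D / d) • (B - A) = C + (-crossArea A B C / d) • (D - C) := by
    apply Complex.ext <;>
      simp only [Complex.add_re, Complex.sub_re, Complex.add_im, Complex.sub_im,
        Complex.real_smul, Complex.re_ofReal_mul, Complex.im_ofReal_mul] <;>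
      field_simp <;> rw [hd] <;> simp only [crossArea_eq, cross] <;> ring
  exact Set.disjoint_left.1 hdisj hAB (hmeet ▸ hCD)

variable {z : Fin 5 → ℂ} {i : Fin 5}

theorem isoperimetric_of_signedArea_removeVertex_le {j : Fin 4}
    (h : signedArea z ≤ signedArea (removeVertex (removeVertex z i) j)) :
    20.784 * signedArea z ≤ polyLength z ^ 2 :=
  calc 20.784 * signedArea z ≤ 20.784 * signedArea (removeVertex (removeVertex z i) j) := by gcongr
    _ ≤ polyLength (removeVertex (removeVertex z i) j) ^ 2 := isoperimetric_triangle _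
    _ ≤ polyLength z ^ 2 := by
        gcongr
        · exact polyLength_nonneg _
        · exact (polyLength_removeVertex_le _ j).trans (polyLength_removeVertex_le z i)

theorem isoperimetric_of_reflex_of_reflex_succ
    (hi : crossArea (z (i - 1)) (z i) (z (i + 1)) < 0)
    (hj : crossArea (z i) (z (i + 1)) (z (i + 2)) < 0)
    (hdisj : Disjoint (segment ℝ (z (i - 1)) (z i)) (segment ℝ (z (i + 1)) (z (i + 2)))) :
    20.784 * signedArea z ≤ polyLength z ^ 2 := by
  have hcorner : crossArea (removeVertex z i (0 - 1)) (removeVertex z i 0)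
      (removeVertex z i (0 + 1)) = crossArea (z (i - 1)) (z (i + 1)) (z (i + 2)) := by
    rw [sub_eq_neg_add i, add_comm i, add_comm i]; rfl
  refine isoperimetric_of_signedArea_removeVertex_le (i := i) (j := 0) ?_
  rw [signedArea_removeVertex, hcorner, signedArea_removeVertex]
  linarith [crossArea_add_nonpos hi hj hdisj]

theorem isoperimetric_of_reflex_of_reflex_add_two
    (hi : crossArea (z (i - 1)) (z i) (z (i + 1)) < 0)
    (hj : crossArea (z (i + 1)) (z (i + 2)) (z (i + 3)) < 0) :
    20.784 * signedArea z ≤ polyLength z ^ 2 := by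
  have hcorner : crossArea (removeVertex z i (1 - 1)) (removeVertex z i 1)
      (removeVertex z i (1 + 1)) = crossArea (z (i + 1)) (z (i + 2)) (z (i + 3)) := by
    rw [add_comm i, add_comm i, add_comm i]; rfl
  refine isoperimetric_of_signedArea_removeVertex_le (i := i) (j := 1) ?_
  rw [signedArea_removeVertex, hcorner, signedArea_removeVertex]
  linarith

/-- Leaving out the two reflex vertices turns the pentagon into a triangle of larger area. -/
theorem isoperimetric_of_two_reflex {j : Fin 5}
    (hdisj : ∀ k, Disjoint (segment ℝ (z k) (z (k + 1))) (segment ℝ (z (k + 2)) (z (k + 3))))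
    (hij : i ≠ j) (hi : crossArea (z (i - 1)) (z i) (z (i + 1)) < 0)
    (hj : crossArea (z (j - 1)) (z j) (z (j + 1)) < 0) :
    20.784 * signedArea z ≤ polyLength z ^ 2 := by
  wlog h : j = i + 1 ∨ j = i + 2 generalizing i j
  · refine this hij.symm hj hi ?_
    clear hi hj this
    revert i j; decide
  rcases h with rfl | rfl
  · refine isoperimetric_of_reflex_of_reflex_succ hi ?_ ?_
    · rwa [add_sub_cancel_right, add_assoc i 1 1] at hj
    · have := hdisj (i - 1)
      rwa [sub_add_cancel, sub_add_eq_add_sub, sub_add_eq_add_sub, add_sub_assoc,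
        add_sub_assoc] at this
  · refine isoperimetric_of_reflex_of_reflex_add_two hi ?_
    rwa [add_sub_assoc, add_assoc i 2 1] at hj

end Reflex

/-- The open rhombus around the segment from `0` to `1` whose sides have slopes `± δ`. -/
def thinRhombus (δ : ℝ) : Set ℂ := {ζ | |ζ.im| < δ * ζ.re ∧ |ζ.im| < δ * (1 - ζ.re)}

theorem isOpen_thinRhombus (δ : ℝ) : IsOpen (thinRhombus δ) := by
  have him : Continuous fun ζ : ℂ => |ζ.im| := by fun_prop
  exact (isOpen_lt him (by fun_prop)).inter (isOpen_lt him (by fun_prop))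

theorem convex_thinRhombus (δ : ℝ) : Convex ℝ (thinRhombus δ) := by
  refine convex_iff_forall_pos.2 fun x hx y hy a b ha hb hab => ?_
  have him : |(a • x + b • y).im| ≤ a * |x.im| + b * |y.im| := by
    simpa [abs_mul, abs_of_pos, ha, hb] using abs_add_le (a * x.im) (b * y.im)
  have hre : (a • x + b • y).re = a * x.re + b * y.re := by simp
  have hx1 := mul_lt_mul_of_pos_left hx.1 ha
  have hx2 := mul_lt_mul_of_pos_left hx.2 ha
  have hy1 := mul_lt_mul_of_pos_left hy.1 hb
  have hy2 := mul_lt_mul_of_pos_left hy.2 hb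
  obtain rfl : b = 1 - a := by linarith
  refine ⟨?_, ?_⟩ <;> rw [hre] <;> linarith

theorem convex_thinRhombus_inter (δ s : ℝ) : Convex ℝ (thinRhombus δ ∩ {ζ | 0 < s * ζ.im}) := by
  refine (convex_thinRhombus δ).inter (convex_halfSpace_gt (f := fun ζ : ℂ => s * ζ.im) ?_ 0)
  exact ⟨fun x y => by simp [mul_add], fun c x => by simp [mul_left_comm]⟩

theorem one_sub_mem_thinRhombus {δ : ℝ} {ζ : ℂ} (h : ζ ∈ thinRhombus δ) :
    1 - ζ ∈ thinRhombus δ := by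
  refine ⟨?_, ?_⟩
  · simpa using h.2
  · simpa using h.1

theorem re_mem_Ioo_of_mem_thinRhombus {δ : ℝ} (hδ : 0 < δ) {ζ : ℂ} (h : ζ ∈ thinRhombus δ) :
    ζ.re ∈ Ioo (0 : ℝ) 1 :=
  ⟨pos_of_mul_pos_right ((abs_nonneg _).trans_lt h.1) hδ.le,
    sub_pos.1 (pos_of_mul_pos_right ((abs_nonneg _).trans_lt h.2) hδ.le)⟩

theorem mul_exp_mem_thinRhombus {δ r φ : ℝ} (hr : r ∈ Ioc 0 (1 / 2)) (hφ : |φ| ≤ 1)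
    (hδ : |φ| < δ / 2) : r * Complex.exp (φ * Complex.I) ∈ thinRhombus δ := by
  obtain ⟨hr, hr'⟩ := hr
  rw [thinRhombus, mem_ofPred_eq, Complex.re_ofReal_mul, Complex.im_ofReal_mul,
    Complex.exp_ofReal_mul_I_re, Complex.exp_ofReal_mul_I_im, abs_mul, abs_of_pos hr]
  have hsin : |Real.sin φ| ≤ |φ| := Real.abs_sin_le_abs
  have hcos : 1 / 2 ≤ Real.cos φ := by
    have hsq : φ ^ 2 ≤ 1 := by rw [← sq_abs]; exact pow_le_one₀ (abs_nonneg φ) hφ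
    linarith [Real.one_sub_sq_div_two_le_cos (x := φ)]
  have hδ0 : 0 < δ := by linarith [abs_nonneg φ]
  constructor
  · rw [mul_left_comm]
    refine mul_lt_mul_of_pos_left ?_ hr
    nlinarith
  · have him : r * |Real.sin φ| ≤ 1 / 2 * |φ| := by gcongr
    have hre : r * Real.cos φ ≤ 1 / 2 := by nlinarith [Real.cos_le_one φ]
    nlinarith [abs_nonneg φ]

theorem eventually_ray_notMem_thinRhombus (q : ℂ) : ∀ᶠ δ in 𝓝[>] (0 : ℝ), ∀ t : ℝ, 0 ≤ t →
    (t * q).im ≠ 0 → (t * q : ℂ) ∉ thinRhombus δ := by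
  by_cases hq : q.im = 0
  · refine Eventually.of_forall fun δ t _ him => absurd ?_ him
    rw [Complex.im_ofReal_mul, hq, mul_zero]
  have hpos : 0 < |q.im| / (|q.re| + 1) := by positivity
  filter_upwards [Ioo_mem_nhdsGT hpos] with δ hδ t ht _ hmem
  have hlt := hmem.1
  rw [Complex.im_ofReal_mul, Complex.re_ofReal_mul, abs_mul, abs_of_nonneg ht] at hlt
  have hslope := (lt_div_iff₀ (by positivity)).1 hδ.2
  have hre : δ * q.re ≤ δ * (|q.re| + 1) := by
    have := hδ.1
    gcongr
    linarith [le_abs_self q.re]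
  nlinarith

theorem subset_interior_or_subset_compl_of_disjoint_frontier {X : Type*} [TopologicalSpace X]
    {C R : Set X} (hC : IsPreconnected C) (hR : IsClosed R) (h : Disjoint C (frontier R)) :
    C ⊆ interior R ∨ C ⊆ Rᶜ := by
  refine hC.subset_or_subset isOpen_interior hR.isOpen_compl
    (disjoint_compl_right.mono_left interior_subset) fun x hx => ?_
  by_cases hxR : x ∈ R
  · exact Or.inl (by_contra fun hi => Set.disjoint_left.1 h hx (hR.frontier_eq ▸ ⟨hxR, hi⟩))
  · exact Or.inr hxR

namespace Pentagon

/-- The affine coordinate along the `k`-th edge, with `0` and `1` at its endpoints; complex values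
of the coordinate reach all points of the plane. -/
def edgePoint (P : Pentagon) (k : Fin 5) (ζ : ℂ) : ℂ :=
  P.vertices k + ζ * (P.vertices (k + 1) - P.vertices k)

theorem mem_edge {P : Pentagon} {k : Fin 5} {z : ℂ} : z ∈ P.edge k ↔
    ∃ t : ℝ, 0 ≤ t ∧ t ≤ 1 ∧ z = P.edgePoint k t := by
  rw [edge_eq_segment, segment_eq_image']
  simp only [edgePoint, mem_image, mem_Icc, Complex.real_smul, and_assoc, eq_comm]

theorem vertex_mem_edge (P : Pentagon) (k : Fin 5) : P.vertices k ∈ P.edge k :=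
  P.edge_eq_segment k ▸ left_mem_segment ℝ _ _

theorem vertex_succ_mem_edge (P : Pentagon) (k : Fin 5) : P.vertices (k + 1) ∈ P.edge k :=
  P.edge_eq_segment k ▸ right_mem_segment ℝ _ _

theorem edge_inter (P : Pentagon) (k : Fin 5) :
    P.edge k ∩ P.edge (k + 1) = {P.vertices (k + 1)} := P.edge_inter_succ k

theorem disjoint_edge_add_two (P : Pentagon) (k : Fin 5) : Disjoint (P.edge k) (P.edge (k + 2)) :=
  P.edge_disjoint k

theorem disjoint_edge_add_three (P : Pentagon) (k : Fin 5) :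
    Disjoint (P.edge k) (P.edge (k + 3)) := by
  have h := P.disjoint_edge_add_two (k + 3)
  rw [add_assoc, show (3 : Fin 5) + 2 = 0 from rfl, add_zero] at h
  exact h.symm

theorem vertices_succ_ne (P : Pentagon) (k : Fin 5) : P.vertices (k + 1) ≠ P.vertices k := by
  intro h
  refine Set.disjoint_left.1 (P.disjoint_edge_add_three (k + 1)) (P.vertex_mem_edge (k + 1)) ?_
  have hprev := P.vertex_succ_mem_edge (k + 4)
  rw [add_assoc, show (4 : Fin 5) + 1 = 0 from rfl, add_zero] at hprev
  rwa [h, add_assoc, show (1 : Fin 5) + 3 = 4 from rfl]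

theorem vertices_succ_sub_ne_zero (P : Pentagon) (k : Fin 5) :
    P.vertices (k + 1) - P.vertices k ≠ 0 := sub_ne_zero.2 (P.vertices_succ_ne k)

theorem edgePoint_injective (P : Pentagon) (k : Fin 5) : Function.Injective (P.edgePoint k) :=
  fun _ _ h => mul_right_cancel₀ (P.vertices_succ_sub_ne_zero k) (add_left_cancel h)

theorem continuous_edgePoint (P : Pentagon) (k : Fin 5) : Continuous (P.edgePoint k) := by
  unfold edgePoint
  fun_prop

theorem isOpenMap_edgePoint (P : Pentagon) (k : Fin 5) : IsOpenMap (P.edgePoint k) :=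
  (isOpenMap_add_left _).comp (Homeomorph.mulRight₀ _ (P.vertices_succ_sub_ne_zero k)).isOpenMap

theorem frontier_eq (P : Pentagon) : frontier P.region = ⋃ k, P.edge k := P.frontier_region

theorem isClosed_region (P : Pentagon) : IsClosed P.region := P.isCompact_region.isClosed

theorem isCompact_edge (P : Pentagon) (k : Fin 5) : IsCompact (P.edge k) := by
  rw [edge_eq_segment, segment_eq_image']
  exact isCompact_Icc.image (by fun_prop)

theorem isClosed_edge (P : Pentagon) (k : Fin 5) : IsClosed (P.edge k) :=
  (P.isCompact_edge k).isClosed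

theorem edge_subset_frontier (P : Pentagon) (k : Fin 5) : P.edge k ⊆ frontier P.region :=
  P.frontier_eq ▸ subset_iUnion P.edge k

theorem edge_subset_region (P : Pentagon) (k : Fin 5) : P.edge k ⊆ P.region :=
  (P.edge_subset_frontier k).trans P.isClosed_region.frontier_subset

theorem vertex_notMem_edge (P : Pentagon) {j k : Fin 5} (h1 : j ≠ k) (h2 : j + 1 ≠ k) :
    P.vertices k ∉ P.edge j := by
  have hj : j = k + 1 ∨ j = k + 2 ∨ j = k + 3 := by clear P; revert j k; decide
  intro hmem
  rcases hj with rfl | rfl | rfl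
  · have hinter : P.vertices k ∈ P.edge k ∩ P.edge (k + 1) := ⟨P.vertex_mem_edge k, hmem⟩
    rw [edge_inter] at hinter
    exact P.vertices_succ_ne k (mem_singleton_iff.1 hinter).symm
  · exact Set.disjoint_left.1 (P.disjoint_edge_add_two k) (P.vertex_mem_edge k) hmem
  · exact Set.disjoint_left.1 (P.disjoint_edge_add_three k) (P.vertex_mem_edge k) hmem

theorem vertices_injective (P : Pentagon) : Function.Injective P.vertices := by
  intro j k h
  by_contra hne
  by_cases hjk : j + 1 = k
  · exact P.vertices_succ_ne j (by rw [hjk, h])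
  · exact P.vertex_notMem_edge hne hjk (h ▸ P.vertex_mem_edge j)

theorem eventually_notMem_edge_of_disjoint (P : Pentagon) {k j : Fin 5}
    (hd : Disjoint (P.edge k) (P.edge j)) :
    ∀ᶠ δ in 𝓝[>] (0 : ℝ), ∀ ζ ∈ thinRhombus δ, P.edgePoint k ζ ∉ P.edge j := by
  have he : 0 < ‖P.vertices (k + 1) - P.vertices k‖ :=
    norm_pos_iff.2 (P.vertices_succ_sub_ne_zero k)
  obtain ⟨r, hr, hrd⟩ := Metric.exists_pos_forall_lt_edist (P.isCompact_edge k)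
    (P.isClosed_edge j) hd
  filter_upwards [Ioo_mem_nhdsGT (div_pos (NNReal.coe_pos.2 hr) he)] with δ hδ ζ hζ hmem
  have hre := re_mem_Ioo_of_mem_thinRhombus hδ.1 hζ
  have him : |ζ.im| ≤ δ := by nlinarith [hζ.1, hre.2, hδ.1]
  have hdist : dist (P.edgePoint k ζ.re) (P.edgePoint k ζ) =
      |ζ.im| * ‖P.vertices (k + 1) - P.vertices k‖ := by
    rw [dist_eq_norm, edgePoint, edgePoint, add_sub_add_left_eq_sub, ← sub_mul, norm_mul]
    congr 1
    rw [show (ζ.re : ℂ) - ζ = ((-ζ.im : ℝ) : ℂ) * Complex.I by apply Complex.ext <;> simp]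
    simp
  have hfar := hrd _ (mem_edge.2 ⟨ζ.re, hre.1.le, hre.2.le, rfl⟩) _ hmem
  rw [edist_nndist, ENNReal.coe_lt_coe, ← NNReal.coe_lt_coe, coe_nndist, hdist] at hfar
  have hδr := (lt_div_iff₀ he).1 hδ.2
  nlinarith

theorem eventually_notMem_edge (P : Pentagon) (k j : Fin 5) : ∀ᶠ δ in 𝓝[>] (0 : ℝ),
    ∀ ζ ∈ thinRhombus δ, ζ.im ≠ 0 → P.edgePoint k ζ ∉ P.edge j := by
  have he := P.vertices_succ_sub_ne_zero k
  have hj : j = k ∨ j = k + 1 ∨ j = k + 2 ∨ j = k + 3 ∨ j = k - 1 := by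
    clear he P; revert j k; decide
  rcases hj with rfl | rfl | rfl | rfl | rfl
  · refine Eventually.of_forall fun δ ζ _ him hmem => him ?_
    obtain ⟨t, -, -, ht⟩ := mem_edge.1 hmem
    rw [P.edgePoint_injective j ht, Complex.ofReal_im]
  · filter_upwards [eventually_ray_notMem_thinRhombus (-(P.vertices (k + 1 + 1) -
      P.vertices (k + 1)) / (P.vertices (k + 1) - P.vertices k))] with δ hδ ζ hζ him hmem
    obtain ⟨t, ht0, -, ht⟩ := mem_edge.1 hmem
    have hray : 1 - ζ = t * (-(P.vertices (k + 1 + 1) - P.vertices (k + 1)) /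
        (P.vertices (k + 1) - P.vertices k)) := by
      rw [edgePoint, edgePoint] at ht
      field_simp
      linear_combination -ht
    exact hδ t ht0 (hray ▸ by simpa using him) (hray ▸ one_sub_mem_thinRhombus hζ)
  · exact (P.eventually_notMem_edge_of_disjoint (P.disjoint_edge_add_two k)).mono
      fun δ h ζ hζ _ => h ζ hζ
  · exact (P.eventually_notMem_edge_of_disjoint (P.disjoint_edge_add_three k)).mono
      fun δ h ζ hζ _ => h ζ hζ
  · filter_upwards [eventually_ray_notMem_thinRhombus ((P.vertices (k - 1) - P.vertices k) /
      (P.vertices (k + 1) - P.vertices k))] with δ hδ ζ hζ him hmem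
    obtain ⟨t, -, ht1, ht⟩ := mem_edge.1 hmem
    have hray : ζ = ((1 - t : ℝ) : ℂ) * ((P.vertices (k - 1) - P.vertices k) /
        (P.vertices (k + 1) - P.vertices k)) := by
      rw [edgePoint, edgePoint, sub_add_cancel] at ht
      push_cast
      field_simp
      linear_combination ht
    exact hδ (1 - t) (by linarith) (hray ▸ him) (hray ▸ hζ)

theorem exists_half_rhombus_dichotomy (P : Pentagon) (k : Fin 5) : ∃ δ > 0, ∀ s : ℝ,
    P.edgePoint k '' (thinRhombus δ ∩ {ζ | 0 < s * ζ.im}) ⊆ interior P.region ∨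
      P.edgePoint k '' (thinRhombus δ ∩ {ζ | 0 < s * ζ.im}) ⊆ P.regionᶜ := by
  obtain ⟨δ, hoff, hδ⟩ := ((Filter.eventually_all.2 fun j => P.eventually_notMem_edge k j).and
    self_mem_nhdsWithin).exists
  refine ⟨δ, hδ, fun s => subset_interior_or_subset_compl_of_disjoint_frontier
    ((convex_thinRhombus_inter δ s).isPreconnected.image _ (P.continuous_edgePoint k).continuousOn)
    P.isClosed_region (Set.disjoint_left.2 ?_)⟩
  rintro _ ⟨ζ, ⟨hζ, hs⟩, rfl⟩ hf
  obtain ⟨j, hj⟩ := mem_iUnion.1 (P.frontier_eq ▸ hf)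
  exact hoff j ζ hζ (fun h => by simp [h] at hs) hj

theorem edgePoint_half_mem_edge (P : Pentagon) (k : Fin 5) : P.edgePoint k (1 / 2) ∈ P.edge k :=
  mem_edge.2 ⟨1 / 2, by norm_num, by norm_num, by norm_num⟩

theorem mem_of_mem_thinRhombus (P : Pentagon) {k : Fin 5} {δ : ℝ} (hδ : 0 < δ) {ζ : ℂ}
    (hζ : ζ ∈ thinRhombus δ) :
    P.edgePoint k ζ ∈ P.edgePoint k '' (thinRhombus δ ∩ {ζ | 0 < 1 * ζ.im}) ∨
    P.edgePoint k ζ ∈ P.edgePoint k '' (thinRhombus δ ∩ {ζ | 0 < -1 * ζ.im}) ∨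
    P.edgePoint k ζ ∈ P.edge k := by
  rcases lt_trichotomy ζ.im 0 with h | h | h
  · exact Or.inr (Or.inl ⟨ζ, ⟨hζ, by simpa using h⟩, rfl⟩)
  · have hre := re_mem_Ioo_of_mem_thinRhombus hδ hζ
    refine Or.inr (Or.inr (mem_edge.2 ⟨ζ.re, hre.1.le, hre.2.le, congrArg _ ?_⟩))
    apply Complex.ext <;> simp [h]
  · exact Or.inl ⟨ζ, ⟨hζ, by simpa using h⟩, rfl⟩

theorem image_thinRhombus_mem_nhds (P : Pentagon) (k : Fin 5) {δ : ℝ} (hδ : 0 < δ) :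
    P.edgePoint k '' thinRhombus δ ∈ 𝓝 (P.edgePoint k (1 / 2)) := by
  refine (P.isOpenMap_edgePoint k).image_mem_nhds ((isOpen_thinRhombus δ).mem_nhds ?_)
  constructor <;> norm_num [hδ]

/-- The side of the `k`-th edge given by the sign `σ` (left for `1`, right for `-1`) is inside the
pentagon, the other side is outside. -/
def SideIn (P : Pentagon) (k : Fin 5) (σ : ℝ) : Prop :=
  ∃ δ > 0, ∀ ζ ∈ thinRhombus δ, (0 < σ * ζ.im → P.edgePoint k ζ ∈ interior P.region) ∧
    (σ * ζ.im < 0 → P.edgePoint k ζ ∉ P.region)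

theorem exists_sideIn (P : Pentagon) (k : Fin 5) : ∃ σ : ℝ, (σ = 1 ∨ σ = -1) ∧ P.SideIn k σ := by
  obtain ⟨δ, hδ, hdich⟩ := P.exists_half_rhombus_dichotomy k
  have hmid := P.edgePoint_half_mem_edge k
  have hnear := P.image_thinRhombus_mem_nhds k hδ
  have of_subset {σ : ℝ}
      (hin : P.edgePoint k '' (thinRhombus δ ∩ {ζ | 0 < σ * ζ.im}) ⊆ interior P.region)
      (hout : P.edgePoint k '' (thinRhombus δ ∩ {ζ | 0 < -σ * ζ.im}) ⊆ P.regionᶜ) :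
      P.SideIn k σ :=
    ⟨δ, hδ, fun ζ hζ => ⟨fun h => hin ⟨ζ, ⟨hζ, h⟩, rfl⟩,
      fun h => hout ⟨ζ, ⟨hζ, by simpa using h⟩, rfl⟩⟩⟩
  rcases hdich 1 with hleft | hleft <;> rcases hdich (-1) with hright | hright
  · refine absurd (mem_interior_iff_mem_nhds.2 ?_) (P.edge_subset_frontier k hmid).2
    filter_upwards [hnear]
    rintro _ ⟨ζ, hζ, rfl⟩
    rcases P.mem_of_mem_thinRhombus hδ hζ with h | h | h
    · exact interior_subset (hleft h)
    · exact interior_subset (hright h)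
    · exact P.edge_subset_region k h
  · exact ⟨1, Or.inl rfl, of_subset hleft hright⟩
  · exact ⟨-1, Or.inr rfl, of_subset hright (by rwa [neg_neg])⟩
  · have hcl : P.edgePoint k (1 / 2) ∈ closure (interior P.region) := by
      rw [P.closure_interior_region]
      exact P.edge_subset_region k hmid
    obtain ⟨_, ⟨ζ, hζ, rfl⟩, hint⟩ := mem_closure_iff_nhds.1 hcl _ hnear
    rcases P.mem_of_mem_thinRhombus hδ hζ with h | h | h
    · exact absurd (interior_subset hint) (hleft h)
    · exact absurd (interior_subset hint) (hright h)
    · exact absurd hint (P.edge_subset_frontier k h).2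

end Pentagon

theorem exp_mul_I_ne_one {θ : ℝ} (h0 : θ ≠ 0) (h1 : |θ| < 2 * π) :
    Complex.exp (θ * Complex.I) ≠ 1 := by
  intro h
  obtain ⟨n, hn⟩ := Complex.exp_eq_one_iff.1 h
  have hθ : θ = n * (2 * π) := by simpa using congrArg Complex.im hn
  rw [hθ, abs_mul, abs_of_pos Real.two_pi_pos, mul_lt_iff_lt_one_left Real.two_pi_pos] at h1
  have hn0 : n = 0 := Int.abs_lt_one_iff.1 (by exact_mod_cast h1)
  exact h0 (by rw [hθ, hn0, Int.cast_zero, zero_mul])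

theorem exp_add_two_pi_mul_I (θ : ℝ) :
    Complex.exp ((θ + 2 * π : ℝ) * Complex.I) = Complex.exp (θ * Complex.I) := by
  rw [← Complex.exp_periodic (θ * Complex.I)]
  push_cast
  ring_nf

theorem exp_sub_two_pi_mul_I (θ : ℝ) :
    Complex.exp ((θ - 2 * π : ℝ) * Complex.I) = Complex.exp (θ * Complex.I) := by
  rw [← exp_add_two_pi_mul_I (θ - 2 * π), sub_add_cancel]

theorem norm_ofReal_mul_exp {r : ℝ} (hr : 0 ≤ r) (φ : ℝ) :
    ‖r * Complex.exp (φ * Complex.I)‖ = r := by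
  rw [norm_mul, Complex.norm_exp_ofReal_mul_I, mul_one, Complex.norm_real, Real.norm_of_nonneg hr]

section Sign

variable {σ : ℝ} (hσ : σ = 1 ∨ σ = -1)
include hσ

theorem abs_sign_mul (φ : ℝ) : |σ * φ| = |φ| := by
  rcases hσ with rfl | rfl <;> simp

theorem sign_mul_im_mul_exp (r φ : ℝ) :
    σ * (r * Complex.exp ((σ * φ : ℝ) * Complex.I)).im = r * Real.sin φ := by
  rw [Complex.im_ofReal_mul, Complex.exp_ofReal_mul_I_im]
  rcases hσ with rfl | rfl <;> simp

theorem exp_sign_mul_neg (φ : ℝ) : Complex.exp ((σ * -φ : ℝ) * Complex.I) =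
    Complex.exp ((σ * (2 * π - φ) : ℝ) * Complex.I) := by
  rcases hσ with rfl | rfl
  · rw [one_mul, one_mul, ← exp_add_two_pi_mul_I, neg_add_eq_sub]
  · rw [← exp_sub_two_pi_mul_I]
    congr 2
    ring_nf

theorem exists_angle {q : ℂ} (hq : ∀ t : ℝ, 0 ≤ t → q ≠ t) : ∃ α ∈ Ioo (0 : ℝ) (2 * π),
    q = ‖q‖ * Complex.exp ((σ * α : ℝ) * Complex.I) := by
  have harg := Complex.norm_mul_exp_arg_mul_I q
  have h0 : q.arg ≠ 0 := fun h => by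
    rw [Complex.arg_eq_zero_iff] at h
    exact hq q.re h.1 (by apply Complex.ext <;> simp [h.2])
  have h1 := Complex.neg_pi_lt_arg q
  have h2 := Complex.arg_le_pi q
  rcases hσ with rfl | rfl <;> rcases h0.lt_or_gt with hlt | hgt
  · exact ⟨q.arg + 2 * π, ⟨by linarith, by linarith⟩, by rw [one_mul, exp_add_two_pi_mul_I, harg]⟩
  · exact ⟨q.arg, ⟨hgt, by linarith⟩, by rw [one_mul, harg]⟩
  · exact ⟨-q.arg, ⟨by linarith, by linarith⟩, by rw [neg_one_mul, neg_neg, harg]⟩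
  · refine ⟨2 * π - q.arg, ⟨by linarith, by linarith⟩, ?_⟩
    rw [neg_one_mul, neg_sub, exp_sub_two_pi_mul_I, harg]

end Sign

namespace Pentagon

/-- The point at distance `r` (in units of the `k`-th edge) from the `k`-th vertex, in the direction
of the `k`-th edge turned by `φ` counterclockwise (`σ = 1`) or clockwise (`σ = -1`). -/
noncomputable def cornerPoint (P : Pentagon) (k : Fin 5) (σ r φ : ℝ) : ℂ :=
  P.edgePoint k (r * Complex.exp ((σ * φ : ℝ) * Complex.I))

/-- The pentagon fills the sector of angle `α` at the `k`-th vertex which starts at the `k`-th edge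
and extends counterclockwise (`σ = 1`) or clockwise (`σ = -1`). -/
def HasSector (P : Pentagon) (k : Fin 5) (σ α : ℝ) : Prop :=
  ∃ ε > 0, ∀ r ∈ Ioo 0 ε, (∀ φ ∈ Ioo 0 α, P.cornerPoint k σ r φ ∈ interior P.region) ∧
    ∀ φ ∈ Ioo α (2 * π), P.cornerPoint k σ r φ ∉ P.region

/-- The previous edge is the `k`-th edge turned by the angle `α` counterclockwise (`σ = 1`) or
clockwise (`σ = -1`) about the `k`-th vertex, up to scaling. -/
def Turns (P : Pentagon) (k : Fin 5) (σ α : ℝ) : Prop :=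
  ∃ ρ > 0, P.vertices (k - 1) = P.cornerPoint k σ ρ α

theorem exists_forall_edgePoint_frontier (P : Pentagon) (k : Fin 5) : ∃ ε > 0, ∀ ζ : ℂ, ‖ζ‖ < ε →
    P.edgePoint k ζ ∈ frontier P.region → (∃ t : ℝ, 0 ≤ t ∧ ζ = t) ∨ ∃ t : ℝ, 0 ≤ t ∧
      ζ = t * ((P.vertices (k - 1) - P.vertices k) / (P.vertices (k + 1) - P.vertices k)) := by
  have he := P.vertices_succ_sub_ne_zero k
  have hfar : ∀ᶠ z in 𝓝 (P.vertices k), ∀ j : Fin 5, j ≠ k ∧ j + 1 ≠ k → z ∉ P.edge j :=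
    Filter.eventually_all.2 fun j => Filter.eventually_imp_distrib_left.2 fun h =>
      (P.isClosed_edge j).isOpen_compl.mem_nhds (P.vertex_notMem_edge h.1 h.2)
  have hcont : Tendsto (P.edgePoint k) (𝓝 0) (𝓝 (P.vertices k)) := by
    simpa [edgePoint] using (P.continuous_edgePoint k).tendsto 0
  obtain ⟨ε, hε, hball⟩ := Metric.eventually_nhds_iff.1 (hcont.eventually hfar)
  refine ⟨ε, hε, fun ζ hζ hf => ?_⟩
  obtain ⟨j, hj⟩ := mem_iUnion.1 (P.frontier_eq ▸ hf)
  by_cases hjk : j = k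
  · subst hjk
    obtain ⟨t, ht0, -, ht⟩ := mem_edge.1 hj
    exact Or.inl ⟨t, ht0, P.edgePoint_injective j ht⟩
  by_cases hjk' : j + 1 = k
  · subst hjk'
    obtain ⟨t, -, ht1, ht⟩ := mem_edge.1 hj
    refine Or.inr ⟨1 - t, by linarith, ?_⟩
    rw [edgePoint, edgePoint] at ht
    rw [add_sub_cancel_right]
    push_cast
    field_simp
    linear_combination ht
  · exact absurd hj (hball (by simpa using hζ) j ⟨hjk, hjk'⟩)

theorem prev_ratio_ne (P : Pentagon) (k : Fin 5) (t : ℝ) (ht : 0 ≤ t) :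
    (P.vertices (k - 1) - P.vertices k) / (P.vertices (k + 1) - P.vertices k) ≠ t := by
  have he := P.vertices_succ_sub_ne_zero k
  intro h
  have hprev : P.vertices (k - 1) = P.edgePoint k t := by
    rw [edgePoint, ← h, div_mul_cancel₀ _ he, add_sub_cancel]
  have hne : P.vertices (k - 1) ≠ P.vertices k := by
    simpa [eq_comm] using P.vertices_succ_ne (k - 1)
  have ht0 : 0 < t := ht.lt_of_ne fun h0 => hne (by rw [hprev, ← h0]; simp [edgePoint])
  have hm : 0 < min 1 t := lt_min one_pos ht0
  have hmem : P.edgePoint k (min 1 t : ℝ) ∈ P.edge (k - 1) ∩ P.edge (k - 1 + 1) := by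
    constructor
    · refine mem_edge.2 ⟨1 - min 1 t / t, ?_, ?_, ?_⟩
      · rw [sub_nonneg, div_le_one ht0]
        exact min_le_right _ _
      · linarith [div_pos hm ht0]
      · rw [edgePoint, edgePoint, sub_add_cancel, hprev, edgePoint]
        have htc : (t : ℂ) ≠ 0 := by exact_mod_cast ht0.ne'
        push_cast
        field_simp
        ring
    · rw [sub_add_cancel]
      exact mem_edge.2 ⟨min 1 t, hm.le, min_le_left _ _, rfl⟩
  rw [edge_inter, sub_add_cancel, mem_singleton_iff] at hmem
  have hzero : ((min 1 t : ℝ) : ℂ) = 0 := P.edgePoint_injective k (by simpa [edgePoint] using hmem)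
  exact hm.ne' (by exact_mod_cast hzero)

section Sector

variable {P : Pentagon} {k : Fin 5} {σ α : ℝ}

theorem exists_turns (hσ : σ = 1 ∨ σ = -1) : ∃ α ∈ Ioo (0 : ℝ) (2 * π), P.Turns k σ α := by
  have he := P.vertices_succ_sub_ne_zero k
  obtain ⟨α, hα, hq⟩ := exists_angle hσ (P.prev_ratio_ne k)
  refine ⟨α, hα, ‖(P.vertices (k - 1) - P.vertices k) / (P.vertices (k + 1) - P.vertices k)‖,
    norm_pos_iff.2 fun h => ?_, ?_⟩
  · exact P.prev_ratio_ne k 0 le_rfl (by simpa using h)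
  · rw [cornerPoint, ← hq, edgePoint, div_mul_cancel₀ _ he, add_sub_cancel]

theorem Turns.edge_prev (h : P.Turns k σ α) :
    (P.vertices (k - 1) - P.vertices k) * dist (P.vertices k) (P.vertices (k + 1)) =
      (P.vertices (k + 1) - P.vertices k) * dist (P.vertices (k - 1)) (P.vertices k) *
        Complex.exp ((σ * α : ℝ) * Complex.I) := by
  obtain ⟨ρ, hρ, hprev⟩ := h
  have hsub : P.vertices (k - 1) - P.vertices k = ρ * Complex.exp ((σ * α : ℝ) * Complex.I) *
      (P.vertices (k + 1) - P.vertices k) := by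
    rw [hprev, cornerPoint, edgePoint, add_sub_cancel_left]
  rw [dist_comm (P.vertices k), dist_eq_norm, dist_eq_norm, hsub, norm_mul,
    norm_ofReal_mul_exp hρ.le]
  push_cast
  ring

theorem Turns.exists_cornerPoint_notMem_frontier (hσ : σ = 1 ∨ σ = -1)
    (hα : α ∈ Ioo (0 : ℝ) (2 * π)) (hturn : P.Turns k σ α) : ∃ ε > 0, ∀ r ∈ Ioo 0 ε,
      ∀ φ ∈ Ioo 0 (2 * π), φ ≠ α → P.cornerPoint k σ r φ ∉ frontier P.region := by
  obtain ⟨ε, hε, hnear⟩ := P.exists_forall_edgePoint_frontier k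
  refine ⟨ε, hε, fun r hr φ hφ hne hf => ?_⟩
  obtain ⟨ρ, hρ, hprev⟩ := hturn
  have hratio : (P.vertices (k - 1) - P.vertices k) / (P.vertices (k + 1) - P.vertices k) =
      ρ * Complex.exp ((σ * α : ℝ) * Complex.I) := by
    rw [hprev, cornerPoint, edgePoint, add_sub_cancel_left,
      mul_div_cancel_right₀ _ (P.vertices_succ_sub_ne_zero k)]
  have hnorm := norm_ofReal_mul_exp hr.1.le (σ * φ)
  rcases hnear _ (hnorm.trans_lt hr.2) hf with ⟨t, ht, h⟩ | ⟨t, ht, h⟩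
  · rw [h, Complex.norm_real, Real.norm_of_nonneg ht] at hnorm
    rw [hnorm, mul_eq_left₀ (by exact_mod_cast hr.1.ne')] at h
    refine exp_mul_I_ne_one (abs_ne_zero.1 ?_) ?_ h <;> rw [abs_sign_mul hσ, abs_of_pos hφ.1]
    exacts [hφ.1.ne', hφ.2]
  · rw [hratio, ← mul_assoc, ← Complex.ofReal_mul] at h
    rw [h, norm_ofReal_mul_exp (by positivity)] at hnorm
    rw [hnorm] at h
    have hexp := mul_left_cancel₀ (by exact_mod_cast hr.1.ne') h
    have hone : Complex.exp ((σ * (φ - α) : ℝ) * Complex.I) = 1 := by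
      rw [mul_sub, Complex.ofReal_sub, sub_mul, Complex.exp_sub, hexp,
        div_self (Complex.exp_ne_zero _)]
    refine exp_mul_I_ne_one (abs_ne_zero.1 ?_) ?_ hone <;> rw [abs_sign_mul hσ]
    · exact abs_ne_zero.2 (sub_ne_zero.2 hne)
    · exact abs_sub_lt_iff.2 ⟨by linarith [hφ.2, hα.1], by linarith [hφ.1, hα.2]⟩

theorem sector_dichotomy {ε a b : ℝ} (hoff : ∀ r ∈ Ioo 0 ε, ∀ φ ∈ Ioo a b,
      P.cornerPoint k σ r φ ∉ frontier P.region) :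
    (∀ r ∈ Ioo 0 ε, ∀ φ ∈ Ioo a b, P.cornerPoint k σ r φ ∈ interior P.region) ∨
    ∀ r ∈ Ioo 0 ε, ∀ φ ∈ Ioo a b, P.cornerPoint k σ r φ ∉ P.region := by
  have hpre : IsPreconnected ((fun p : ℝ × ℝ => P.cornerPoint k σ p.1 p.2) ''
      (Ioo 0 ε ×ˢ Ioo a b)) := by
    refine (isPreconnected_Ioo.prod isPreconnected_Ioo).image _ (Continuous.continuousOn ?_)
    exact (P.continuous_edgePoint k).comp (by fun_prop)
  refine (subset_interior_or_subset_compl_of_disjoint_frontier hpre P.isClosed_region ?_).imp ?_ ?_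
  · rw [Set.disjoint_left]
    rintro _ ⟨⟨r, φ⟩, ⟨hr, hφ⟩, rfl⟩
    exact hoff r hr φ hφ
  all_goals exact fun h r hr φ hφ => h ⟨(r, φ), ⟨hr, hφ⟩, rfl⟩

theorem exists_small_angle {δ α : ℝ} (hδ : 0 < δ) (hα : 0 < α) :
    ∃ φ, 0 < φ ∧ φ ≤ 1 ∧ φ < δ / 2 ∧ φ < α :=
  ⟨min (α / 2) (min 1 (δ / 4)), by positivity, by simp, by
    rw [min_lt_iff, min_lt_iff]; exact Or.inr (Or.inr (by linarith)), by
    rw [min_lt_iff]; exact Or.inl (by linarith)⟩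

theorem SideIn.exists_cornerPoint_mem (hσ : σ = 1 ∨ σ = -1) (h : P.SideIn k σ) {β : ℝ}
    (hβ : 0 < β) : ∃ φ ∈ Ioo 0 β, ∀ r ∈ Ioc (0 : ℝ) (1 / 2),
      P.cornerPoint k σ r φ ∈ interior P.region ∧
      P.cornerPoint k σ r (2 * π - φ) ∉ P.region := by
  obtain ⟨δ, hδ, hside⟩ := h
  obtain ⟨φ, hφ0, hφ1, hφδ, hφβ⟩ := exists_small_angle hδ hβ
  have hsin : 0 < Real.sin φ :=
    Real.sin_pos_of_pos_of_lt_pi hφ0 (by linarith [Real.pi_gt_three])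
  refine ⟨φ, ⟨hφ0, hφβ⟩, fun r hr => ⟨(hside _ (mul_exp_mem_thinRhombus hr ?_ ?_)).1 ?_, ?_⟩⟩
  · rwa [abs_sign_mul hσ, abs_of_pos hφ0]
  · rwa [abs_sign_mul hσ, abs_of_pos hφ0]
  · rw [sign_mul_im_mul_exp hσ]
    exact mul_pos hr.1 hsin
  · rw [cornerPoint, ← exp_sign_mul_neg hσ]
    refine (hside _ (mul_exp_mem_thinRhombus hr ?_ ?_)).2 ?_
    · rwa [abs_sign_mul hσ, abs_neg, abs_of_pos hφ0]
    · rwa [abs_sign_mul hσ, abs_neg, abs_of_pos hφ0]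
    · rw [sign_mul_im_mul_exp hσ, Real.sin_neg]
      linarith [mul_pos hr.1 hsin]

theorem SideIn.hasSector (hσ : σ = 1 ∨ σ = -1) (hside : P.SideIn k σ)
    (hα : α ∈ Ioo (0 : ℝ) (2 * π)) (hturn : P.Turns k σ α) : P.HasSector k σ α := by
  obtain ⟨ε, hε, hoff⟩ := hturn.exists_cornerPoint_notMem_frontier hσ hα
  have hr : min (ε / 2) (1 / 2) ∈ Ioo 0 ε ∩ Ioc (0 : ℝ) (1 / 2) :=
    ⟨⟨by positivity, (min_le_left _ _).trans_lt (by linarith)⟩, by positivity, min_le_right _ _⟩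
  have hin : ∀ r ∈ Ioo 0 ε, ∀ φ ∈ Ioo 0 α, P.cornerPoint k σ r φ ∈ interior P.region := by
    refine (sector_dichotomy fun r hr φ hφ => hoff r hr φ ⟨hφ.1, hφ.2.trans hα.2⟩
      hφ.2.ne).resolve_right fun hout => ?_
    obtain ⟨φ, hφ, hmem⟩ := hside.exists_cornerPoint_mem hσ hα.1
    exact hout _ hr.1 φ hφ (interior_subset (hmem _ hr.2).1)
  have hout : ∀ r ∈ Ioo 0 ε, ∀ φ ∈ Ioo α (2 * π), P.cornerPoint k σ r φ ∉ P.region := by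
    refine (sector_dichotomy fun r hr φ hφ => hoff r hr φ ⟨hα.1.trans hφ.1, hφ.2⟩
      hφ.1.ne').resolve_left fun hin => ?_
    obtain ⟨φ, hφ, hmem⟩ := hside.exists_cornerPoint_mem hσ (sub_pos.2 hα.2)
    refine (hmem _ hr.2).2 (interior_subset (hin _ hr.1 _ ⟨?_, ?_⟩)) <;> linarith [hφ.1, hφ.2]
  exact ⟨ε, hε, fun r hr => ⟨hin r hr, hout r hr⟩⟩

theorem Turns.edgePoint_pred {ρ : ℝ} (hprev : P.vertices (k - 1) = P.cornerPoint k σ ρ α)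
    (r φ : ℝ) : P.edgePoint (k - 1) (1 - r * Complex.exp ((σ * -φ : ℝ) * Complex.I)) =
      P.cornerPoint k σ (r * ρ) (α - φ) := by
  rw [edgePoint, sub_add_cancel, hprev, cornerPoint, cornerPoint, edgePoint, edgePoint,
    show ((σ * (α - φ) : ℝ) : ℂ) * Complex.I = (σ * -φ : ℝ) * Complex.I + (σ * α : ℝ) * Complex.I
      by push_cast; ring, Complex.exp_add]
  push_cast
  ring

theorem SideIn.pred (hσ : σ = 1 ∨ σ = -1) (hα : 0 < α) (hturn : P.Turns k σ α)
    (hsec : P.HasSector k σ α) : P.SideIn (k - 1) σ := by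
  obtain ⟨σ₁, hσ₁, hside⟩ := P.exists_sideIn (k - 1)
  by_cases hs : σ₁ = σ
  · exact hs ▸ hside
  exfalso
  obtain rfl : σ₁ = -σ := by
    rcases hσ with rfl | rfl <;> rcases hσ₁ with rfl | rfl <;> simp_all
  obtain ⟨ρ, hρ, hprev⟩ := hturn
  obtain ⟨ε, hε, hin⟩ := hsec
  obtain ⟨δ, hδ, hside⟩ := hside
  obtain ⟨φ, hφ0, hφ1, hφδ, hφα⟩ := exists_small_angle hδ hα
  have hr : min (ε / ρ / 2) (1 / 2) ∈ Ioc (0 : ℝ) (1 / 2) := ⟨by positivity, min_le_right _ _⟩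
  have hrε : min (ε / ρ / 2) (1 / 2) < ε / ρ :=
    (min_le_left _ _).trans_lt (half_lt_self (div_pos hε hρ))
  set r := min (ε / ρ / 2) (1 / 2)
  have hthin : r * Complex.exp ((σ * -φ : ℝ) * Complex.I) ∈ thinRhombus δ := by
    refine mul_exp_mem_thinRhombus hr ?_ ?_ <;> rwa [abs_sign_mul hσ, abs_neg, abs_of_pos hφ0]
  refine (hside _ (one_sub_mem_thinRhombus hthin)).2 ?_ ?_
  · rw [Complex.sub_im, Complex.one_im, zero_sub, neg_mul_neg, sign_mul_im_mul_exp hσ,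
      Real.sin_neg, mul_neg, neg_lt_zero]
    exact mul_pos hr.1 (Real.sin_pos_of_pos_of_lt_pi hφ0 (by linarith [Real.pi_gt_three]))
  · rw [Turns.edgePoint_pred hprev]
    exact interior_subset ((hin (r * ρ) ⟨mul_pos hr.1 hρ, (lt_div_iff₀ hρ).1 hrε⟩).1 _
      ⟨by linarith, by linarith⟩)

theorem SideIn.exists_sector (hσ : σ = 1 ∨ σ = -1) (hside : P.SideIn k σ) :
    ∃ α ∈ Ioo (0 : ℝ) (2 * π), P.Turns k σ α ∧ P.HasSector k σ α ∧ P.SideIn (k - 1) σ := by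
  obtain ⟨α, hα, hturn⟩ := exists_turns (P := P) (k := k) hσ
  have hsec := hside.hasSector hσ hα hturn
  exact ⟨α, hα, hturn, hsec, .pred hσ hα.1 hturn hsec⟩

end Sector

theorem exists_orientation (P : Pentagon) :
    ∃ σ : ℝ, (σ = 1 ∨ σ = -1) ∧ ∀ k, P.SideIn k σ := by
  obtain ⟨σ, hσ, h0⟩ := P.exists_sideIn 0
  have hpred (k : Fin 5) (h : P.SideIn k σ) : P.SideIn (k - 1) σ := by
    obtain ⟨_, _, _, _, hk⟩ := h.exists_sector hσ
    exact hk
  have h4 : P.SideIn 4 σ := hpred 0 h0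
  have h3 : P.SideIn 3 σ := hpred 4 h4
  have h2 : P.SideIn 2 σ := hpred 3 h3
  refine ⟨σ, hσ, fun k => ?_⟩
  fin_cases k
  exacts [h0, hpred 2 h2, h2, h3, h4]

end Pentagon

theorem measurable_toIcoMod_two_pi : Measurable (toIcoMod Real.two_pi_pos 0) := by
  have h : toIcoMod Real.two_pi_pos 0 = fun x => Int.fract (x / (2 * π)) * (2 * π) := by
    funext x
    rw [toIcoMod_eq_fract_mul]
  rw [h]
  fun_prop

theorem integral_indicator_toIcoMod {α : ℝ} (hα : α ∈ Ioo (0 : ℝ) (2 * π)) (s : ℝ) :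
    ∫ x in s..s + 2 * π, (Ioo 0 α).indicator 1 (toIcoMod Real.two_pi_pos 0 x) = α := by
  have hper : Function.Periodic
      (fun x => (Ioo 0 α).indicator (1 : ℝ → ℝ) (toIcoMod Real.two_pi_pos 0 x)) (2 * π) :=
    fun x => congrArg _ (toIcoMod_add_right _ _ _)
  have hmod : EqOn (fun x => (Ioo 0 α).indicator (1 : ℝ → ℝ) (toIcoMod Real.two_pi_pos 0 x))
      ((Ioo 0 α).indicator 1) (Ioo 0 (2 * π)) := fun x hx =>
    congrArg _ ((toIcoMod_eq_self Real.two_pi_pos).2 ⟨hx.1.le, by simpa using hx.2⟩)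
  rw [hper.intervalIntegral_add_eq s 0, zero_add, intervalIntegral.integral_of_le (by positivity),
    integral_Ioc_eq_integral_Ioo, setIntegral_congr_fun measurableSet_Ioo hmod,
    integral_indicator_one measurableSet_Ioo, measureReal_restrict_apply measurableSet_Ioo,
    inter_eq_left.2 (Ioo_subset_Ioo_right hα.2.le), Real.volume_real_Ioo_of_le hα.1.le, sub_zero]

theorem volume_real_toIcoMod_mem_Ioo {σ : ℝ} (hσ : σ = 1 ∨ σ = -1) (a : ℝ) {α : ℝ}
    (hα : α ∈ Ioo (0 : ℝ) (2 * π)) : volume.real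
      ({θ | toIcoMod Real.two_pi_pos 0 (σ * (θ - a)) ∈ Ioo 0 α} ∩ Ioc (-π) π) = α := by
  have hmeas : MeasurableSet {θ | toIcoMod Real.two_pi_pos 0 (σ * (θ - a)) ∈ Ioo 0 α} :=
    measurableSet_Ioo.preimage (measurable_toIcoMod_two_pi.comp (by fun_prop))
  rw [← measureReal_restrict_apply hmeas, ← integral_indicator_one hmeas,
    ← intervalIntegral.integral_of_le (by linarith [Real.pi_pos])]
  change ∫ θ in -π..π, (Ioo 0 α).indicator 1 (toIcoMod Real.two_pi_pos 0 (σ * (θ - a))) = α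
  rcases hσ with rfl | rfl
  · simp only [one_mul]
    rw [intervalIntegral.integral_comp_sub_right
      (fun x => (Ioo 0 α).indicator 1 (toIcoMod Real.two_pi_pos 0 x)),
      show π - a = -π - a + 2 * π by ring, integral_indicator_toIcoMod hα]
  · simp only [neg_one_mul, neg_sub]
    rw [intervalIntegral.integral_comp_sub_left
      (fun x => (Ioo 0 α).indicator 1 (toIcoMod Real.two_pi_pos 0 x)),
      show a - -π = a - π + 2 * π by ring, integral_indicator_toIcoMod hα]

theorem ae_toIcoMod_ne {σ : ℝ} (hσ : σ = 1 ∨ σ = -1) (a c : ℝ) :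
    ∀ᵐ θ : ℝ, toIcoMod Real.two_pi_pos 0 (σ * (θ - a)) ≠ c := by
  filter_upwards [(countable_range fun n : ℤ => a + σ * (c + n • (2 * π))).ae_notMem volume]
    with θ hθ h
  refine hθ ⟨toIcoDiv Real.two_pi_pos 0 (σ * (θ - a)), ?_⟩
  change a + σ * (c + toIcoDiv Real.two_pi_pos 0 (σ * (θ - a)) • (2 * π)) = θ
  rw [← h, toIcoMod_add_toIcoDiv_zsmul]
  rcases hσ with rfl | rfl <;> ring

theorem exp_sign_mul_toIcoMod {σ : ℝ} (hσ : σ = 1 ∨ σ = -1) (x : ℝ) :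
    Complex.exp ((σ * toIcoMod Real.two_pi_pos 0 (σ * x) : ℝ) * Complex.I) =
      Complex.exp (x * Complex.I) := by
  rw [toIcoMod, Complex.exp_eq_exp_iff_exists_int]
  generalize toIcoDiv Real.two_pi_pos 0 (σ * x) = n
  rcases hσ with rfl | rfl
  · exact ⟨-n, by simp; ring⟩
  · exact ⟨n, by simp; ring⟩

namespace Pentagon

/-- The directions which point from the `k`-th vertex into the pentagon. -/
def directions (P : Pentagon) (k : Fin 5) : Set ℝ :=
  {θ : ℝ | θ ∈ Ioc (-π) π ∧
    ∀ᶠ t : ℝ in 𝓝[>] 0, P.vertices k + t * Complex.exp (θ * Complex.I) ∈ P.region}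

theorem angle_eq_volume_directions (P : Pentagon) (k : Fin 5) :
    P.angle k = volume.real (P.directions k) := rfl

/-- The angle in `[0, 2π)` by which the `k`-th edge has to be turned counterclockwise (`σ = 1`) or
clockwise (`σ = -1`) about the `k`-th vertex to point in the direction `θ`. -/
noncomputable def turnTo (P : Pentagon) (k : Fin 5) (σ θ : ℝ) : ℝ :=
  toIcoMod Real.two_pi_pos 0 (σ * (θ - (P.vertices (k + 1) - P.vertices k).arg))

variable {P : Pentagon} {k : Fin 5} {σ α θ : ℝ}

theorem cornerPoint_turnTo (hσ : σ = 1 ∨ σ = -1) (t : ℝ) :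
    P.cornerPoint k σ (t / ‖P.vertices (k + 1) - P.vertices k‖) (P.turnTo k σ θ) =
      P.vertices k + t * Complex.exp (θ * Complex.I) := by
  have he : (‖P.vertices (k + 1) - P.vertices k‖ : ℂ) ≠ 0 := by
    exact_mod_cast norm_ne_zero_iff.2 (P.vertices_succ_sub_ne_zero k)
  rw [cornerPoint, edgePoint, turnTo, exp_sign_mul_toIcoMod hσ, Complex.ofReal_sub, sub_mul,
    Complex.exp_sub]
  conv_lhs => enter [2, 2]; rw [← Complex.norm_mul_exp_arg_mul_I (_ - _)]
  push_cast
  field_simp [Complex.exp_ne_zero]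

theorem eventually_div_norm_mem_Ioo {e : ℂ} (he : e ≠ 0) {ε : ℝ} (hε : 0 < ε) :
    ∀ᶠ t : ℝ in 𝓝[>] 0, t / ‖e‖ ∈ Ioo 0 ε := by
  have hnorm := norm_pos_iff.2 he
  filter_upwards [Ioo_mem_nhdsGT (mul_pos hε hnorm)] with t ht
  exact ⟨div_pos ht.1 hnorm, (div_lt_iff₀ hnorm).2 ht.2⟩

theorem HasSector.eventually_mem (hσ : σ = 1 ∨ σ = -1) (h : P.HasSector k σ α)
    (hθ : P.turnTo k σ θ ∈ Ioo 0 α) :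
    ∀ᶠ t : ℝ in 𝓝[>] 0, P.vertices k + t * Complex.exp (θ * Complex.I) ∈ interior P.region := by
  obtain ⟨ε, hε, hsec⟩ := h
  filter_upwards [eventually_div_norm_mem_Ioo (P.vertices_succ_sub_ne_zero k) hε] with t ht
  exact cornerPoint_turnTo hσ t ▸ (hsec _ ht).1 _ hθ

theorem HasSector.eventually_notMem (hσ : σ = 1 ∨ σ = -1) (h : P.HasSector k σ α)
    (hθ : P.turnTo k σ θ ∈ Ioo α (2 * π)) :
    ∀ᶠ t : ℝ in 𝓝[>] 0, P.vertices k + t * Complex.exp (θ * Complex.I) ∉ P.region := by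
  obtain ⟨ε, hε, hsec⟩ := h
  filter_upwards [eventually_div_norm_mem_Ioo (P.vertices_succ_sub_ne_zero k) hε] with t ht
  exact cornerPoint_turnTo hσ t ▸ (hsec _ ht).2 _ hθ

theorem ae_turnTo_mem (hσ : σ = 1 ∨ σ = -1) (P : Pentagon) (k : Fin 5) (α : ℝ) :
    ∀ᵐ θ : ℝ, P.turnTo k σ θ ∈ Ioo 0 α ∨ P.turnTo k σ θ ∈ Ioo α (2 * π) := by
  filter_upwards [ae_toIcoMod_ne hσ _ 0, ae_toIcoMod_ne hσ _ α] with θ h0 hα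
  have hmem := toIcoMod_mem_Ico' Real.two_pi_pos
    (σ * (θ - (P.vertices (k + 1) - P.vertices k).arg))
  exact (lt_or_gt_of_ne hα).imp (fun h => ⟨hmem.1.lt_of_ne h0.symm, h⟩) fun h => ⟨h, hmem.2⟩

theorem ae_direction (P : Pentagon) (k : Fin 5) : ∀ᵐ θ : ℝ,
    (∀ᶠ t : ℝ in 𝓝[>] 0, P.vertices k + t * Complex.exp (θ * Complex.I) ∈ interior P.region) ∨
    ∀ᶠ t : ℝ in 𝓝[>] 0, P.vertices k + t * Complex.exp (θ * Complex.I) ∉ P.region := by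
  obtain ⟨σ, hσ, hs⟩ := P.exists_orientation
  obtain ⟨α, -, -, hsec, -⟩ := (hs k).exists_sector hσ
  filter_upwards [ae_turnTo_mem hσ P k α] with θ hθ
  exact hθ.imp (hsec.eventually_mem hσ) (hsec.eventually_notMem hσ)

theorem HasSector.directions_ae_eq (hσ : σ = 1 ∨ σ = -1) (h : P.HasSector k σ α) :
    P.directions k =ᵐ[volume] ({θ | P.turnTo k σ θ ∈ Ioo 0 α} ∩ Ioc (-π) π : Set ℝ) := by
  filter_upwards [ae_turnTo_mem hσ P k α] with θ hθ
  refine propext ⟨fun ⟨hmem, hin⟩ => ⟨hθ.resolve_right fun hout => ?_, hmem⟩,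
    fun ⟨hin, hmem⟩ => ⟨hmem, (h.eventually_mem hσ hin).mono fun _ ht => interior_subset ht⟩⟩
  obtain ⟨t, ht, ht'⟩ := (hin.and (h.eventually_notMem hσ hout)).exists
  exact ht' ht

theorem nullMeasurableSet_directions (P : Pentagon) (k : Fin 5) :
    NullMeasurableSet (P.directions k) := by
  obtain ⟨σ, hσ, hs⟩ := P.exists_orientation
  obtain ⟨α, -, -, hsec, -⟩ := (hs k).exists_sector hσ
  have hmeas : Measurable (P.turnTo k σ) := measurable_toIcoMod_two_pi.comp (by fun_prop)
  exact ((measurableSet_Ioo.preimage hmeas).inter measurableSet_Ioc).nullMeasurableSet.congr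
    (hsec.directions_ae_eq hσ).symm

theorem HasSector.angle_eq (hσ : σ = 1 ∨ σ = -1) (h : P.HasSector k σ α)
    (hα : α ∈ Ioo (0 : ℝ) (2 * π)) : P.angle k = α := by
  rw [angle_eq_volume_directions, measureReal_congr (h.directions_ae_eq hσ)]
  exact volume_real_toIcoMod_mem_Ioo hσ _ hα

theorem exists_orientation_angle (P : Pentagon) : ∃ σ : ℝ, (σ = 1 ∨ σ = -1) ∧
    (∀ k, P.SideIn k σ) ∧ ∀ k, P.angle k ∈ Ioo (0 : ℝ) (2 * π) ∧
      P.HasSector k σ (P.angle k) ∧ P.Turns k σ (P.angle k) := by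
  obtain ⟨σ, hσ, hs⟩ := P.exists_orientation
  refine ⟨σ, hσ, hs, fun k => ?_⟩
  obtain ⟨α, hα, hturn, hsec, -⟩ := (hs k).exists_sector hσ
  rw [hsec.angle_eq hσ hα]
  exact ⟨hα, hsec, hturn⟩

end Pentagon

theorem exists_const_of_eventually_const {f : ℝ → ℝ}
    (hf : ∀ y, ∃ c, ∀ᶠ t in 𝓝[≠] y, f t = c) : ∃ c, ∀ y, ∀ᶠ t in 𝓝[≠] y, f t = c := by
  choose c hc using hf
  have hloc : IsLocallyConstant c := by
    rw [IsLocallyConstant.iff_eventually_eq]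
    intro y
    filter_upwards [eventually_eventually_nhds.2 (eventually_nhdsWithin_iff.1 (hc y))] with t ht
    have hne : ∀ᶠ s in 𝓝[≠] t, s ≠ y := by
      rcases eq_or_ne t y with rfl | hty
      · exact self_mem_nhdsWithin
      · exact eventually_nhdsWithin_of_eventually_nhds (isOpen_ne.mem_nhds hty)
    obtain ⟨s, hst, hsy, hs⟩ :=
      ((hc t).and ((eventually_nhdsWithin_of_eventually_nhds ht).and hne)).exists
    rw [← hst, hsy hs]
  exact ⟨c 0, fun y => hloc.apply_eq_of_preconnectedSpace y 0 ▸ hc y⟩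

theorem eventually_indicator_eq_of_notMem_frontier {X : Type*} [TopologicalSpace X] {s : Set X}
    {x : X} (hx : x ∉ frontier s) :
    ∀ᶠ t in 𝓝 x, s.indicator (1 : X → ℝ) t = s.indicator 1 x := by
  by_cases hs : x ∈ s
  · have hint : x ∈ interior s := by
      by_contra h
      exact hx ⟨subset_closure hs, h⟩
    filter_upwards [isOpen_interior.mem_nhds hint] with t ht
    rw [indicator_of_mem hs, indicator_of_mem (interior_subset ht), Pi.one_apply, Pi.one_apply]
  · have hext : x ∉ closure s := fun h => hx ⟨h, fun hi => hs (interior_subset hi)⟩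
    filter_upwards [isClosed_closure.isOpen_compl.mem_nhds hext] with t ht
    rw [indicator_of_notMem hs, indicator_of_notMem fun h => ht (subset_closure h)]

theorem intervalIntegral_interpolation (a b p q : ℝ) :
    ∫ x in a..b, (p + (x - a) / (b - a) * (q - p)) = (b - a) * (p + q) / 2 := by
  rcases eq_or_ne a b with rfl | hab
  · simp
  have hba : b - a ≠ 0 := sub_ne_zero.2 hab.symm
  have hderiv : ∀ x, HasDerivAt (fun x => p * x + (x - a) ^ 2 / 2 / (b - a) * (q - p))
      (p + (x - a) / (b - a) * (q - p)) x := by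
    intro x
    have hlin : HasDerivAt (fun x => p * x) p x := by
      simpa using (hasDerivAt_id x).const_mul p
    have hsq : HasDerivAt (fun x => (x - a) ^ 2 / 2) (x - a) x := by
      simpa using (((hasDerivAt_id x).sub_const a).pow 2).div_const 2
    exact hlin.add ((hsq.div_const _).mul_const _)
  rw [intervalIntegral.integral_eq_sub_of_hasDerivAt (fun x _ => hderiv x)
    (by apply Continuous.intervalIntegrable; fun_prop)]
  field_simp
  ring

theorem continuous_mk_im (x : ℝ) : Continuous fun y : ℝ => (⟨x, y⟩ : ℂ) :=
  Complex.equivRealProdCLM.symm.continuous.comp (by fun_prop : Continuous fun y : ℝ => (x, y))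

namespace Pentagon

/-- The position on the `k`-th edge at which the line through it meets the vertical line at `x`;
the value is `0` if the edge is vertical. -/
noncomputable def crossParam (P : Pentagon) (k : Fin 5) (x : ℝ) : ℝ :=
  (x - (P.vertices k).re) / ((P.vertices (k + 1)).re - (P.vertices k).re)

/-- The height at which the line through the `k`-th edge meets the vertical line at `x`. -/
noncomputable def crossHeight (P : Pentagon) (k : Fin 5) (x : ℝ) : ℝ :=
  (P.edgePoint k (P.crossParam k x)).im

/-- The direction in which the `k`-th edge crosses the vertical line at `x`: `1` for rightwards,
`-1` for leftwards, `0` if it does not cross. -/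
noncomputable def crossSign (P : Pentagon) (k : Fin 5) (x : ℝ) : ℝ :=
  (Ioo (P.vertices k).re (P.vertices (k + 1)).re).indicator 1 x -
    (Ioo (P.vertices (k + 1)).re (P.vertices k).re).indicator 1 x

theorem crossHeight_eq (P : Pentagon) (k : Fin 5) (x : ℝ) : P.crossHeight k x =
    (P.vertices k).im + (x - (P.vertices k).re) / ((P.vertices (k + 1)).re - (P.vertices k).re) *
      ((P.vertices (k + 1)).im - (P.vertices k).im) := by
  rw [crossHeight, edgePoint, Complex.add_im, Complex.im_ofReal_mul, Complex.sub_im, crossParam]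

section Crossing

variable {P : Pentagon} {j k : Fin 5} {σ x y M : ℝ}

theorem crossSign_of_mem_Ioo (h : x ∈ Ioo (P.vertices k).re (P.vertices (k + 1)).re) :
    P.crossSign k x = 1 := by
  rw [crossSign, indicator_of_mem h, indicator_of_notMem fun h' => lt_asymm h.1 h'.2, sub_zero,
    Pi.one_apply]

theorem crossSign_of_mem_Ioo_rev (h : x ∈ Ioo (P.vertices (k + 1)).re (P.vertices k).re) :
    P.crossSign k x = -1 := by
  rw [crossSign, indicator_of_mem h, indicator_of_notMem fun h' => lt_asymm h.1 h'.2, zero_sub,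
    Pi.one_apply]

theorem crossSign_cases (h : P.crossSign k x ≠ 0) :
    (P.crossSign k x = 1 ∧ x ∈ Ioo (P.vertices k).re (P.vertices (k + 1)).re) ∨
      (P.crossSign k x = -1 ∧ x ∈ Ioo (P.vertices (k + 1)).re (P.vertices k).re) := by
  by_cases hr : x ∈ Ioo (P.vertices k).re (P.vertices (k + 1)).re
  · exact Or.inl ⟨crossSign_of_mem_Ioo hr, hr⟩
  by_cases hl : x ∈ Ioo (P.vertices (k + 1)).re (P.vertices k).re
  · exact Or.inr ⟨crossSign_of_mem_Ioo_rev hl, hl⟩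
  · rw [crossSign, indicator_of_notMem hr, indicator_of_notMem hl, sub_zero] at h
    exact absurd rfl h

theorem crossParam_mem_Ioo (h : P.crossSign k x ≠ 0) : P.crossParam k x ∈ Ioo (0 : ℝ) 1 := by
  rw [crossParam]
  rcases crossSign_cases h with ⟨-, hl, hr⟩ | ⟨-, hl, hr⟩
  · exact ⟨div_pos (by linarith) (by linarith), (div_lt_one (by linarith)).2 (by linarith)⟩
  · exact ⟨div_pos_of_neg_of_neg (by linarith) (by linarith),
      (div_lt_one_of_neg (by linarith)).2 (by linarith)⟩

theorem mk_crossHeight (h : P.crossSign k x ≠ 0) :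
    (⟨x, P.crossHeight k x⟩ : ℂ) = P.edgePoint k (P.crossParam k x) := by
  have hne : (P.vertices (k + 1)).re - (P.vertices k).re ≠ 0 := by
    rcases crossSign_cases h with ⟨-, hl, hr⟩ | ⟨-, hl, hr⟩
    · exact (sub_pos.2 (hl.trans hr)).ne'
    · exact (sub_neg.2 (hl.trans hr)).ne
  refine Complex.ext ?_ rfl
  rw [edgePoint, Complex.add_re, Complex.re_ofReal_mul, Complex.sub_re, crossParam,
    div_mul_cancel₀ _ hne, add_sub_cancel]

theorem mk_crossHeight_mem_edge (h : P.crossSign k x ≠ 0) :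
    (⟨x, P.crossHeight k x⟩ : ℂ) ∈ P.edge k :=
  mem_edge.2 ⟨_, (crossParam_mem_Ioo h).1.le, (crossParam_mem_Ioo h).2.le, mk_crossHeight h⟩

theorem abs_crossHeight_le (hM : ∀ z ∈ P.region, |z.im| ≤ M) (h : P.crossSign k x ≠ 0) :
    |P.crossHeight k x| ≤ M :=
  hM ⟨x, P.crossHeight k x⟩ (P.edge_subset_region k (mk_crossHeight_mem_edge h))

theorem crossing_of_mem_edge (hx : ∀ k, (P.vertices k).re ≠ x)
    (h : (⟨x, y⟩ : ℂ) ∈ P.edge k) : P.crossSign k x ≠ 0 ∧ P.crossHeight k x = y := by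
  obtain ⟨t, ht0, ht1, ht⟩ := mem_edge.1 h
  have hre : x = (P.vertices k).re + t * ((P.vertices (k + 1)).re - (P.vertices k).re) := by
    simpa [edgePoint] using congrArg Complex.re ht
  have hne : (P.vertices (k + 1)).re - (P.vertices k).re ≠ 0 := fun h =>
    hx k (by rw [hre, h, mul_zero, add_zero])
  have ht0 : 0 < t := ht0.lt_of_ne fun h => hx k (by rw [hre, ← h]; ring)
  have ht1 : t < 1 := ht1.lt_of_ne fun h => hx (k + 1) (by rw [hre, h]; ring)
  constructor
  · rcases lt_or_gt_of_ne hne with h | h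
    · rw [crossSign_of_mem_Ioo_rev ⟨by nlinarith, by nlinarith⟩]
      norm_num
    · rw [crossSign_of_mem_Ioo ⟨by nlinarith, by nlinarith⟩]
      norm_num
  · have hparam : P.crossParam k x = t := by
      rw [crossParam, div_eq_iff hne, hre, add_sub_cancel_left]
    rw [crossHeight, hparam]
    exact (congrArg Complex.im ht).symm

theorem eq_of_mem_edge {z : ℂ} (hz : ∀ i, P.vertices i ≠ z) (hj : z ∈ P.edge j)
    (hk : z ∈ P.edge k) : j = k := by
  have hadj : ∀ i, z ∈ P.edge i → z ∉ P.edge (i + 1) := fun i hi hi' =>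
    hz (i + 1) (mem_singleton_iff.1 (P.edge_inter i ▸ ⟨hi, hi'⟩)).symm
  have hcases : ∀ j k : Fin 5, j = k ∨ j = k + 1 ∨ j = k + 2 ∨ j = k + 3 ∨ k = j + 1 := by
    decide
  rcases hcases j k with h | rfl | rfl | rfl | rfl
  · exact h
  · exact absurd hj (hadj k hk)
  · exact absurd hj (Set.disjoint_left.1 (P.disjoint_edge_add_two k) hk)
  · exact absurd hj (Set.disjoint_left.1 (P.disjoint_edge_add_three k) hk)
  · exact absurd hk (hadj j hj)

theorem crossHeight_injective (hx : ∀ k, (P.vertices k).re ≠ x) (hj : P.crossSign j x ≠ 0)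
    (hk : P.crossSign k x ≠ 0) (h : P.crossHeight j x = P.crossHeight k x) : j = k :=
  eq_of_mem_edge (fun i hi => hx i (by rw [hi])) (mk_crossHeight_mem_edge hj)
    (h ▸ mk_crossHeight_mem_edge hk)

theorem mk_eq_edgePoint_crossParam_add (h : P.crossSign k x ≠ 0) (y : ℝ) :
    (⟨x, y⟩ : ℂ) = P.edgePoint k (P.crossParam k x +
      (y - P.crossHeight k x : ℝ) * (Complex.I / (P.vertices (k + 1) - P.vertices k))) := by
  have hvert : (⟨x, y⟩ : ℂ) =
      ⟨x, P.crossHeight k x⟩ + ((y - P.crossHeight k x : ℝ) : ℂ) * Complex.I := by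
    apply Complex.ext <;> simp
  have he := P.vertices_succ_sub_ne_zero k
  rw [hvert, mk_crossHeight h, edgePoint, edgePoint]
  field_simp
  ring

theorem eventually_mem_region_iff_of_crossing (hs : P.SideIn k σ) (h : P.crossSign k x ≠ 0) :
    ∀ᶠ y in 𝓝 (P.crossHeight k x),
      (0 < σ * P.crossSign k x * (y - P.crossHeight k x) → (⟨x, y⟩ : ℂ) ∈ P.region) ∧
      (σ * P.crossSign k x * (y - P.crossHeight k x) < 0 → (⟨x, y⟩ : ℂ) ∉ P.region) := by
  obtain ⟨δ, hδ, hs⟩ := hs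
  set Y := P.crossHeight k x
  set e := P.vertices (k + 1) - P.vertices k with he
  set ζ : ℝ → ℂ := fun y => P.crossParam k x + (y - Y : ℝ) * (Complex.I / e) with hζ
  have hnear : ∀ᶠ y in 𝓝 Y, ζ y ∈ thinRhombus δ := by
    refine (by fun_prop : Continuous ζ).continuousAt.eventually_mem
      ((isOpen_thinRhombus δ).mem_nhds ?_)
    have hp := crossParam_mem_Ioo h
    simp only [hζ, thinRhombus, sub_self, Complex.ofReal_zero, zero_mul, add_zero,
      mem_ofPred_eq, Complex.ofReal_im, abs_zero, Complex.ofReal_re]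
    exact ⟨mul_pos hδ hp.1, mul_pos hδ (sub_pos.2 hp.2)⟩
  obtain ⟨κ, hκ, him⟩ : ∃ κ > 0, ∀ y, (ζ y).im = P.crossSign k x * (y - Y) * κ := by
    have hn : 0 < Complex.normSq e := Complex.normSq_pos.2 (P.vertices_succ_sub_ne_zero k)
    have him : ∀ y, (ζ y).im = (y - Y) * (e.re / Complex.normSq e) := fun y => by
      simp only [hζ, Complex.add_im, Complex.ofReal_im, Complex.im_ofReal_mul, zero_add,
        Complex.div_im, Complex.I_re, Complex.I_im, one_mul, zero_mul, zero_div, sub_zero]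
    rcases crossSign_cases h with ⟨hc, hl, hr⟩ | ⟨hc, hl, hr⟩
    · refine ⟨e.re / Complex.normSq e, div_pos ?_ hn, fun y => by rw [him, hc, one_mul]⟩
      rw [he, Complex.sub_re]; linarith
    · refine ⟨-e.re / Complex.normSq e, div_pos ?_ hn, fun y => by rw [him, hc]; ring⟩
      rw [he, Complex.sub_re]; linarith
  filter_upwards [hnear] with y hy
  have hside : σ * (ζ y).im = σ * P.crossSign k x * (y - Y) * κ := by rw [him]; ring
  have hpt : (⟨x, y⟩ : ℂ) = P.edgePoint k (ζ y) := mk_eq_edgePoint_crossParam_add h y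
  rw [hpt]
  exact ⟨fun hpos => interior_subset ((hs _ hy).1 (hside ▸ mul_pos hpos hκ)),
    fun hneg => (hs _ hy).2 (hside ▸ mul_neg_of_neg_of_pos hneg hκ)⟩

theorem exists_eventually_indicator_sub_eq_of_crossing (hσ : σ = 1 ∨ σ = -1) (hs : P.SideIn k σ)
    (h : P.crossSign k x ≠ 0) : ∃ c, ∀ᶠ y in 𝓝[≠] (P.crossHeight k x),
      P.region.indicator (1 : ℂ → ℝ) ⟨x, y⟩ -
        σ * (P.crossSign k x * (Ioi (P.crossHeight k x)).indicator 1 y) = c := by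
  have hsign : σ * P.crossSign k x = 1 ∨ σ * P.crossSign k x = -1 := by
    rcases crossSign_cases h with ⟨hc, -⟩ | ⟨hc, -⟩ <;> rcases hσ with rfl | rfl <;>
      rw [hc] <;> norm_num
  refine ⟨if 0 < σ * P.crossSign k x then 0 else 1, ?_⟩
  filter_upwards [eventually_nhdsWithin_of_eventually_nhds
    (eventually_mem_region_iff_of_crossing hs h), self_mem_nhdsWithin] with y hy hne
  rw [← mul_assoc]
  obtain ⟨hin, hout⟩ := hy
  rcases lt_or_gt_of_ne (show y ≠ P.crossHeight k x from hne) with hlt | hlt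
  · rw [indicator_of_notMem (s := Ioi _) (not_lt.2 hlt.le)]
    rcases hsign with hc | hc <;> rw [hc] at hin hout ⊢
    · rw [indicator_of_notMem (hout (by linarith))]; norm_num
    · rw [indicator_of_mem (hin (by linarith))]; norm_num
  · rw [indicator_of_mem (s := Ioi _) hlt]
    rcases hsign with hc | hc <;> rw [hc] at hin hout ⊢
    · rw [indicator_of_mem (hin (by linarith))]; norm_num
    · rw [indicator_of_notMem (hout (by linarith))]; norm_num

/-- The difference between the indicator function of the pentagon and the signed number of edges
that the vertical line at `x` crosses below the height `y`; it turns out to vanish, see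
`crossDefect_eq_zero`. -/
noncomputable def crossDefect (P : Pentagon) (σ x y : ℝ) : ℝ :=
  P.region.indicator 1 ⟨x, y⟩ -
    σ * ∑ k, P.crossSign k x * (Ioi (P.crossHeight k x)).indicator 1 y

theorem eventually_crossSign_mul_indicator_eq
    (hy : P.crossSign k x ≠ 0 → P.crossHeight k x ≠ y) :
    ∀ᶠ t in 𝓝 y, P.crossSign k x * (Ioi (P.crossHeight k x)).indicator (1 : ℝ → ℝ) t =
      P.crossSign k x * (Ioi (P.crossHeight k x)).indicator 1 y := by
  by_cases h : P.crossSign k x = 0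
  · exact Eventually.of_forall fun t => by rw [h, zero_mul, zero_mul]
  · have hfr : y ∉ frontier (Ioi (P.crossHeight k x)) := by
      rw [frontier_Ioi]
      exact (hy h).symm
    filter_upwards [eventually_indicator_eq_of_notMem_frontier hfr] with t ht
    rw [ht]

theorem eventually_crossDefect_eq (hx : ∀ k, (P.vertices k).re ≠ x)
    (hy : ∀ k, P.crossSign k x ≠ 0 → P.crossHeight k x ≠ y) :
    ∀ᶠ t in 𝓝 y, P.crossDefect σ x t = P.crossDefect σ x y := by
  have hfr : (⟨x, y⟩ : ℂ) ∉ frontier P.region := by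
    rw [frontier_eq, mem_iUnion]
    rintro ⟨k, hk⟩
    obtain ⟨hne, heq⟩ := crossing_of_mem_edge hx hk
    exact hy k hne heq
  filter_upwards [(continuous_mk_im x).continuousAt.eventually
      (eventually_indicator_eq_of_notMem_frontier hfr),
    eventually_all.2 fun k => eventually_crossSign_mul_indicator_eq (hy k)] with t hreg hcross
  rw [crossDefect, crossDefect, hreg, Finset.sum_congr rfl fun k _ => hcross k]

theorem exists_eventually_crossDefect_eq (hσ : σ = 1 ∨ σ = -1) (hs : ∀ k, P.SideIn k σ)
    (hx : ∀ k, (P.vertices k).re ≠ x) (y : ℝ) :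
    ∃ c, ∀ᶠ t in 𝓝[≠] y, P.crossDefect σ x t = c := by
  by_cases hy : ∀ k, P.crossSign k x ≠ 0 → P.crossHeight k x ≠ y
  · exact ⟨_, eventually_nhdsWithin_of_eventually_nhds (eventually_crossDefect_eq hx hy)⟩
  push Not at hy
  obtain ⟨k, hk, rfl⟩ := hy
  have hrest : ∀ᶠ t in 𝓝 (P.crossHeight k x), ∀ j, j ≠ k →
      P.crossSign j x * (Ioi (P.crossHeight j x)).indicator (1 : ℝ → ℝ) t =
      P.crossSign j x * (Ioi (P.crossHeight j x)).indicator 1 (P.crossHeight k x) := by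
    refine eventually_all.2 fun j => eventually_imp_distrib_left.2 fun hjk => ?_
    exact eventually_crossSign_mul_indicator_eq fun hj h =>
      hjk (crossHeight_injective hx hj hk h)
  obtain ⟨c, hc⟩ := exists_eventually_indicator_sub_eq_of_crossing hσ (hs k) hk
  refine ⟨c - σ * ∑ j ∈ Finset.univ.erase k,
    P.crossSign j x * (Ioi (P.crossHeight j x)).indicator 1 (P.crossHeight k x), ?_⟩
  filter_upwards [eventually_nhdsWithin_of_eventually_nhds hrest, hc] with t hrest hc
  rw [crossDefect, ← Finset.add_sum_erase _ _ (Finset.mem_univ k),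
    Finset.sum_congr rfl fun j hj => hrest j (Finset.ne_of_mem_erase hj), mul_add, ← sub_sub, hc]

theorem crossDefect_eq_zero (hσ : σ = 1 ∨ σ = -1) (hs : ∀ k, P.SideIn k σ)
    (hx : ∀ k, (P.vertices k).re ≠ x) (hM : ∀ z ∈ P.region, |z.im| ≤ M)
    (hy : ∀ k, P.crossSign k x ≠ 0 → P.crossHeight k x ≠ y) : P.crossDefect σ x y = 0 := by
  obtain ⟨c, hc⟩ := exists_const_of_eventually_const (exists_eventually_crossDefect_eq hσ hs hx)
  have hval : ∀ y, (∀ k, P.crossSign k x ≠ 0 → P.crossHeight k x ≠ y) →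
      P.crossDefect σ x y = c := by
    intro y hy
    obtain ⟨t, ht, hty⟩ := ((hc y).and (eventually_nhdsWithin_of_eventually_nhds
      (eventually_crossDefect_eq (σ := σ) hx hy))).exists
    rw [← hty, ht]
  have hlow : ∀ k, P.crossSign k x ≠ 0 → -M - 1 < P.crossHeight k x := fun k hk => by
    linarith [(abs_le.1 (abs_crossHeight_le hM hk)).1]
  have hout : (⟨x, -M - 1⟩ : ℂ) ∉ P.region := fun h => by
    linarith [(abs_le.1 (hM _ h)).1]
  rw [hval y hy, ← hval (-M - 1) fun k hk => (hlow k hk).ne', crossDefect,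
    indicator_of_notMem hout, Finset.sum_eq_zero, mul_zero, sub_zero]
  intro k _
  by_cases hk : P.crossSign k x = 0
  · rw [hk, zero_mul]
  · rw [indicator_of_notMem (s := Ioi _) (hlow k hk).not_gt, mul_zero]

theorem exists_forall_abs_im_le (P : Pentagon) : ∃ M, ∀ z ∈ P.region, |z.im| ≤ M := by
  obtain ⟨M, hM⟩ := P.isCompact_region.isBounded.exists_norm_le
  exact ⟨M, fun z hz => (Complex.abs_im_le_norm z).trans (hM z hz)⟩

theorem sum_crossSign (hσ : σ = 1 ∨ σ = -1) (hs : ∀ k, P.SideIn k σ)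
    (hx : ∀ k, (P.vertices k).re ≠ x) : ∑ k, P.crossSign k x = 0 := by
  obtain ⟨M, hM⟩ := P.exists_forall_abs_im_le
  have hup : ∀ k, P.crossSign k x ≠ 0 → P.crossHeight k x < M + 1 := fun k hk => by
    linarith [(abs_le.1 (abs_crossHeight_le hM hk)).2]
  have hout : (⟨x, M + 1⟩ : ℂ) ∉ P.region := fun h => by linarith [(abs_le.1 (hM _ h)).2]
  have hdef := crossDefect_eq_zero hσ hs hx hM fun k hk => (hup k hk).ne
  have hterm : ∀ k, P.crossSign k x * (Ioi (P.crossHeight k x)).indicator 1 (M + 1) =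
      P.crossSign k x := by
    intro k
    by_cases hk : P.crossSign k x = 0
    · rw [hk, zero_mul]
    · rw [indicator_of_mem (s := Ioi _) (hup k hk), Pi.one_apply, mul_one]
  rw [crossDefect, indicator_of_notMem hout, zero_sub, neg_eq_zero,
    Finset.sum_congr rfl fun k _ => hterm k] at hdef
  refine (mul_eq_zero.1 hdef).resolve_left ?_
  rcases hσ with rfl | rfl <;> norm_num

theorem measurableSet_verticalSection (P : Pentagon) (x : ℝ) :
    MeasurableSet {y : ℝ | (⟨x, y⟩ : ℂ) ∈ P.region} :=
  (P.isClosed_region.preimage (continuous_mk_im x)).measurableSet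

theorem volume_verticalSection (hσ : σ = 1 ∨ σ = -1) (hs : ∀ k, P.SideIn k σ)
    (hx : ∀ k, (P.vertices k).re ≠ x) :
    volume.real {y : ℝ | (⟨x, y⟩ : ℂ) ∈ P.region} =
      -σ * ∑ k, P.crossSign k x * P.crossHeight k x := by
  obtain ⟨M, hM⟩ := P.exists_forall_abs_im_le
  set S : Set ℝ := {y : ℝ | (⟨x, y⟩ : ℂ) ∈ P.region}
  have hSm : MeasurableSet S := P.measurableSet_verticalSection x
  have hSM : S ⊆ Ioc (-M - 1) M := fun y hy =>
    ⟨by linarith [(abs_le.1 (hM _ hy)).1], (abs_le.1 (hM _ hy)).2⟩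
  have hvol : volume.real S = ∫ y in Ioc (-M - 1) M, S.indicator 1 y := by
    rw [integral_indicator_one hSm, measureReal_restrict_apply hSm, inter_eq_left.2 hSM]
  have hae : ∀ᵐ y : ℝ, S.indicator 1 y =
      σ * ∑ k, P.crossSign k x * (Ioi (P.crossHeight k x)).indicator (1 : ℝ → ℝ) y := by
    filter_upwards [(Set.toFinite (range fun k => P.crossHeight k x)).countable.ae_notMem volume]
      with y hy
    exact sub_eq_zero.1 (crossDefect_eq_zero hσ hs hx hM (y := y) fun k _ h => hy ⟨k, h⟩)
  have hint : ∀ k, P.crossSign k x * ∫ y in Ioc (-M - 1) M,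
      (Ioi (P.crossHeight k x)).indicator (1 : ℝ → ℝ) y =
      P.crossSign k x * (M - P.crossHeight k x) := by
    intro k
    by_cases hk : P.crossSign k x = 0
    · rw [hk, zero_mul, zero_mul]
    obtain ⟨hlow, hup⟩ := abs_le.1 (abs_crossHeight_le hM hk)
    rw [integral_indicator_one measurableSet_Ioi, measureReal_restrict_apply measurableSet_Ioi,
      inter_comm, Ioc_inter_Ioi, sup_of_le_right (by linarith), Real.volume_real_Ioc_of_le hup]
  rw [hvol, integral_congr_ae (ae_restrict_of_ae hae), integral_const_mul, integral_finsetSum]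
  · simp only [integral_const_mul, hint, mul_sub, Finset.sum_sub_distrib]
    rw [← Finset.sum_mul, sum_crossSign hσ hs hx]
    ring
  · exact fun k _ =>
      ((integrable_const (1 : ℝ)).indicator measurableSet_Ioi).const_mul (P.crossSign k x)

end Crossing

theorem crossSign_mul_crossHeight_eq (P : Pentagon) (k : Fin 5) (x : ℝ) :
    P.crossSign k x * P.crossHeight k x =
      (Ioo (P.vertices k).re (P.vertices (k + 1)).re).indicator (P.crossHeight k) x -
        (Ioo (P.vertices (k + 1)).re (P.vertices k).re).indicator (P.crossHeight k) x := by
  simp only [crossSign, sub_mul, indicator_apply, Pi.one_apply, ite_mul, one_mul, zero_mul]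

theorem integrable_indicator_crossHeight (P : Pentagon) (k : Fin 5) (a b : ℝ) :
    Integrable ((Ioo a b).indicator (P.crossHeight k)) := by
  have hcont : Continuous (P.crossHeight k) := by
    rw [show P.crossHeight k = _ from funext (P.crossHeight_eq k)]
    fun_prop
  exact (hcont.integrableOn_Icc.mono_set Ioo_subset_Icc_self).integrable_indicator
    measurableSet_Ioo

theorem integrable_crossSign_mul_crossHeight (P : Pentagon) (k : Fin 5) :
    Integrable fun x => P.crossSign k x * P.crossHeight k x := by
  simp only [crossSign_mul_crossHeight_eq]
  exact (P.integrable_indicator_crossHeight k _ _).sub (P.integrable_indicator_crossHeight k _ _)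

theorem integral_crossSign_mul_crossHeight (P : Pentagon) (k : Fin 5) :
    ∫ x, P.crossSign k x * P.crossHeight k x =
      ((P.vertices (k + 1)).re - (P.vertices k).re) *
        ((P.vertices k).im + (P.vertices (k + 1)).im) / 2 := by
  simp only [crossSign_mul_crossHeight_eq]
  rw [integral_sub (P.integrable_indicator_crossHeight k _ _)
      (P.integrable_indicator_crossHeight k _ _), integral_indicator measurableSet_Ioo,
    integral_indicator measurableSet_Ioo, ← integral_Ioc_eq_integral_Ioo,
    ← integral_Ioc_eq_integral_Ioo, ← intervalIntegral_interpolation, intervalIntegral]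
  simp only [crossHeight_eq]

theorem area_eq_integral_verticalSection (P : Pentagon) :
    P.area = ∫ x, volume.real {y : ℝ | (⟨x, y⟩ : ℂ) ∈ P.region} := by
  set R : Set (ℝ × ℝ) := Complex.measurableEquivRealProd.symm ⁻¹' P.region
  have hRm : MeasurableSet R :=
    Complex.measurableEquivRealProd.symm.measurable P.isClosed_region.measurableSet
  have hvol : volume R = volume P.region :=
    Complex.volume_preserving_equiv_real_prod.symm.measure_preimage
      P.isClosed_region.measurableSet.nullMeasurableSet
  have hint : Integrable (R.indicator (1 : ℝ × ℝ → ℝ)) (volume.prod volume) := by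
    rw [← Measure.volume_eq_prod]
    exact (integrable_indicator_iff hRm).2
      (integrableOn_const (hvol ▸ P.isCompact_region.measure_lt_top.ne))
  have harea : P.area = ∫ p, R.indicator (1 : ℝ × ℝ → ℝ) p := by
    rw [integral_indicator_one hRm, area, measureReal_def, measureReal_def, hvol]
  rw [harea, Measure.volume_eq_prod, integral_prod _ hint]
  refine integral_congr_ae (Eventually.of_forall fun x => ?_)
  exact integral_indicator_one (P.measurableSet_verticalSection x)

theorem area_eq_mul_signedArea {P : Pentagon} {σ : ℝ} (hσ : σ = 1 ∨ σ = -1)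
    (hs : ∀ k, P.SideIn k σ) : P.area = σ * signedArea P.vertices := by
  have hae : ∀ᵐ x : ℝ, volume.real {y : ℝ | (⟨x, y⟩ : ℂ) ∈ P.region} =
      -σ * ∑ k, P.crossSign k x * P.crossHeight k x := by
    filter_upwards [(Set.toFinite (range fun k => (P.vertices k).re)).countable.ae_notMem volume]
      with x hx
    exact volume_verticalSection hσ hs fun k h => hx ⟨k, h⟩
  rw [area_eq_integral_verticalSection, integral_congr_ae hae, integral_const_mul,
    integral_finsetSum _ fun k _ => P.integrable_crossSign_mul_crossHeight k]
  simp only [integral_crossSign_mul_crossHeight, signedArea, cross, Fin.sum_univ_five,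
    Fin.isValue, Fin.reduceAdd, zero_add]
  ring

end Pentagon

theorem signedArea_conj {n : ℕ} [NeZero n] (z : Fin n → ℂ) :
    signedArea (fun k => conj (z k)) = -signedArea z := by
  rw [signedArea, signedArea, ← neg_div, ← Finset.sum_neg_distrib]
  congr 1
  refine Finset.sum_congr rfl fun k _ => ?_
  simp only [cross, Complex.conj_re, Complex.conj_im]
  ring

theorem image_conj_segment (a b : ℂ) : conj '' segment ℝ a b = segment ℝ (conj a) (conj b) :=
  image_segment ℝ Complex.conjLIE.toLinearEquiv.toLinearMap.toAffineMap a b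

theorem cross_mul_of_mul_eq {u w : ℂ} {d d' α : ℝ}
    (h : w * d = u * d' * Complex.exp (α * Complex.I)) :
    cross u w * d = ‖u‖ ^ 2 * d' * Real.sin α :=
  calc cross u w * d = (conj u * (w * d)).im := by
        rw [cross_eq_im, ← Complex.im_mul_ofReal, mul_assoc]
    _ = ((‖u‖ ^ 2 * d' : ℝ) * Complex.exp (α * Complex.I)).im := by
        rw [h, ← mul_assoc, ← mul_assoc, Complex.conj_mul']
        push_cast
        rfl
    _ = ‖u‖ ^ 2 * d' * Real.sin α := by
        rw [Complex.im_ofReal_mul, Complex.exp_ofReal_mul_I_im]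

namespace Pentagon

variable {P : Pentagon}

theorem exists_counterclockwise (P : Pentagon) : ∃ z : Fin 5 → ℂ, signedArea z = P.area ∧
    polyLength z = P.perimeter ∧
    (∀ k, Disjoint (segment ℝ (z k) (z (k + 1))) (segment ℝ (z (k + 2)) (z (k + 3)))) ∧
    (∀ k, z (k + 1) ≠ z k) ∧ ∀ k, (z (k - 1) - z k) * dist (z k) (z (k + 1)) =
      (z (k + 1) - z k) * dist (z (k - 1)) (z k) * Complex.exp (P.angle k * Complex.I) := by
  obtain ⟨σ, hσ, hside, hangle⟩ := P.exists_orientation_angle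
  have harea := area_eq_mul_signedArea hσ hside
  have hdisj : ∀ k, Disjoint (segment ℝ (P.vertices k) (P.vertices (k + 1)))
      (segment ℝ (P.vertices (k + 2)) (P.vertices (k + 3))) := by
    intro k
    have h := P.disjoint_edge_add_two k
    rwa [edge_eq_segment, edge_eq_segment, add_assoc, show (2 : Fin 5) + 1 = 3 from rfl] at h
  rcases hσ with rfl | rfl
  · refine ⟨P.vertices, by rw [harea, one_mul], rfl, hdisj, P.vertices_succ_ne, fun k => ?_⟩
    have h := (hangle k).2.2.edge_prev
    rwa [one_mul] at h
  · refine ⟨fun k => conj (P.vertices k), by rw [harea, signedArea_conj, neg_one_mul], ?_,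
      fun k => ?_, fun k h => P.vertices_succ_ne k ((starRingEnd ℂ).injective h), fun k => ?_⟩
    · simp only [polyLength, perimeter, edgeLength, Complex.dist_conj_conj]
    · rw [← image_conj_segment, ← image_conj_segment,
        disjoint_image_iff (starRingEnd ℂ).injective]
      exact hdisj k
    · have h := congrArg conj (hangle k).2.2.edge_prev
      simp only [map_mul, map_sub, Complex.conj_ofReal, ← Complex.exp_conj, Complex.conj_I] at h
      simp only [Complex.dist_conj_conj]
      rw [h, neg_one_mul, Complex.ofReal_neg, neg_mul_neg]

theorem perimeter_nonneg (P : Pentagon) : 0 ≤ P.perimeter :=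
  polyLength_nonneg P.vertices

theorem le_perimeter (h : P.area = 1) : 3.811 ≤ P.perimeter := by
  obtain ⟨z, hS, hL, -⟩ := P.exists_counterclockwise
  have hiso := isoperimetric_pentagon z
  rw [hS, h, hL] at hiso
  nlinarith [P.perimeter_nonneg]

theorem angle_mem_Ioo (P : Pentagon) (k : Fin 5) : P.angle k ∈ Ioo 0 (2 * π) := by
  obtain ⟨_, -, -, hangle⟩ := P.exists_orientation_angle
  exact (hangle k).1

theorem lt_angle_of_perimeter_le (h : P.area = 1) (hp : P.perimeter ≤ 3.8638) (k : Fin 5) :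
    2 * π / 5 < P.angle k := by
  obtain ⟨z, hS, hL, -, hne, hturn⟩ := P.exists_counterclockwise
  by_contra! hle
  have hlt := lt_polyLength_of_angle_le (hS.trans h) (hne k) (P.angle_mem_Ioo k).1.le hle (hturn k)
  linarith

theorem le_perimeter_of_isType2 (h : P.area = 1) (h2 : P.IsType2) : 4.5589 ≤ P.perimeter := by
  obtain ⟨z, hS, hL, hdisj, hne, hturn⟩ := P.exists_counterclockwise
  have hreflex : ∀ k, π < P.angle k → crossArea (z (k - 1)) (z k) (z (k + 1)) < 0 := by
    intro k hk
    have hsin : Real.sin (P.angle k) < 0 := by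
      rw [← Real.sin_sub_two_pi]
      exact Real.sin_neg_of_neg_of_neg_pi_lt (by linarith [(P.angle_mem_Ioo k).2]) (by linarith)
    have hu : 0 < ‖z (k + 1) - z k‖ := norm_pos_iff.2 (sub_ne_zero.2 (hne k))
    have hw : 0 < dist (z (k - 1)) (z k) := by
      have hne' := hne (k - 1)
      rw [sub_add_cancel] at hne'
      exact dist_pos.2 hne'.symm
    have hneg : crossArea (z (k - 1)) (z k) (z (k + 1)) * dist (z k) (z (k + 1)) < 0 := by
      rw [show crossArea (z (k - 1)) (z k) (z (k + 1)) =
          cross (z (k + 1) - z k) (z (k - 1) - z k) by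
        simp only [crossArea, cross, Complex.sub_re, Complex.sub_im]; ring,
        cross_mul_of_mul_eq (hturn k)]
      exact mul_neg_of_pos_of_neg (by positivity) hsin
    exact neg_of_mul_neg_left hneg dist_nonneg
  obtain ⟨i, j, hij, hset⟩ := Set.ncard_eq_two.1 h2
  have hi : i ∈ {k | π < P.angle k} := hset ▸ mem_insert i {j}
  have hj : j ∈ {k | π < P.angle k} := hset ▸ mem_insert_of_mem i rfl
  have hiso := isoperimetric_of_two_reflex hdisj hij (hreflex i hi) (hreflex j hj)
  rw [hL, hS, h] at hiso
  nlinarith [P.perimeter_nonneg]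

end Pentagon

theorem inner_mul_mul (a b e : ℂ) : inner ℝ (a * e) (b * e) = ‖e‖ ^ 2 * inner ℝ a b := by
  rw [Complex.inner, Complex.inner, map_mul, mul_mul_mul_comm, Complex.mul_conj',
    ← Complex.ofReal_pow, Complex.re_mul_ofReal, mul_comm]

theorem mul_norm_eq_of_inner {e v : ℂ} {σ : ℝ} (he : e ≠ 0) (hσ : σ = 1 ∨ σ = -1)
    (hperp : inner ℝ e v = 0) (hside : inner ℝ (-σ * Complex.I * e) v ≤ 0) :
    v * ‖e‖ = (σ * ‖v‖ : ℝ) * Complex.I * e := by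
  obtain ⟨ξ, rfl⟩ : ∃ ξ, ξ * e = v := ⟨v / e, div_mul_cancel₀ v he⟩
  have he0 : 0 < ‖e‖ := norm_pos_iff.2 he
  have hre : ξ.re = 0 := by
    nth_rewrite 1 [← one_mul e] at hperp
    rw [inner_mul_mul] at hperp
    simpa [he] using hperp
  have him : 0 ≤ σ * ξ.im := by
    rw [inner_mul_mul] at hside
    have := nonpos_of_mul_nonpos_right hside (by positivity)
    simpa [Complex.inner, mul_comm] using this
  have hnorm : ‖ξ‖ = σ * ξ.im := by
    rw [← Complex.abs_im_eq_norm.2 hre, ← abs_sign_mul hσ, abs_of_nonneg him]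
  have hξ : ξ = (σ * ‖ξ‖ : ℝ) * Complex.I := by
    rw [hnorm]
    apply Complex.ext
    · rw [hre, Complex.re_ofReal_mul, Complex.I_re, mul_zero]
    · rw [Complex.im_ofReal_mul, Complex.I_im, mul_one]
      rcases hσ with rfl | rfl <;> ring
  rw [norm_mul]
  nth_rewrite 1 [hξ]
  push_cast
  ring

theorem eventually_dist_add_mul_lt {z c w : ℂ} (h : 0 < inner ℝ w (c - z)) :
    ∀ᶠ t : ℝ in 𝓝[>] 0, dist (z + t * w) c < dist z c := by
  have hw : 0 < ‖w‖ := norm_pos_iff.2 fun h0 => by simp [h0] at h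
  have hbound : 0 < 2 * inner ℝ w (c - z) / ‖w‖ ^ 2 := by positivity
  filter_upwards [Ioo_mem_nhdsGT hbound] with t ht
  have hsq : dist (z + t * w) c ^ 2 =
      dist z c ^ 2 - t * (2 * inner ℝ w (c - z) - t * ‖w‖ ^ 2) := by
    rw [dist_eq_norm, dist_comm z, dist_eq_norm,
      show z + t * w - c = t • w - (c - z) by rw [Complex.real_smul]; ring, norm_sub_sq_real,
      norm_smul, Real.norm_of_nonneg ht.1.le, real_inner_smul_left]
    ring
  refine lt_of_pow_lt_pow_left₀ 2 dist_nonneg ?_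
  have hlt := (lt_div_iff₀ (by positivity)).1 ht.2
  rw [hsq]
  linarith [mul_pos ht.1 (sub_pos.2 hlt)]

theorem eq_zero_of_forall_cos_sin_nonpos {a b α : ℝ} (hα : α < π)
    (h : ∀ ψ ∈ Ioo α (2 * π), a * Real.cos ψ + b * Real.sin ψ ≤ 0) : a = 0 ∧ b = 0 := by
  have hzero : ∀ ψ ∈ Ioo α π, a * Real.cos ψ + b * Real.sin ψ = 0 := by
    intro ψ hψ
    have hopp := h (ψ + π) ⟨by linarith [hψ.1, Real.pi_pos], by linarith [hψ.2]⟩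
    rw [Real.cos_add_pi, Real.sin_add_pi] at hopp
    have := h ψ ⟨hψ.1, by linarith [hψ.2, Real.pi_pos]⟩
    linarith
  obtain ⟨ψ, hψ⟩ := exists_between (max_lt hα (sub_lt_self π Real.pi_pos))
  obtain ⟨ψ', hψ'⟩ := exists_between hψ.2
  have hαψ := (le_max_left _ _).trans_lt hψ.1
  have hψ0 := (le_max_right _ _).trans_lt hψ.1
  have h1 := hzero ψ ⟨hαψ, hψ.2⟩
  have h2 := hzero ψ' ⟨hαψ.trans hψ'.1, hψ'.2⟩
  have hsin : Real.sin (ψ' - ψ) ≠ 0 :=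
    (Real.sin_pos_of_pos_of_lt_pi (by linarith [hψ'.1]) (by linarith [hψ'.2])).ne'
  have hs := Real.sin_sub ψ' ψ
  constructor <;> refine (mul_eq_zero.1 ?_).resolve_right hsin <;> rw [hs]
  · linear_combination Real.sin ψ' * h1 - Real.sin ψ * h2
  · linear_combination Real.cos ψ * h2 - Real.cos ψ' * h1

theorem eventually_mem_thinRhombus {δ s : ℝ} (hδ : 0 < δ) (hs : s ∈ Ioo 0 1) (w : ℂ) :
    ∀ᶠ t : ℝ in 𝓝[>] 0, (s : ℂ) + t * w ∈ thinRhombus δ := by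
  have hmem : (s : ℂ) ∈ thinRhombus δ := by
    simp only [thinRhombus, mem_ofPred_eq, Complex.ofReal_re, Complex.ofReal_im, abs_zero]
    exact ⟨mul_pos hδ hs.1, mul_pos hδ (sub_pos.2 hs.2)⟩
  have hcont : Tendsto (fun t : ℝ => (s : ℂ) + t * w) (𝓝[>] 0) (𝓝 s) := by
    refine Tendsto.mono_left ?_ nhdsWithin_le_nhds
    exact Continuous.tendsto' (by fun_prop) _ _ (by simp)
  exact hcont.eventually ((isOpen_thinRhombus δ).mem_nhds hmem)

namespace Pentagon

variable {P : Pentagon} {k : Fin 5} {σ : ℝ}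

theorem HasSector.eventually_cornerPoint_notMem {α φ : ℝ} (h : P.HasSector k σ α)
    (hφ : φ ∈ Ioo α (2 * π)) : ∀ᶠ t in 𝓝[>] 0, P.cornerPoint k σ t φ ∉ P.region := by
  obtain ⟨ε, hε, hsec⟩ := h
  filter_upwards [Ioo_mem_nhdsGT hε] with t ht
  exact (hsec t ht).2 φ hφ

theorem SideIn.eventually_mem_interior {s : ℝ} (hσ : σ = 1 ∨ σ = -1) (h : P.SideIn k σ)
    (hs : s ∈ Ioo 0 1) : ∀ᶠ t : ℝ in 𝓝[>] 0,
      P.edgePoint k (s + t * (σ * Complex.I)) ∈ interior P.region := by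
  obtain ⟨δ, hδ, hside⟩ := h
  filter_upwards [eventually_mem_thinRhombus hδ hs (σ * Complex.I), self_mem_nhdsWithin]
    with t ht (ht0 : 0 < t)
  refine (hside _ ht).1 ?_
  rcases hσ with rfl | rfl <;> simpa using ht0

theorem SideIn.eventually_notMem {s : ℝ} (hσ : σ = 1 ∨ σ = -1) (h : P.SideIn k σ)
    (hs : s ∈ Ioo 0 1) : ∀ᶠ t : ℝ in 𝓝[>] 0,
      P.edgePoint k (s + t * (-σ * Complex.I)) ∉ P.region := by
  obtain ⟨δ, hδ, hside⟩ := h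
  filter_upwards [eventually_mem_thinRhombus hδ hs (-σ * Complex.I), self_mem_nhdsWithin]
    with t ht (ht0 : 0 < t)
  refine (hside _ ht).2 ?_
  rcases hσ with rfl | rfl <;> simpa using ht0

/-- The circle with centre `c` and radius `r` is inscribed in the pentagon `P`. -/
def IsIncircle (P : Pentagon) (c : ℂ) (r : ℝ) : Prop :=
  0 < r ∧ Metric.closedBall c r ⊆ P.region ∧ ∀ k, ∃ z ∈ P.edge k, dist z c = r

/-- The length of the tangent segments from the `k`-th vertex of `P` to the circle with centre `c`
and radius `r`. -/
noncomputable def tangentLength (P : Pentagon) (c : ℂ) (r : ℝ) (k : Fin 5) : ℝ :=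
  √(dist (P.vertices k) c ^ 2 - r ^ 2)

theorem edgeLength_pos (P : Pentagon) (k : Fin 5) : 0 < P.edgeLength k :=
  dist_pos.2 (P.vertices_succ_ne k).symm

theorem norm_vertices_succ_sub (P : Pentagon) (k : Fin 5) :
    ‖P.vertices (k + 1) - P.vertices k‖ = P.edgeLength k := by
  rw [edgeLength, dist_comm, dist_eq_norm]

namespace IsIncircle

variable {c : ℂ} {r : ℝ}

theorem eventually_mem_interior {z w : ℂ} (h : P.IsIncircle c r) (hz : dist z c = r)
    (hw : 0 < inner ℝ w (c - z)) : ∀ᶠ t : ℝ in 𝓝[>] 0, z + t * w ∈ interior P.region := by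
  filter_upwards [eventually_dist_add_mul_lt hw] with t ht
  exact interior_maximal (Metric.ball_subset_closedBall.trans h.2.1) Metric.isOpen_ball (hz ▸ ht)

theorem inner_nonpos {z w : ℂ} (h : P.IsIncircle c r) (hz : dist z c = r)
    (hw : ∀ᶠ t : ℝ in 𝓝[>] 0, z + t * w ∉ interior P.region) : inner ℝ w (c - z) ≤ 0 := by
  by_contra! hpos
  obtain ⟨t, ht, ht'⟩ := ((h.eventually_mem_interior hz hpos).and hw).exists
  exact ht' ht

-- At a vertex of angle less than `π` the directions leading out of the pentagon fill more than a
-- half-plane, so one of them enters any disk having the vertex on its boundary.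
theorem dist_vertex_ne (h : P.IsIncircle c r) (hk : P.angle k < π) :
    dist (P.vertices k) c ≠ r := by
  intro hdist
  obtain ⟨σ, hσ, -, hangle⟩ := P.exists_orientation_angle
  set e := P.vertices (k + 1) - P.vertices k
  have he0 : e ≠ 0 := P.vertices_succ_sub_ne_zero k
  set ζ := (c - P.vertices k) / e
  have hc : c - P.vertices k = ζ * e := (div_mul_cancel₀ _ he0).symm
  have hnonpos : ∀ ψ ∈ Ioo (P.angle k) (2 * π),
      ζ.re * Real.cos ψ + (σ * ζ.im) * Real.sin ψ ≤ 0 := by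
    intro ψ hψ
    have hinner := h.inner_nonpos (w := Complex.exp ((σ * ψ : ℝ) * Complex.I) * e) hdist <| by
      filter_upwards [(hangle k).2.1.eventually_cornerPoint_notMem hψ] with t ht
      rw [← mul_assoc]
      exact fun hmem => ht (interior_subset hmem)
    rw [hc, inner_mul_mul, Complex.inner, Complex.mul_re, Complex.conj_re, Complex.conj_im,
      Complex.exp_ofReal_mul_I_re, Complex.exp_ofReal_mul_I_im] at hinner
    have hinner := nonpos_of_mul_nonpos_right hinner (by positivity)
    rcases hσ with rfl | rfl <;> simp only [one_mul, neg_one_mul, Real.cos_neg, Real.sin_neg]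
      at hinner ⊢ <;> linarith
  obtain ⟨hre, him⟩ := eq_zero_of_forall_cos_sin_nonpos hk hnonpos
  have hσ0 : σ ≠ 0 := by rcases hσ with rfl | rfl <;> norm_num
  rw [Complex.ext (w := 0) hre ((mul_eq_zero.1 him).resolve_left hσ0), zero_mul, sub_eq_zero] at hc
  rw [hc, dist_self] at hdist
  exact h.1.ne hdist

theorem inner_edge_eq_zero {s : ℝ} (h : P.IsIncircle c r) (hs : s ∈ Ioo 0 1)
    (hdist : dist (P.edgePoint k s) c = r) :
    inner ℝ (P.vertices (k + 1) - P.vertices k) (c - P.edgePoint k s) = 0 := by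
  have hnot : ∀ x : ℝ, ∀ᶠ t : ℝ in 𝓝[>] 0,
      P.edgePoint k s + t * (x * (P.vertices (k + 1) - P.vertices k)) ∉ interior P.region := by
    intro x
    have hcont : Tendsto (fun t : ℝ => s + t * x) (𝓝[>] 0) (𝓝 s) := by
      refine Tendsto.mono_left ?_ nhdsWithin_le_nhds
      exact Continuous.tendsto' (by fun_prop) _ _ (by simp)
    filter_upwards [hcont.eventually (Icc_mem_nhds hs.1 hs.2)] with t ht hmem
    refine (P.edge_subset_frontier k (mem_edge.2 ⟨s + t * x, ht.1, ht.2, ?_⟩)).2 hmem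
    simp only [edgePoint]
    push_cast
    ring
  have h1 := h.inner_nonpos hdist (hnot 1)
  have h2 := h.inner_nonpos hdist (hnot (-1))
  rw [Complex.ofReal_one, one_mul] at h1
  rw [Complex.ofReal_neg, Complex.ofReal_one, neg_one_mul, inner_neg_left] at h2
  linarith

theorem exists_tangency (h : P.IsIncircle c r) (hσ : σ = 1 ∨ σ = -1) (hside : P.SideIn k σ)
    (hk : P.angle k < π) (hk' : P.angle (k + 1) < π) :
    ∃ s ∈ Ioo (0 : ℝ) 1, c = P.edgePoint k (s + (σ * (r / P.edgeLength k) : ℝ) * Complex.I) := by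
  obtain ⟨z, hz, hdist⟩ := h.2.2 k
  obtain ⟨s, hs0, hs1, rfl⟩ := mem_edge.1 hz
  have hs : s ∈ Ioo 0 1 := by
    refine ⟨hs0.lt_of_ne ?_, hs1.lt_of_ne ?_⟩
    · rintro rfl
      exact h.dist_vertex_ne hk (by simpa [edgePoint] using hdist)
    · rintro rfl
      exact h.dist_vertex_ne hk' (by simpa [edgePoint] using hdist)
  have hperp := h.inner_edge_eq_zero hs hdist
  have hout : inner ℝ (-σ * Complex.I * (P.vertices (k + 1) - P.vertices k))
      (c - P.edgePoint k s) ≤ 0 := by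
    refine h.inner_nonpos hdist ?_
    filter_upwards [hside.eventually_notMem hσ hs] with t ht hmem
    refine ht (interior_subset ?_)
    convert hmem using 1
    simp only [edgePoint]
    ring
  have hl := P.edgeLength_pos k
  have hl' : (P.edgeLength k : ℂ) ≠ 0 := Complex.ofReal_ne_zero.2 hl.ne'
  have hnormal := mul_norm_eq_of_inner (P.vertices_succ_sub_ne_zero k) hσ hperp hout
  rw [← dist_eq_norm c, dist_comm c, hdist, P.norm_vertices_succ_sub] at hnormal
  refine ⟨s, hs, mul_right_cancel₀ hl' ?_⟩
  simp only [edgePoint] at hnormal ⊢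
  push_cast at hnormal ⊢
  field_simp
  linear_combination hnormal

theorem center_sub_vertex (h : P.IsIncircle c r) (hσ : σ = 1 ∨ σ = -1) (hside : P.SideIn k σ)
    (hk : P.angle k < π) (hk' : P.angle (k + 1) < π) :
    (c - P.vertices k) * P.edgeLength k = (P.tangentLength c r k + (σ * r : ℝ) * Complex.I) *
        (P.vertices (k + 1) - P.vertices k) ∧
      (P.vertices (k + 1) - c) * P.edgeLength k =
        (P.tangentLength c r (k + 1) - (σ * r : ℝ) * Complex.I) *
        (P.vertices (k + 1) - P.vertices k) := by
  obtain ⟨s, hs, hc⟩ := h.exists_tangency hσ hside hk hk'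
  have hl := P.norm_vertices_succ_sub k
  have hl0 := P.edgeLength_pos k
  have hl0' : (P.edgeLength k : ℂ) ≠ 0 := Complex.ofReal_ne_zero.2 hl0.ne'
  have hσ2 : σ ^ 2 = 1 := by rcases hσ with rfl | rfl <;> norm_num
  have hnorm : ∀ x y : ℝ, ‖(x + (σ * (r / P.edgeLength k) : ℝ) * y * Complex.I : ℂ) *
      (P.vertices (k + 1) - P.vertices k)‖ ^ 2 - r ^ 2 * y ^ 2 = (x * P.edgeLength k) ^ 2 := by
    intro x y
    rw [norm_mul, hl, mul_pow, ← Complex.ofReal_mul, Complex.sq_norm, Complex.normSq_add_mul_I]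
    field_simp
    linear_combination r ^ 2 * y ^ 2 * hσ2
  have h1 : P.tangentLength c r k = s * P.edgeLength k := by
    rw [tangentLength, dist_comm, dist_eq_norm, ← Real.sqrt_sq (mul_pos hs.1 hl0).le, ← hnorm s 1,
      hc, edgePoint]
    simp
  have h2 : P.tangentLength c r (k + 1) = (1 - s) * P.edgeLength k := by
    rw [tangentLength, dist_eq_norm, ← Real.sqrt_sq (mul_pos (sub_pos.2 hs.2) hl0).le,
      ← hnorm _ (-1), hc, edgePoint]
    congr 3
    · congr 1
      push_cast
      ring
    · ring
  rw [h1, h2]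
  constructor <;>
  · nth_rewrite 1 [hc]
    rw [edgePoint]
    push_cast
    field_simp
    ring

theorem edgeLength_eq (h : P.IsIncircle c r) (hk : P.angle k < π) (hk' : P.angle (k + 1) < π) :
    P.edgeLength k = P.tangentLength c r k + P.tangentLength c r (k + 1) := by
  obtain ⟨σ, hσ, hside, -⟩ := P.exists_orientation_angle
  obtain ⟨h1, h2⟩ := h.center_sub_vertex hσ (hside k) hk hk'
  have hsum : (P.edgeLength k : ℂ) = P.tangentLength c r k + P.tangentLength c r (k + 1) :=
    mul_right_cancel₀ (P.vertices_succ_sub_ne_zero k) (by linear_combination h1 + h2)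
  exact_mod_cast hsum

theorem perimeter_eq (h : P.IsIncircle c r) (hconv : ∀ k, P.angle k < π) :
    P.perimeter = 2 * ∑ k, P.tangentLength c r k := by
  rw [perimeter, Finset.sum_congr rfl fun k _ => h.edgeLength_eq (hconv k) (hconv (k + 1)),
    Finset.sum_add_distrib, two_mul]
  congr 1
  exact Equiv.sum_comp (Equiv.addRight (1 : Fin 5)) (P.tangentLength c r)

theorem area_eq (h : P.IsIncircle c r) (hconv : ∀ k, P.angle k < π) :
    P.area = r * P.perimeter / 2 := by
  obtain ⟨σ, hσ, hside, -⟩ := P.exists_orientation_angle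
  have hcross : ∀ k, cross (P.vertices k - c) (P.vertices (k + 1) - c) =
      σ * r * P.edgeLength k := by
    intro k
    have hl0 := P.edgeLength_pos k
    obtain ⟨h1, h2⟩ := h.center_sub_vertex hσ (hside k) (hconv k) (hconv (k + 1))
    have h3 := cross_mul_mul (P.vertices k - c) (P.vertices (k + 1) - c) (P.edgeLength k)
    rw [h2, ← neg_sub c, neg_mul, h1, ← neg_mul, cross_mul_mul, P.norm_vertices_succ_sub,
      Complex.norm_real, Real.norm_of_nonneg hl0.le] at h3
    rw [← neg_sub c, ← mul_left_cancel₀ (by positivity) h3, h.edgeLength_eq (hconv k) (hconv _)]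
    simp [cross]
    ring
  rw [area_eq_mul_signedArea hσ hside, ← signedArea_sub_const _ c, signedArea, perimeter,
    Finset.sum_congr rfl fun k _ => hcross k, ← Finset.mul_sum]
  rcases hσ with rfl | rfl <;> ring

theorem tangentLength_mul_sin (h : P.IsIncircle c r) (hconv : ∀ k, P.angle k < π) (k : Fin 5) :
    P.tangentLength c r k * Real.sin (P.angle k) = r * (1 + Real.cos (P.angle k)) := by
  obtain ⟨σ, hσ, hside, hangle⟩ := P.exists_orientation_angle
  have hturn := (hangle k).2.2.edge_prev
  obtain ⟨h1, -⟩ := h.center_sub_vertex hσ (hside k) (hconv k) (hconv (k + 1))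
  obtain ⟨-, h2⟩ := h.center_sub_vertex hσ (hside (k - 1)) (hconv (k - 1)) (hconv _)
  have hl := P.edgeLength_pos (k - 1)
  rw [sub_add_cancel] at h2
  have hd : dist (P.vertices (k - 1)) (P.vertices k) = P.edgeLength (k - 1) := by
    rw [edgeLength, sub_add_cancel]
  rw [hd, ← edgeLength] at hturn
  have hrot : (P.tangentLength c r k + (σ * r : ℝ) * Complex.I : ℂ) =
      (P.tangentLength c r k - (σ * r : ℝ) * Complex.I) *
        Complex.exp ((σ * P.angle k : ℝ) * Complex.I) := by
    refine mul_right_cancel₀ (mul_ne_zero (Complex.ofReal_ne_zero.2 hl.ne')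
      (P.vertices_succ_sub_ne_zero k)) ?_
    linear_combination (-(P.edgeLength (k - 1) : ℂ)) * h1 - P.edgeLength k * h2 +
      (P.tangentLength c r k - (σ * r : ℝ) * Complex.I) * hturn
  have him := congrArg Complex.im hrot
  simp only [Complex.add_im, Complex.mul_im, Complex.sub_re, Complex.sub_im, Complex.ofReal_re,
    Complex.ofReal_im, Complex.mul_re, Complex.I_re, Complex.I_im, Complex.exp_ofReal_mul_I_re,
    Complex.exp_ofReal_mul_I_im] at him
  rcases hσ with rfl | rfl <;> simp only [one_mul, neg_one_mul, Real.cos_neg, Real.sin_neg] at him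
    <;> linarith

end IsIncircle

theorem IsCircumscribed.sq_perimeter (hP : P.IsCircumscribed) {i j : Fin 5} (hij : i ≠ j)
    (hi : P.angle i = π / 2) (hj : P.angle j = π / 2)
    (hk : ∀ k, k ≠ i → k ≠ j → P.angle k = 2 * π / 3) :
    P.perimeter ^ 2 = 4 * (2 + √3) * P.area := by
  obtain ⟨c, r, h⟩ := hP
  change P.IsIncircle c r at h
  have hconv : ∀ k, P.angle k < π := by
    intro k
    by_cases h1 : k = i
    · rw [h1, hi]; linarith [Real.pi_pos]
    by_cases h2 : k = j
    · rw [h2, hj]; linarith [Real.pi_pos]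
    rw [hk k h1 h2]; linarith [Real.pi_pos]
  have hτ := h.tangentLength_mul_sin hconv
  have hright : ∀ k, P.angle k = π / 2 → P.tangentLength c r k = r := by
    intro k hk
    simpa [hk] using hτ k
  have hobtuse : ∀ k, P.angle k = 2 * π / 3 → P.tangentLength c r k = √3 / 3 * r := by
    intro k hk
    have hk := hτ k
    rw [‹P.angle k = _›, show 2 * π / 3 = π - π / 3 by ring, Real.sin_pi_sub, Real.cos_pi_sub,
      Real.sin_pi_div_three, Real.cos_pi_div_three] at hk
    have h3 : √3 ^ 2 = 3 := Real.sq_sqrt (by norm_num)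
    linear_combination 2 * √3 / 3 * hk - P.tangentLength c r k / 3 * h3
  have hsum : ∑ k, P.tangentLength c r k = (2 + √3) * r := by
    rw [← Finset.add_sum_erase _ _ (Finset.mem_univ i),
      ← Finset.add_sum_erase _ _ (Finset.mem_erase.2 ⟨hij.symm, Finset.mem_univ j⟩),
      hright i hi, hright j hj, Finset.sum_eq_card_nsmul (b := √3 / 3 * r)]
    · rw [Finset.card_erase_of_mem (Finset.mem_erase.2 ⟨hij.symm, Finset.mem_univ j⟩),
        Finset.card_erase_of_mem (Finset.mem_univ i), Finset.card_univ, Fintype.card_fin]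
      norm_num
      ring
    · intro k hkm
      simp only [Finset.mem_erase] at hkm
      exact hobtuse k (hk k hkm.2.1 hkm.1)
  rw [h.area_eq hconv, h.perimeter_eq hconv, hsum]
  ring

theorem perimeter_le_of_sq_perimeter (h : P.perimeter ^ 2 = 4 * (2 + √3) * P.area)
    (ha : P.area = 1) : P.perimeter ≤ 3.8638 := by
  have h3 : √3 ≤ 1.73206 := Real.sqrt_le_iff.2 (by norm_num)
  rw [ha] at h
  nlinarith

theorem IsCairo.perimeter_le (hP : P.IsCairo) (ha : P.area = 1) : P.perimeter ≤ 3.8638 := by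
  obtain ⟨hc, k, h0, h1, h2, h3, h4⟩ := hP
  refine perimeter_le_of_sq_perimeter
    (hc.sq_perimeter (i := k) (j := k + 2) (by clear * -; revert k; decide) h0 h2 ?_) ha
  intro j hj1 hj2
  have hj : j = k + 1 ∨ j = k + 3 ∨ j = k + 4 := by clear * - hj1 hj2; revert j k; decide
  rcases hj with rfl | rfl | rfl <;> assumption

theorem IsPrismatic.perimeter_le (hP : P.IsPrismatic) (ha : P.area = 1) :
    P.perimeter ≤ 3.8638 := by
  obtain ⟨hc, k, h0, h1, h2, h3, h4⟩ := hP
  refine perimeter_le_of_sq_perimeter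
    (hc.sq_perimeter (i := k) (j := k + 1) (by clear * -; revert k; decide) h0 h1 ?_) ha
  intro j hj1 hj2
  have hj : j = k + 2 ∨ j = k + 3 ∨ j = k + 4 := by clear * - hj1 hj2; revert j k; decide
  rcases hj with rfl | rfl | rfl <;> assumption

theorem IsEfficient.perimeter_le (hP : P.IsEfficient) : P.perimeter ≤ 3.8638 := by
  obtain ⟨-, C, hC, hCa, h⟩ := hP
  exact h.trans (hC.perimeter_le hCa)

theorem IsEfficient.lt_angle (hP : P.IsEfficient) (k : Fin 5) : 2 * π / 5 < P.angle k :=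
  lt_angle_of_perimeter_le hP.1 hP.perimeter_le k

end Pentagon

theorem segment_eq_segment {E : Type*} [NormedAddCommGroup E] [NormedSpace ℝ E] {a b c d : E}
    (h : segment ℝ a b = segment ℝ c d) : (a = c ∧ b = d) ∨ (a = d ∧ b = c) := by
  have hdist : dist a b = dist c d := by
    have hdiam := congrArg Metric.diam h
    rwa [← convexHull_pair, ← convexHull_pair, convexHull_diam, convexHull_diam, Metric.diam_pair,
      Metric.diam_pair] at hdiam
  have ha : a ∈ segment ℝ c d := h ▸ left_mem_segment ℝ a b
  have hb : b ∈ segment ℝ c d := h ▸ right_mem_segment ℝ a b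
  rw [segment_eq_image_lineMap] at ha hb
  obtain ⟨s, hs, rfl⟩ := ha
  obtain ⟨t, ht, rfl⟩ := hb
  rcases eq_or_ne c d with rfl | hcd
  · simp only [AffineMap.lineMap_same_apply, true_and, true_or]
  rw [dist_lineMap_lineMap, mul_eq_right₀ (dist_pos.2 hcd).ne', Real.dist_eq,
    abs_eq one_pos.le] at hdist
  rcases hdist with hst | hst
  · obtain rfl : s = 1 := by linarith [hs.2, ht.1]
    obtain rfl : t = 0 := by linarith
    exact Or.inr ⟨AffineMap.lineMap_apply_one c d, AffineMap.lineMap_apply_zero c d⟩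
  · obtain rfl : s = 0 := by linarith [hs.1, ht.2]
    obtain rfl : t = 1 := by linarith
    exact Or.inl ⟨AffineMap.lineMap_apply_zero c d, AffineMap.lineMap_apply_one c d⟩

namespace Pentagon

variable {P Q : Pentagon} {j k l : Fin 5}

theorem mem_translate_region {w z : ℂ} : z ∈ (P.translate w).region ↔ z - w ∈ P.region := by
  rw [sub_eq_neg_add]
  change z ∈ Homeomorph.addLeft w '' P.region ↔ _
  rw [Homeomorph.image_eq_preimage_symm]
  rfl

theorem mem_interior_translate {w z : ℂ} :
    z ∈ interior (P.translate w).region ↔ z - w ∈ interior P.region := by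
  rw [sub_eq_neg_add]
  change z ∈ interior (Homeomorph.addLeft w '' P.region) ↔ _
  rw [← Homeomorph.image_interior, Homeomorph.image_eq_preimage_symm]
  rfl

theorem eq_of_vertex_mem_edge (h : P.vertices k ∈ P.edge j) : j = k ∨ j + 1 = k := by
  by_contra! hne
  exact P.vertex_notMem_edge hne.1 hne.2 h

theorem edge_eq_edge (h : P.edge k = Q.edge l) :
    (P.vertices k = Q.vertices l ∧ P.vertices (k + 1) = Q.vertices (l + 1)) ∨
    (P.vertices k = Q.vertices (l + 1) ∧ P.vertices (k + 1) = Q.vertices l) := by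
  rw [edge_eq_segment, edge_eq_segment] at h
  exact segment_eq_segment h

theorem edgePoint_half_ne_vertex (P : Pentagon) (k j : Fin 5) :
    P.vertices j ≠ P.edgePoint k (1 / 2) := by
  intro h
  have h0 : P.vertices k = P.edgePoint k 0 := by simp [edgePoint]
  have h1 : P.vertices (k + 1) = P.edgePoint k 1 := by simp [edgePoint]
  rcases eq_of_vertex_mem_edge (h ▸ P.edgePoint_half_mem_edge k) with rfl | rfl
  · exact absurd (P.edgePoint_injective k (h0.symm.trans h)) (by norm_num)
  · exact absurd (P.edgePoint_injective k (h1.symm.trans h)) (by norm_num)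

theorem eq_of_edgePoint_half_mem (h : P.edgePoint k (1 / 2) ∈ P.edge j) : k = j :=
  eq_of_mem_edge (P.edgePoint_half_ne_vertex k) (P.edgePoint_half_mem_edge k) h

theorem edge_injective (P : Pentagon) : Function.Injective P.edge := fun j _ h =>
  eq_of_edgePoint_half_mem (h ▸ P.edgePoint_half_mem_edge j)

theorem exists_side_of_edge_eq (h : P.edge k = Q.edge l) : ∃ σ : ℝ, (σ = 1 ∨ σ = -1) ∧
    ∀ᶠ t : ℝ in 𝓝[>] 0, Q.edgePoint l (1 / 2 + t * (σ * Complex.I)) ∈ interior P.region := by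
  obtain ⟨σ, hσ, hside⟩ := P.exists_sideIn k
  have hint := hside.eventually_mem_interior (s := 1 / 2) hσ ⟨by norm_num, by norm_num⟩
  rcases edge_eq_edge h with ⟨h1, h2⟩ | ⟨h1, h2⟩
  · refine ⟨σ, hσ, hint.mono fun t ht => ?_⟩
    convert ht using 1
    simp only [edgePoint, h1, h2]
    push_cast
    ring
  · refine ⟨-σ, by rcases hσ with rfl | rfl <;> norm_num, hint.mono fun t ht => ?_⟩
    convert ht using 1
    simp only [edgePoint, h1, h2]
    push_cast
    ring

end Pentagon

namespace TorusTiling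

variable {Λ : Submodule ℤ ℂ} {ι : Type*}

/-- The tiles of the plane which are the lifts of the tiles of the torus. -/
def lift (T : TorusTiling Λ ι) (p : ι × Λ) : Pentagon := (T.tile p.1).translate p.2

theorem lift_vertices (T : TorusTiling Λ ι) (p : ι × Λ) (k : Fin 5) :
    (T.lift p).vertices k = p.2 + (T.tile p.1).vertices k := rfl

theorem eq_of_mem_interior (T : TorusTiling Λ ι) {p q : ι × Λ} {z : ℂ}
    (hp : z ∈ interior (T.lift p).region) (hq : z ∈ interior (T.lift q).region) : p = q := by
  by_contra hne
  exact Set.disjoint_left.1 (T.disjoint hne) hp hq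

theorem exists_mem_lift (T : TorusTiling Λ ι) (z : ℂ) : ∃ p, z ∈ (T.lift p).region :=
  mem_iUnion.1 (T.cover.symm ▸ mem_univ z)

open scoped Pointwise in
theorem finite_lifts_meeting_closedBall [DiscreteTopology Λ] (T : TorusTiling Λ ι) (i : ι)
    (z : ℂ) (r : ℝ) : {w : Λ | ∃ y ∈ Metric.closedBall z r, y ∈ (T.lift (i, w)).region}.Finite := by
  have hΛ : IsClosed (Λ : Set ℂ) := by
    have : DiscreteTopology Λ.toAddSubgroup := inferInstanceAs (DiscreteTopology Λ)
    exact AddSubgroup.isClosed_of_discrete (H := Λ.toAddSubgroup)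
  have hbounded : Bornology.IsBounded (Metric.closedBall z r - (T.tile i).region) :=
    Metric.isBounded_closedBall.sub (T.tile i).isCompact_region.isBounded
  have hfinite := Metric.finite_isBounded_inter_isClosed
    (DiscreteTopology.isDiscrete : IsDiscrete (Λ : Set ℂ)) hbounded hΛ
  refine Set.Finite.of_finite_image (f := ((↑) : Λ → ℂ)) (hfinite.subset ?_)
    Subtype.val_injective.injOn
  rintro _ ⟨w, ⟨y, hy, hyw⟩, rfl⟩
  exact ⟨⟨y, hy, y - w, Pentagon.mem_translate_region.1 hyw, sub_sub_cancel y w⟩, w.2⟩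

theorem eventually_mem_lift [DiscreteTopology Λ] [Finite ι] (T : TorusTiling Λ ι) (z : ℂ) :
    ∀ᶠ y in 𝓝 z, ∀ p, y ∈ (T.lift p).region → z ∈ (T.lift p).region := by
  have htile : ∀ i, ∀ᶠ y in 𝓝 z, ∀ w ∈ {w : Λ | ∃ y ∈ Metric.closedBall z 1,
      y ∈ (T.lift (i, w)).region}, y ∈ (T.lift (i, w)).region → z ∈ (T.lift (i, w)).region := by
    intro i
    refine (Filter.eventually_all_finite (T.finite_lifts_meeting_closedBall i z 1)).2 fun w _ => ?_
    by_cases hz : z ∈ (T.lift (i, w)).region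
    · exact Eventually.of_forall fun _ _ => hz
    · filter_upwards [(T.lift (i, w)).isClosed_region.isOpen_compl.mem_nhds hz] with y hy hmem
      exact absurd hmem hy
  filter_upwards [Filter.eventually_all.2 htile, Metric.closedBall_mem_nhds z one_pos]
    with y hy hball p hp
  exact hy p.1 p.2 ⟨y, hball, hp⟩ hp

theorem exists_vertex_of_mem (T : TorusTiling Λ ι) {p q : ι × Λ} {k : Fin 5}
    (h : (T.lift p).vertices k ∈ (T.lift q).region) :
    ∃ l, (T.lift q).vertices l = (T.lift p).vertices k := by
  by_cases hpq : p = q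
  · exact ⟨k, by rw [hpq]⟩
  rcases T.edgeToEdge hpq _ ⟨(T.lift p).edge_subset_region k ((T.lift p).vertex_mem_edge k), h⟩ with
    ⟨k', l, -, h2⟩ | ⟨k', l, h1, h2⟩
  · exact ⟨l, h2.symm⟩
  · rcases Pentagon.edge_eq_edge h1 with ⟨e1, e2⟩ | ⟨e1, e2⟩ <;>
      rcases Pentagon.eq_of_vertex_mem_edge h2 with rfl | rfl
    · exact ⟨l, e1.symm⟩
    · exact ⟨l + 1, e2.symm⟩
    · exact ⟨l + 1, e1.symm⟩
    · exact ⟨l, e2.symm⟩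

/-- Two corners of tiles are equivalent if they lie at the same vertex of the torus. -/
def cornerSetoid (T : TorusTiling Λ ι) : Setoid (ι × Fin 5) where
  r c d := (T.tile c.1).vertices c.2 - (T.tile d.1).vertices d.2 ∈ Λ
  iseqv := by
    refine ⟨fun c => by simp, fun {c d} h => ?_, fun {c d e} h h' => ?_⟩
    · simpa using Λ.neg_mem h
    · simpa using Λ.add_mem h h'

theorem eq_of_cornerSetoid (T : TorusTiling Λ ι) {c d : ι × Fin 5} (h : T.cornerSetoid c d) {y : ℂ}
    (hc : (T.tile c.1).vertices c.2 + y ∈ interior (T.tile c.1).region)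
    (hd : (T.tile d.1).vertices d.2 + y ∈ interior (T.tile d.1).region) : c = d := by
  obtain ⟨i, k⟩ := c
  obtain ⟨j, l⟩ := d
  have heq : ((i, 0) : ι × Λ) = (j, ⟨_, h⟩) := by
    refine T.eq_of_mem_interior (z := (T.tile i).vertices k + y) ?_ ?_ <;>
      rw [lift, Pentagon.mem_interior_translate]
    · simpa using hc
    · convert hd using 1
      ring
  obtain ⟨rfl, hzero⟩ := Prod.mk.inj heq
  have hvert : (T.tile i).vertices k = (T.tile i).vertices l :=
    sub_eq_zero.1 (congrArg Subtype.val hzero).symm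
  rw [(T.tile i).vertices_injective hvert]

theorem eventually_exists_corner [DiscreteTopology Λ] [Finite ι] (T : TorusTiling Λ ι)
    (c : ι × Fin 5) : ∀ᶠ y in 𝓝 0, ∃ d, T.cornerSetoid c d ∧
      (T.tile d.1).vertices d.2 + y ∈ (T.tile d.1).region := by
  have htend : Tendsto ((T.tile c.1).vertices c.2 + ·) (𝓝 0) (𝓝 ((T.tile c.1).vertices c.2)) :=
    Continuous.tendsto' (by fun_prop) _ _ (add_zero _)
  filter_upwards [htend.eventually (T.eventually_mem_lift _)] with y hy
  obtain ⟨p, hp⟩ := T.exists_mem_lift ((T.tile c.1).vertices c.2 + y)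
  have hzero : (T.lift (c.1, 0)).vertices c.2 = (T.tile c.1).vertices c.2 := zero_add _
  obtain ⟨l, hl⟩ := T.exists_vertex_of_mem (p := (c.1, 0)) (hzero.symm ▸ hy p hp)
  rw [hzero, lift_vertices] at hl
  refine ⟨(p.1, l), ?_, ?_⟩
  · change (T.tile c.1).vertices c.2 - (T.tile p.1).vertices l ∈ Λ
    rw [← hl, add_sub_cancel_right]
    exact p.2.2
  · rw [lift, Pentagon.mem_translate_region, ← hl] at hp
    convert hp using 1
    ring

theorem aedisjoint_directions (T : TorusTiling Λ ι) {c d : ι × Fin 5} (h : T.cornerSetoid c d)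
    (hne : c ≠ d) : AEDisjoint volume ((T.tile c.1).directions c.2)
      ((T.tile d.1).directions d.2) := by
  rw [AEDisjoint, measure_eq_zero_iff_ae_notMem]
  filter_upwards [(T.tile c.1).ae_direction c.2, (T.tile d.1).ae_direction d.2] with θ hc hd
  rintro ⟨⟨-, hc'⟩, -, hd'⟩
  have hin : ∀ {p q : ℝ → Prop}, (∀ᶠ t in 𝓝[>] 0, p t) →
      ((∀ᶠ t in 𝓝[>] 0, q t) ∨ ∀ᶠ t in 𝓝[>] 0, ¬p t) → ∀ᶠ t in 𝓝[>] 0, q t := fun hp hpq =>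
    hpq.resolve_right fun hnp => (hp.and hnp).exists.elim fun _ ht => ht.2 ht.1
  obtain ⟨t, htc, htd⟩ := ((hin hc' hc).and (hin hd' hd)).exists
  exact hne (T.eq_of_cornerSetoid h htc htd)

theorem ae_exists_mem_directions [DiscreteTopology Λ] [Finite ι] (T : TorusTiling Λ ι)
    (c : ι × Fin 5) : ∀ᵐ θ : ℝ, θ ∈ Ioc (-π) π →
      ∃ d, T.cornerSetoid c d ∧ θ ∈ (T.tile d.1).directions d.2 := by
  filter_upwards [Filter.eventually_all.2 fun d : ι × Fin 5 => (T.tile d.1).ae_direction d.2]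
    with θ hθ hmem
  by_contra! hnot
  have hout : ∀ᶠ t : ℝ in 𝓝[>] 0, ∀ d, T.cornerSetoid c d →
      (T.tile d.1).vertices d.2 + t * Complex.exp (θ * Complex.I) ∉ (T.tile d.1).region := by
    refine Filter.eventually_all.2 fun d => ?_
    rcases hθ d with hd | hd
    · exact Eventually.of_forall fun t hcd =>
        absurd ⟨hmem, hd.mono fun _ ht => interior_subset ht⟩ (hnot d hcd)
    · exact hd.mono fun t ht _ => ht
  have htend : Tendsto (fun t : ℝ => t * Complex.exp (θ * Complex.I)) (𝓝[>] 0) (𝓝 0) := by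
    refine Tendsto.mono_left ?_ nhdsWithin_le_nhds
    exact Continuous.tendsto' (by fun_prop) _ _ (by simp)
  obtain ⟨t, ht, d, hcd, hd⟩ := (hout.and (htend.eventually (T.eventually_exists_corner c))).exists
  exact ht d hcd hd

open Classical in
theorem sum_angle [DiscreteTopology Λ] [Fintype ι] (T : TorusTiling Λ ι) (c : ι × Fin 5) :
    ∑ d with T.cornerSetoid c d, (T.tile d.1).angle d.2 = 2 * π := by
  set S : Finset (ι × Fin 5) := {d | T.cornerSetoid c d} with hS
  have hmem : ∀ d, d ∈ S ↔ T.cornerSetoid c d := fun d => by simp [hS]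
  have hcover : (⋃ d ∈ S, (T.tile d.1).directions d.2 : Set ℝ) =ᵐ[volume] Ioc (-π) π := by
    filter_upwards [T.ae_exists_mem_directions c] with θ hθ
    refine propext ⟨fun h => ?_, fun h => ?_⟩
    · obtain ⟨d, -, hd⟩ := mem_iUnion₂.1 h
      exact hd.1
    · obtain ⟨d, hcd, hd⟩ := hθ h
      exact mem_iUnion₂.2 ⟨d, (hmem d).2 hcd, hd⟩
  have hdisj : Set.Pairwise (S : Set (ι × Fin 5)) (Function.onFun (AEDisjoint volume)
      fun d => (T.tile d.1).directions d.2) := fun d hd d' hd' hne =>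
    T.aedisjoint_directions
      (T.cornerSetoid.trans (T.cornerSetoid.symm ((hmem d).1 hd)) ((hmem d').1 hd')) hne
  calc ∑ d ∈ S, (T.tile d.1).angle d.2
      = volume.real (⋃ d ∈ S, (T.tile d.1).directions d.2) :=
        (measureReal_biUnion_finset₀ hdisj
          (fun d _ => (T.tile d.1).nullMeasurableSet_directions d.2)
          fun d _ => measure_ne_top_of_subset (fun _ hθ => hθ.1) measure_Ioc_lt_top.ne).symm
    _ = 2 * π := by
        rw [measureReal_congr hcover, Real.volume_real_Ioc_of_le (by linarith [Real.pi_pos])]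
        ring

theorem edgeSetoid_iff (T : TorusTiling Λ ι) {e f : ι × Fin 5} : T.edgeSetoid e f ↔
    ∃ w : Λ, (T.lift (e.1, w)).edge e.2 = (T.lift (f.1, 0)).edge f.2 := by
  have hzero : (T.lift (f.1, 0)).edge f.2 = (T.tile f.1).edge f.2 := by
    rw [lift, Pentagon.translate_edge]
    simp
  rw [hzero]
  exact ⟨fun ⟨w, hw, h⟩ => ⟨⟨w, hw⟩, h⟩, fun ⟨w, h⟩ => ⟨w, w.2, h⟩⟩

theorem eq_of_lift_edge_eq (T : TorusTiling Λ ι) {i : ι} {w w' : Λ} {k : Fin 5}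
    (h : (T.lift (i, w)).edge k = (T.lift (i, w')).edge k) : w = w' := by
  rcases Pentagon.edge_eq_edge h with ⟨h1, h2⟩ | ⟨h1, h2⟩ <;>
    simp only [lift_vertices] at h1 h2 <;>
    exact Subtype.ext (by linear_combination (h1 + h2) / 2)

theorem eq_or_eq_of_lift_edge_eq (T : TorusTiling Λ ι) {p q s : ι × Λ} {j k l : Fin 5}
    (hp : (T.lift p).edge j = (T.lift s).edge l) (hq : (T.lift q).edge k = (T.lift s).edge l) :
    p = s ∨ q = s ∨ p = q := by
  obtain ⟨σ, hσ, hs⟩ := Pentagon.exists_side_of_edge_eq (rfl : _ = (T.lift s).edge l)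
  obtain ⟨σ', hσ', hp⟩ := Pentagon.exists_side_of_edge_eq hp
  obtain ⟨σ'', hσ'', hq⟩ := Pentagon.exists_side_of_edge_eq hq
  have hside : σ' = σ ∨ σ'' = σ ∨ σ' = σ'' := by
    rcases hσ with rfl | rfl <;> rcases hσ' with rfl | rfl <;> rcases hσ'' with rfl | rfl <;> simp
  rcases hside with rfl | rfl | rfl
  · obtain ⟨t, htp, hts⟩ := (hp.and hs).exists
    exact Or.inl (T.eq_of_mem_interior htp hts)
  · obtain ⟨t, htq, hts⟩ := (hq.and hs).exists
    exact Or.inr (Or.inl (T.eq_of_mem_interior htq hts))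
  · obtain ⟨t, htp, htq⟩ := (hp.and hq).exists
    exact Or.inr (Or.inr (T.eq_of_mem_interior htp htq))

theorem eq_of_edgeSetoid (T : TorusTiling Λ ι) {e f g : ι × Fin 5} (hf : T.edgeSetoid f e)
    (hg : T.edgeSetoid g e) (hfe : f ≠ e) (hge : g ≠ e) : f = g := by
  obtain ⟨w, hw⟩ := T.edgeSetoid_iff.1 hf
  obtain ⟨w', hw'⟩ := T.edgeSetoid_iff.1 hg
  have hface : ∀ {a b : ι × Fin 5} {u u' : Λ}, (a.1, u) = (b.1, u') →
      (T.lift (a.1, u)).edge a.2 = (T.lift (b.1, u')).edge b.2 → a = b := by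
    rintro ⟨i, k⟩ ⟨j, l⟩ u u' h hedge
    obtain ⟨rfl, rfl⟩ := Prod.mk.inj h
    exact Prod.ext rfl ((T.lift (i, u)).edge_injective hedge)
  rcases T.eq_or_eq_of_lift_edge_eq hw hw' with h | h | h
  · exact absurd (hface h hw) hfe
  · exact absurd (hface h hw') hge
  · exact hface h (hw.trans hw'.symm)

theorem exists_edgeSetoid [DiscreteTopology Λ] [Finite ι] (T : TorusTiling Λ ι) (e : ι × Fin 5) :
    ∃ f, f ≠ e ∧ T.edgeSetoid f e := by
  set P := T.lift (e.1, 0) with hP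
  obtain ⟨σ, hσ, hside⟩ := P.exists_sideIn e.2
  have hout := hside.eventually_notMem (s := 1 / 2) hσ ⟨by norm_num, by norm_num⟩
  push_cast at hout
  have htend : Tendsto (fun t : ℝ => P.edgePoint e.2 (1 / 2 + t * (-σ * Complex.I))) (𝓝[>] 0)
      (𝓝 (P.edgePoint e.2 (1 / 2))) := by
    refine Tendsto.mono_left ?_ nhdsWithin_le_nhds
    exact Continuous.tendsto' ((P.continuous_edgePoint e.2).comp (by fun_prop)) _ _ (by simp)
  obtain ⟨t, ht, hnear⟩ := (hout.and (htend.eventually (T.eventually_mem_lift _))).exists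
  obtain ⟨p, hp⟩ := T.exists_mem_lift (P.edgePoint e.2 (1 / 2 + t * (-σ * Complex.I)))
  have hne : (e.1, 0) ≠ p := by
    rintro rfl
    exact ht hp
  have hmid := P.edgePoint_half_mem_edge e.2
  rcases T.edgeToEdge hne _ ⟨P.edge_subset_region _ hmid, hnear p hp⟩ with
    ⟨k, l, hk, -⟩ | ⟨k, l, hedge, hk⟩
  · exact absurd hk.symm (P.edgePoint_half_ne_vertex _ _)
  · obtain rfl := Pentagon.eq_of_edgePoint_half_mem hk
    have hedge : (T.lift p).edge l = (T.lift (e.1, 0)).edge e.2 := hedge.symm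
    refine ⟨(p.1, l), ?_, T.edgeSetoid_iff.2 ⟨p.2, hedge⟩⟩
    rintro rfl
    exact hne (Prod.ext rfl (T.eq_of_lift_edge_eq hedge).symm)

theorem exists_corner_of_edgeSetoid (T : TorusTiling Λ ι) {e f : ι × Fin 5}
    (h : T.edgeSetoid f e) (hne : f ≠ e) {k : Fin 5} (hk : k = e.2 ∨ k = e.2 + 1) :
    ∃ l, (f.1, l) ≠ (e.1, k) ∧ T.cornerSetoid (e.1, k) (f.1, l) := by
  obtain ⟨i, m⟩ := e
  obtain ⟨j, n⟩ := f
  obtain ⟨w, hw⟩ := T.edgeSetoid_iff.1 h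
  obtain ⟨l, hl⟩ : ∃ l, w + (T.tile j).vertices l = (T.tile i).vertices k := by
    rcases Pentagon.edge_eq_edge hw with ⟨h1, h2⟩ | ⟨h1, h2⟩ <;>
      simp only [lift_vertices, ZeroMemClass.coe_zero, zero_add] at h1 h2 <;>
      rcases hk with rfl | rfl
    · exact ⟨_, h1⟩
    · exact ⟨_, h2⟩
    · exact ⟨_, h2⟩
    · exact ⟨_, h1⟩
  refine ⟨l, ?_, ?_⟩
  · intro heq
    obtain ⟨rfl, rfl⟩ := Prod.mk.inj heq
    obtain rfl : w = 0 := Subtype.ext (add_eq_right.1 hl)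
    exact hne (by rw [show n = m from (T.lift (j, 0)).edge_injective hw])
  · change (T.tile i).vertices k - (T.tile j).vertices l ∈ Λ
    rw [← hl, add_sub_cancel_right]
    exact w.2

/-- The other side of an edge: the edge of the tile across it. -/
noncomputable def opposite [DiscreteTopology Λ] [Finite ι] (T : TorusTiling Λ ι)
    (e : ι × Fin 5) : ι × Fin 5 := (T.exists_edgeSetoid e).choose

theorem opposite_ne [DiscreteTopology Λ] [Finite ι] (T : TorusTiling Λ ι) (e : ι × Fin 5) :
    T.opposite e ≠ e := (T.exists_edgeSetoid e).choose_spec.1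

theorem edgeSetoid_opposite [DiscreteTopology Λ] [Finite ι] (T : TorusTiling Λ ι)
    (e : ι × Fin 5) : T.edgeSetoid (T.opposite e) e := (T.exists_edgeSetoid e).choose_spec.2

theorem opposite_involutive [DiscreteTopology Λ] [Finite ι] (T : TorusTiling Λ ι) :
    Function.Involutive T.opposite := fun e =>
  T.eq_of_edgeSetoid (T.edgeSetoid_opposite _) (T.edgeSetoid.symm (T.edgeSetoid_opposite e))
    (T.opposite_ne _) (T.opposite_ne e).symm

open Classical in
theorem card_edgeSetoid_fiber_le_two [Fintype ι] (T : TorusTiling Λ ι) (q : T.Edge) :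
    (Finset.univ.filter fun e => Quotient.mk T.edgeSetoid e = q).card ≤ 2 := by
  by_contra! hlt
  obtain ⟨a, b, c, ha, hb, hc, hab, hac, hbc⟩ := Finset.two_lt_card_iff.1 hlt
  have ha := (Finset.mem_filter.1 ha).2
  have hb := (Finset.mem_filter.1 hb).2
  have hc := (Finset.mem_filter.1 hc).2
  exact hbc (T.eq_of_edgeSetoid (e := a) (Quotient.exact (hb.trans ha.symm))
    (Quotient.exact (hc.trans ha.symm)) hab.symm hac.symm)

theorem sum_perimeter_le [Fintype ι] (T : TorusTiling Λ ι) :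
    ∑ i, (T.tile i).perimeter ≤ 2 * T.perimeter := by
  classical
  have : Finite T.Edge := Quotient.finite _
  have := Fintype.ofFinite T.Edge
  calc ∑ i, (T.tile i).perimeter
      = ∑ e : ι × Fin 5, T.edgeLength (Quotient.mk T.edgeSetoid e) :=
        by rw [Fintype.sum_prod_type]; rfl
    _ = ∑ q : T.Edge, ∑ e with Quotient.mk T.edgeSetoid e = q,
          T.edgeLength (Quotient.mk T.edgeSetoid e) :=
        (Finset.sum_fiberwise (κ := T.Edge) _ (fun e => Quotient.mk T.edgeSetoid e) _).symm
    _ ≤ ∑ q : T.Edge, 2 * T.edgeLength q := by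
        refine Finset.sum_le_sum fun q _ => ?_
        have hlen : 0 ≤ T.edgeLength q := Quotient.inductionOn q fun _ => dist_nonneg
        rw [Finset.sum_congr rfl (g := fun _ => T.edgeLength q)
          (fun e he => by rw [(Finset.mem_filter.1 he).2]), Finset.sum_const, nsmul_eq_mul]
        exact mul_le_mul_of_nonneg_right (by exact_mod_cast T.card_edgeSetoid_fiber_le_two q) hlen
    _ = 2 * T.perimeter := by rw [perimeter, finsum_eq_sum_of_fintype, Finset.mul_sum]

end TorusTiling

theorem five_add_four_mul_card_le_of_endpoints {A B : Finset (Fin 5)} (hB : B.Nonempty)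
    (h : ∀ k ∈ A, k ∈ B ∧ k + 1 ∈ B) : 5 + 4 * A.card ≤ 5 * B.card := by
  revert A B
  decide

theorem sum_card_div_card_eq {α : Type*} [Fintype α] (r : Setoid α) [DecidableRel r]
    (p q : α → Prop) [DecidablePred p] [DecidablePred q] :
    ∑ c with q c, ({d | r c d ∧ p d} : Finset α).card / (({d | r c d ∧ q d} : Finset α).card : ℝ) =
      ({d | p d ∧ ∃ c, r d c ∧ q c} : Finset α).card := by
  set N : α → ℝ := fun c => ({d | r c d ∧ q d} : Finset α).card with hN
  have hcongr : ∀ {c d}, r c d → N c = N d := fun {c d} h => by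
    have hiff : ∀ e, r c e ↔ r d e := fun e => ⟨r.trans (r.symm h), r.trans h⟩
    simp only [hN, hiff]
  calc ∑ c with q c, ({d | r c d ∧ p d} : Finset α).card / N c
      = ∑ c with q c, ∑ d with p d, if r c d then 1 / N d else 0 := by
        refine Finset.sum_congr rfl fun c _ => ?_
        rw [← Finset.sum_filter, Finset.filter_filter,
          Finset.sum_congr rfl fun d hd => by rw [← hcongr (Finset.mem_filter.1 hd).2.2],
          Finset.sum_const, nsmul_eq_mul, mul_one_div]
        simp only [and_comm]
    _ = ∑ d with p d, N d * (1 / N d) := by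
        rw [Finset.sum_comm]
        refine Finset.sum_congr rfl fun d _ => ?_
        rw [← Finset.sum_filter, Finset.filter_filter, Finset.sum_const, nsmul_eq_mul]
        simp only [hN, and_comm, r.comm' (x := d)]
    _ = ∑ d with p d, if ∃ c, r d c ∧ q c then 1 else 0 := by
        refine Finset.sum_congr rfl fun d _ => ?_
        have hzero : N d ≠ 0 ↔ ∃ c, r d c ∧ q c := by
          simp [hN, Finset.filter_eq_empty_iff]
        split_ifs with h
        · exact mul_one_div_cancel (hzero.2 h)
        · rw [not_ne_iff.1 (mt hzero.1 h), zero_mul]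
    _ = _ := by rw [Finset.sum_boole, Finset.filter_filter]

theorem card_filter_and_comp_eq {α : Type*} [Fintype α] {f : α → α} (hf : Function.Involutive f)
    (p q : α → Prop) [DecidablePred p] [DecidablePred q] : ({e | p e ∧ q (f e)} : Finset α).card =
      ({e | q e ∧ p (f e)} : Finset α).card :=
  Finset.card_equiv hf.toPerm fun e => by simp [hf e, and_comm]

theorem sum_filter_fst_eq {α β : Type*} [Fintype α] [Fintype β] (p : α → Prop) [DecidablePred p]
    (f : α × β → ℝ) : ∑ c with p c.1, f c = ∑ i with p i, ∑ k, f (i, k) := by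
  rw [Finset.sum_filter, Finset.sum_filter, Fintype.sum_prod_type]
  refine Finset.sum_congr rfl fun i _ => ?_
  split_ifs
  · rfl
  · exact Finset.sum_const_zero

theorem card_filter_fst_eq {α β : Type*} [Fintype α] [Fintype β] (p : α → Prop) [DecidablePred p]
    (q : α × β → Prop) [DecidablePred q] : (({c | p c.1 ∧ q c} : Finset (α × β)).card : ℝ) =
      ∑ i with p i, (({k | q (i, k)} : Finset β).card : ℝ) := by
  rw [← Finset.filter_filter, Finset.natCast_card_filter, sum_filter_fst_eq]
  simp only [Finset.natCast_card_filter]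

theorem five_mul_div_le {p q m x y : ℝ} (hp : 0 ≤ p) (hpm : p ≤ m) (hm : 8 / 5 ≤ m) (hx : 0 ≤ x)
    (hy : 0 ≤ y) (hq : 1 ≤ q) (h : x = 1 ∧ y = 1 ∨ 2 ≤ q) :
    5 * (p / q) ≤ 2 * x + 2 * y + (5 * m - 4) := by
  rcases h with ⟨rfl, rfl⟩ | h
  · linarith [(div_le_self hp hq).trans hpm]
  · linarith [div_le_div₀ (hp.trans hpm) hpm two_pos h]

namespace TorusTiling

variable {Λ : Submodule ℤ ℂ} {ι : Type*} [Fintype ι] (T : TorusTiling Λ ι) {E : ι → Prop}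
  {i : ι} {k l : Fin 5}

open Classical in
/-- The corners of tiles satisfying `E` at the vertex of the torus at which the corner `c` lies. -/
noncomputable def cornersAt (E : ι → Prop) (c : ι × Fin 5) : Finset (ι × Fin 5) :=
  {d | T.cornerSetoid c d ∧ E d.1}

theorem mem_cornersAt {c d : ι × Fin 5} :
    d ∈ T.cornersAt E c ↔ T.cornerSetoid c d ∧ E d.1 := by
  simp [cornersAt]

open Classical in
theorem le_sum_perimeter {E : ι → Prop} (harea : ∀ i, (T.tile i).area = 1)
    (h2 : ∀ i, ¬E i → (T.tile i).IsType2) :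
    3.811 * ({i | E i} : Finset ι).card + 4.5589 * ({i | ¬E i} : Finset ι).card ≤
      ∑ i, (T.tile i).perimeter := by
  rw [← Finset.sum_filter_add_sum_filter_not Finset.univ E, mul_comm, ← nsmul_eq_mul,
    mul_comm (4.5589 : ℝ), ← nsmul_eq_mul]
  exact add_le_add
    (Finset.card_nsmul_le_sum _ _ _ fun i _ => Pentagon.le_perimeter (harea i))
    (Finset.card_nsmul_le_sum _ _ _ fun i hi =>
      Pentagon.le_perimeter_of_isType2 (harea i) (h2 i (Finset.mem_filter.1 hi).2))

variable [DiscreteTopology Λ]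

open Classical in
theorem card_cornersAt_mul_add_angle_le (hE : ∀ i, E i → ∀ k, 2 * π / 5 < (T.tile i).angle k)
    (hi : ¬E i) : (T.cornersAt E (i, k)).card * (2 * π / 5) + (T.tile i).angle k ≤ 2 * π := by
  have hsum := T.sum_angle (i, k)
  rw [← Finset.sum_filter_add_sum_filter_not _ fun d => E d.1, Finset.filter_filter,
    Finset.filter_filter] at hsum
  refine (add_le_add ?_ ?_).trans hsum.le
  · rw [← nsmul_eq_mul]
    exact Finset.card_nsmul_le_sum _ _ _ fun d hd => (hE d.1 (T.mem_cornersAt.1 hd).2 d.2).le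
  · exact Finset.single_le_sum (f := fun d : ι × Fin 5 => (T.tile d.1).angle d.2)
      (fun d _ => ((T.tile d.1).angle_mem_Ioo d.2).1.le)
      (Finset.mem_filter.2 ⟨Finset.mem_univ (i, k), T.cornerSetoid.refl _, hi⟩)

open Classical in
theorem card_cornersAt_le (hE : ∀ i, E i → ∀ k, 2 * π / 5 < (T.tile i).angle k) (hi : ¬E i) :
    (T.cornersAt E (i, k)).card ≤ if π < (T.tile i).angle k then 2 else 4 := by
  have hangle := T.card_cornersAt_mul_add_angle_le (k := k) hE hi
  have hpos := ((T.tile i).angle_mem_Ioo k).1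
  have hpi := Real.pi_pos
  split_ifs with hreflex <;> by_contra! hlt
  · have hcard : (3 : ℝ) ≤ (T.cornersAt E (i, k)).card := by exact_mod_cast hlt
    nlinarith
  · have hcard : (5 : ℝ) ≤ (T.cornersAt E (i, k)).card := by exact_mod_cast hlt
    nlinarith

theorem two_le_card_cornersAt (hi : E i) (hl : E (T.opposite (i, l)).1)
    (hk : k = l ∨ k = l + 1) : 2 ≤ (T.cornersAt E (i, k)).card := by
  obtain ⟨m, hne, hm⟩ :=
    T.exists_corner_of_edgeSetoid (T.edgeSetoid_opposite (i, l)) (T.opposite_ne (i, l)) hk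
  exact Finset.one_lt_card.2 ⟨_, T.mem_cornersAt.2 ⟨T.cornerSetoid.refl _, hi⟩, _,
    T.mem_cornersAt.2 ⟨hm, hl⟩, hne.symm⟩

open Classical in
theorem five_mul_card_cornersAt_div_le (hE : ∀ i, E i → ∀ k, 2 * π / 5 < (T.tile i).angle k)
    (hi : ¬E i) : 5 * ((T.cornersAt E (i, k)).card / (T.cornersAt (¬E ·) (i, k)).card : ℝ) ≤
      2 * (if E (T.opposite (i, k)).1 then 1 else 0) +
      2 * (if E (T.opposite (i, k - 1)).1 then 1 else 0) +
      (if π < (T.tile i).angle k then 6 else 16) := by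
  have hself : (i, k) ∈ T.cornersAt (¬E ·) (i, k) := T.mem_cornersAt.2 ⟨T.cornerSetoid.refl _, hi⟩
  have hpos : (1 : ℝ) ≤ (T.cornersAt (¬E ·) (i, k)).card := by
    exact_mod_cast Finset.card_pos.2 ⟨_, hself⟩
  have htwo : ∀ l, k = l ∨ k = l + 1 → ¬E (T.opposite (i, l)).1 →
      (2 : ℝ) ≤ (T.cornersAt (¬E ·) (i, k)).card := fun l hl hEl => by
    exact_mod_cast T.two_le_card_cornersAt (E := (¬E ·)) hi hEl hl
  have hcard : ((T.cornersAt E (i, k)).card : ℝ) ≤ if π < (T.tile i).angle k then 2 else 4 := by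
    exact_mod_cast T.card_cornersAt_le hE hi
  convert five_mul_div_le (Nat.cast_nonneg _) hcard ?_ ?_ ?_ hpos ?_ using 2
  · split_ifs <;> norm_num
  · split_ifs <;> norm_num
  · split_ifs <;> norm_num
  · split_ifs <;> norm_num
  · by_cases h : E (T.opposite (i, k)).1
    · by_cases h' : E (T.opposite (i, k - 1)).1
      · exact Or.inl ⟨if_pos h, if_pos h'⟩
      · exact Or.inr (htwo _ (Or.inr (sub_add_cancel k 1).symm) h')
    · exact Or.inr (htwo _ (Or.inl rfl) h)

open Classical in
theorem five_mul_sum_card_cornersAt_div_le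
    (hE : ∀ i, E i → ∀ k, 2 * π / 5 < (T.tile i).angle k) (hi : ¬E i) (h2 : (T.tile i).IsType2) :
    5 * ∑ k, ((T.cornersAt E (i, k)).card / (T.cornersAt (¬E ·) (i, k)).card : ℝ) ≤
      4 * ({k | E (T.opposite (i, k)).1} : Finset (Fin 5)).card + 60 := by
  set x : Fin 5 → ℝ := fun k => if E (T.opposite (i, k)).1 then 1 else 0 with hx
  have hshift : ∑ k, x (k - 1) = ∑ k, x k := Equiv.sum_comp (Equiv.subRight (1 : Fin 5)) x
  have hreflex : ∑ k, (if π < (T.tile i).angle k then 6 else 16 : ℝ) = 60 := by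
    have hcard : ({k | π < (T.tile i).angle k} : Finset (Fin 5)).card = 2 := by
      rw [← h2, ← Set.ncard_coe_finset]
      simp
    have hite : ∀ k, (if π < (T.tile i).angle k then 6 else 16 : ℝ) =
        16 - 10 * if π < (T.tile i).angle k then 1 else 0 := fun k => by
      split_ifs <;> norm_num
    rw [Finset.sum_congr rfl fun k _ => hite k, Finset.sum_sub_distrib, ← Finset.mul_sum,
      Finset.sum_boole, hcard]
    norm_num
  calc 5 * ∑ k, ((T.cornersAt E (i, k)).card / (T.cornersAt (¬E ·) (i, k)).card : ℝ)
      ≤ ∑ k, (2 * x k + 2 * x (k - 1) + if π < (T.tile i).angle k then 6 else 16) := by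
        rw [Finset.mul_sum]
        exact Finset.sum_le_sum fun k _ => T.five_mul_card_cornersAt_div_le hE hi
    _ = 4 * ∑ k, x k + 60 := by
        rw [Finset.sum_add_distrib, Finset.sum_add_distrib, ← Finset.mul_sum, ← Finset.mul_sum,
          hshift, hreflex]
        ring
    _ = _ := by rw [hx, Finset.sum_boole]

open Classical in
theorem five_add_four_mul_card_opposite_le
    (h : ∃ k d, T.cornerSetoid (i, k) d ∧ ¬E d.1) :
    5 + 4 * ({k | ¬E (T.opposite (i, k)).1} : Finset (Fin 5)).card ≤
      5 * ({k | ∃ d, T.cornerSetoid (i, k) d ∧ ¬E d.1} : Finset (Fin 5)).card := by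
  obtain ⟨k, hk⟩ := h
  refine five_add_four_mul_card_le_of_endpoints
    ⟨k, Finset.mem_filter.2 ⟨Finset.mem_univ _, hk⟩⟩ fun l hl => ?_
  have hmixed : ∀ k, k = l ∨ k = l + 1 → ∃ d, T.cornerSetoid (i, k) d ∧ ¬E d.1 := by
    intro k hk
    obtain ⟨m, -, hm⟩ :=
      T.exists_corner_of_edgeSetoid (T.edgeSetoid_opposite (i, l)) (T.opposite_ne (i, l)) hk
    exact ⟨_, hm, (Finset.mem_filter.1 hl).2⟩
  exact ⟨Finset.mem_filter.2 ⟨Finset.mem_univ _, hmixed l (Or.inl rfl)⟩,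
    Finset.mem_filter.2 ⟨Finset.mem_univ _, hmixed (l + 1) (Or.inr rfl)⟩⟩

open Classical in
theorem card_filter_le_twelve_mul (hE : ∀ i, E i → ∀ k, 2 * π / 5 < (T.tile i).angle k)
    (h2 : ∀ i, ¬E i → (T.tile i).IsType2)
    (hmixed : ∀ i, E i → ∃ k d, T.cornerSetoid (i, k) d ∧ ¬E d.1) :
    ({i | E i} : Finset ι).card ≤ 12 * ({i | ¬E i} : Finset ι).card := by
  have hcorners := sum_card_div_card_eq T.cornerSetoid (fun c => E c.1) (fun c => ¬E c.1)
  have hedges : (_ : ℝ) = _ := congrArg Nat.cast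
    (card_filter_and_comp_eq T.opposite_involutive (fun e => E e.1) (fun e => ¬E e.1))
  rw [sum_filter_fst_eq (fun i => ¬E i),
    card_filter_fst_eq E fun d => ∃ c, T.cornerSetoid d c ∧ ¬E c.1] at hcorners
  rw [card_filter_fst_eq E fun e => ¬E (T.opposite e).1,
    card_filter_fst_eq (fun i => ¬E i) fun e => E (T.opposite e).1] at hedges
  have hsumE := Finset.sum_le_sum fun i (hi : i ∈ Finset.univ.filter E) => Nat.cast_le (α := ℝ).2 <|
    T.five_add_four_mul_card_opposite_le (hmixed i (Finset.mem_filter.1 hi).2)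
  have hsum2 := Finset.sum_le_sum fun i (hi : i ∈ Finset.univ.filter (¬E ·)) =>
    T.five_mul_sum_card_cornersAt_div_le hE (Finset.mem_filter.1 hi).2
      (h2 i (Finset.mem_filter.1 hi).2)
  push_cast at hsumE
  simp only [Finset.sum_add_distrib, ← Finset.mul_sum, Finset.sum_const, nsmul_eq_mul]
    at hsumE hsum2
  simp only [cornersAt] at hsum2
  have hreal : ((Finset.univ.filter E).card : ℝ) ≤ 12 * (Finset.univ.filter (¬E ·)).card := by
    linarith
  exact_mod_cast hreal

end TorusTiling

namespace TorusTiling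

variable {Λ : Submodule ℤ ℂ} {ι : Type*}

theorem nonempty_index (T : TorusTiling Λ ι) : Nonempty ι :=
  (T.exists_mem_lift 0).nonempty.map Prod.fst

variable [DiscreteTopology Λ] [Finite ι] (T : TorusTiling Λ ι)

open Classical in
theorem angleTiles_of_forall_isEfficient (c : T.EfficientCorner)
    (h : ∀ d, T.cornerSetoid (c.1.1, c.2) d → (T.tile d.1).IsEfficient) :
    AngleTiles T.cornerAngle c := by
  let g : T.EfficientCorner → ι × Fin 5 := fun e => (e.1.1, e.2)
  have hg : Function.Injective g := fun _ _ h =>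
    Prod.ext (Subtype.ext (congrArg (fun d : ι × Fin 5 => d.1) h))
      (congrArg (fun d : ι × Fin 5 => d.2) h)
  have := Fintype.ofFinite ι
  have : Finite T.EfficientCorner := Finite.of_injective g hg
  have := Fintype.ofFinite T.EfficientCorner
  refine ⟨Finsupp.equivFunOnFinite.symm
    (fun e => if T.cornerSetoid (g c) (g e) then 1 else 0), by simp, ?_⟩
  have himage : (Finset.univ.filter fun d => T.cornerSetoid (g c) d) =
      (Finset.univ.filter fun e => T.cornerSetoid (g c) (g e)).image g := by
    ext d
    simp only [Finset.mem_filter, Finset.mem_univ, true_and, Finset.mem_image]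
    refine ⟨fun hd => ⟨(⟨d.1, h d hd⟩, d.2), hd, rfl⟩, ?_⟩
    rintro ⟨e, he, rfl⟩
    exact he
  rw [Finsupp.sum_fintype _ _ (by simp), ← T.sum_angle (g c), himage, Finset.sum_image hg.injOn,
    Finset.sum_filter]
  refine Finset.sum_congr rfl fun e _ => ?_
  by_cases he : T.cornerSetoid (g c) (g e) <;> simp [he, cornerAngle, g]

theorem exists_corner_not_isEfficient {i : ι} (hi : (T.tile i).IsEfficient)
    (hfour : {k | AngleTiles T.cornerAngle (⟨i, hi⟩, k)}.ncard ≤ 4) :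
    ∃ k d, T.cornerSetoid (i, k) d ∧ ¬(T.tile d.1).IsEfficient := by
  by_contra! hall
  have huniv : {k | AngleTiles T.cornerAngle (⟨i, hi⟩, k)} = univ :=
    eq_univ_of_forall fun k => T.angleTiles_of_forall_isEfficient (⟨i, hi⟩, k) (hall k)
  rw [huniv, ncard_univ, Nat.card_eq_fintype_card, Fintype.card_fin] at hfour
  omega

end TorusTiling

theorem proposition2p13 (Λ : Submodule ℤ ℂ) [DiscreteTopology Λ] [IsZLattice ℝ Λ]
    {ι : Type*} [Finite ι] (T : TorusTiling Λ ι)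
    (harea : ∀ i, (T.tile i).area = 1)
    (htypes : ∀ i, (T.tile i).IsEfficient ∨ (T.tile i).IsType2)
    (hfour : ∀ (i : ι) (hi : (T.tile i).IsEfficient),
      {k : Fin 5 | AngleTiles T.cornerAngle (⟨i, hi⟩, k)}.ncard ≤ 4)
    (Q : Pentagon) (hQ : Q.IsPrismatic) (hQarea : Q.area = 1) :
    Q.perimeter / 2 < T.perimeterPerTile := by
  classical
  have := Fintype.ofFinite ι
  have := T.nonempty_index
  let E : ι → Prop := fun i => (T.tile i).IsEfficient
  have htype2 : ∀ i, ¬E i → (T.tile i).IsType2 := fun i => (htypes i).resolve_left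
  have hcount : (Finset.univ.filter E).card ≤ 12 * (Finset.univ.filter (¬E ·)).card :=
    T.card_filter_le_twelve_mul (fun _ hi => hi.lt_angle) htype2
      fun i hi => T.exists_corner_not_isEfficient hi (hfour i hi)
  have hcard : (Finset.univ.filter E).card + (Finset.univ.filter (¬E ·)).card = Nat.card ι := by
    rw [Finset.card_filter_add_card_filter_not, Finset.card_univ, Nat.card_eq_fintype_card]
  have hpos : 0 < Nat.card ι := Nat.card_pos
  have hone : (1 : ℝ) ≤ (Finset.univ.filter (¬E ·)).card := by exact_mod_cast (by omega)
  have hcount : (_ : ℝ) ≤ _ := Nat.cast_le.2 hcount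
  push_cast at hcount
  rw [TorusTiling.perimeterPerTile, lt_div_iff₀ (by exact_mod_cast hpos), ← hcard, Nat.cast_add]
  nlinarith [hQ.perimeter_le hQarea, T.sum_perimeter_le, T.le_sum_perimeter harea htype2]
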